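/- **Conventions.** Algebras are associative algebras over $\mathbb C$, possibly without unit, with non-degenerate product; $\otimes=\otimes_{\mathbb C}$ and $M(A)$ is the multiplier algebra of $A$. A *multiplier Hopf algebra* is an algebra $A$ with a non-degenerate coassociative homomorphism $\Delta:A\to M(A\otimes A)$ such that $T_1(a\otimes a')=\Delta(a)(1\otimes a')$ and $T_2(a\otimes a')=(a\otimes 1)\Delta(a')$ are bijections of $A\otimes A$ onto itself; it is *regular* if the opposite coproduct also makes $A$ into a multiplier Hopf algebra. Its counit and antipode are denoted by $\varepsilon$ and $S$. We write $\Delta(a)=\sum a_{(1)}\otimes a_{(2)}$. Let $A$ and $B$ be regular multiplier Hopf algebras. **Action.** Let $B$ be a right $A$-module algebra: there is a right action $B\otimes A\to B$, $b\otimes a\mapsto b\triangleleft a$, which is unital (the elements $b\triangleleft a$ span $B$) and satisfies $bb'\triangleleft a=\sum (b\triangleleft a_{(1)})(b'\triangleleft a_{(2)})$. Put $R(b\otimes a)=\sum a_{(1)}\otimes (b\triangleleft a_{(2)})$ and $R^{\mathrm{op}}(b\otimes a)=\sum a_{(2)}\otimes(b\triangleleft a_{(1)})$, linear maps $B\otimes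 A\to A\otimes B$. The *smash product* $AB$ is the space $A\otimes B$, with $a\otimes b$ written $ab$, with the product $(ab)(a'b')=\sum aa'_{(1)}(b\triangleleft a'_{(2)})b'$; in it, $ba=R(b\otimes a)$ under the identification $A\otimes B=AB$. **Coaction.** Let $M_0(B\otimes A)$ be the completion of the $B$-bimodule $B\otimes A$ (multiplication in the first factor); its elements $y$ are such that $(b\otimes1)y$ and $y(b\otimes 1)$ are in $B\otimes A$ for all $b\in B$. Let $A$ be a left $B$-comodule coalgebra: there is an injective linear map $\Gamma:A\to M_0(B\otimes A)$, $\Gamma(a)=\sum a_{(-1)}\otimes a_{(0)}$, with $(\iota\otimes\Gamma)\Gamma=(\Delta_B\otimes\iota)\Gamma$, and, with the maps $T(a\otimes b)=\Gamma(a)(b\otimes 1)$ and $T^{\mathrm{op}}(a\otimes b)=(b\otimes 1)\Gamma(a)$ from $A\otimes B$ to $B\otimes A$, the elements $((\iota\otimes T)(\Delta_A(a)\otimes b))(1\otimes1\otimes a')$ and $(1\otimes1\otimes a')((\iota\otimes T)(\Delta_A(a)\otimes b))$ lie in $A\otimes B\otimes A$ for all $a,a'\in A$, $b\in B$, and $(\iota\otimes\Delta_A)T=(T\otimes\iota)(\iota\otimes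 T)(\Delta_A\otimes\iota)$ on $A\otimes B$. **Compatibility.** Put $P=T^{\mathrm{op}}\circ R^{\mathrm{op}}$ on $B\otimes A$, that is $P(b\otimes a)=\sum((b\triangleleft a_{(1)})\otimes1)\Gamma(a_{(2)})$, and assume, with leg numbering notation and $m_A$ the product of $A$, $$P(\iota\otimes m_A)=(\iota\otimes m_A)P_{13}P_{12}\ \text{ on } B\otimes A\otimes A,\qquad (\Delta_B\otimes\iota)P=P_{23}P_{13}(\Delta_B\otimes\iota)\ \text{ on } B\otimes A,\qquad T\circ R=T^{\mathrm{op}}\circ R^{\mathrm{op}}.$$ **Theorem.** There is a unique linear map $\Delta_\#:AB\to M(AB\otimes AB)$ given by $\Delta_\#(ab)=\sum(a_{(1)}\otimes1)\Gamma(a_{(2)})\Delta_B(b)$, in the sense that $$(a'\otimes1)\Delta_\#(ab)(1\otimes b')=(\iota\otimes T\otimes\iota)\big((a'\otimes1)\Delta_A(a)\otimes\Delta_B(b)(1\otimes b')\big)$$ in $AB\otimes AB=A\otimes B\otimes A\otimes B$ for all $a,a'\in A$ and $b,b'\in B$. The pair $(AB,\Delta_\#)$ is a regular multiplier Hopf algebra.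 Its counit is $$\varepsilon_\#(ab)=\varepsilon_A(a)\varepsilon_B(b)$$ and its antipode is $$S_\#(ab)=\sum S_B(b)S_B(a_{(-1)})S_A(a_{(0)}),$$ where $\sum a_{(-1)}b\otimes a_{(0)}=\Gamma(a)(b\otimes1)$ and the product of the elements of $B$ and of $A$ is taken in $AB$. -/

import Mathlib

open scoped TensorProduct

namespace MultiplierHopf

universe u v

section Algebras

variable (A : Type u) [NonUnitalNonAssocRing A] [Module ℂ A] [IsScalarTower ℂ A A]
  [SMulCommClass ℂ A A]

/-- The multiplier algebra `M(A)` of an algebra `A` (not necessarily unital), as the algebra of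
double centralizers: pairs `(L, R)` of linear maps, `L x = m x` and `R x = x m`, with
`L (a b) = L a b`, `R (a b) = a R b` and `R a * b = a * L b`. The product of `m` and `m'`
is `(L ∘ L', R' ∘ R)`. -/
def Multiplier : Subalgebra ℂ (Module.End ℂ A × (Module.End ℂ A)ᵐᵒᵖ) where
  carrier := {m | (∀ a b, m.1 (a * b) = m.1 a * b) ∧ (∀ a b, m.2.unop (a * b) = a * m.2.unop b) ∧
    ∀ a b, m.2.unop a * b = a * m.1 b}
  mul_mem' := by
    rintro m m' ⟨h1, h2, h3⟩ ⟨h1', h2', h3'⟩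
    refine ⟨fun a b => ?_, fun a b => ?_, fun a b => ?_⟩
    · simp [h1, h1']
    · simp [h2, h2']
    · simp [h3, h3']
  add_mem' := by
    rintro m m' ⟨h1, h2, h3⟩ ⟨h1', h2', h3'⟩
    refine ⟨fun a b => ?_, fun a b => ?_, fun a b => ?_⟩
    · simp [h1, h1', add_mul]
    · simp [h2, h2', mul_add]
    · simp [h3, h3', add_mul, mul_add]
  algebraMap_mem' := by
    intro r
    refine ⟨fun a b => ?_, fun a b => ?_, fun a b => ?_⟩
    · simp [Algebra.algebraMap_eq_smul_one, smul_mul_assoc]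
    · simp [Algebra.algebraMap_eq_smul_one, mul_smul_comm]
    · simp [Algebra.algebraMap_eq_smul_one, mul_smul_comm, smul_mul_assoc]

variable {A}

/-- `lmul m x` is the element `m x` of `A`, for `m ∈ M(A)` and `x ∈ A`. -/
def lmul (m : Multiplier A) : A →ₗ[ℂ] A := m.1.1

/-- `rmul m x` is the element `x m` of `A`, for `m ∈ M(A)` and `x ∈ A`. -/
def rmul (m : Multiplier A) : A →ₗ[ℂ] A := m.1.2.unop

/-- The flip on `A ⊗ A`. -/
abbrev flip : A ⊗[ℂ] A →ₗ[ℂ] A ⊗[ℂ] A := (TensorProduct.comm ℂ A A).toLinearMap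

theorem flip_flip (x : A ⊗[ℂ] A) : flip (flip x) = x := by
  simp [flip]

theorem flip_mul (x y : A ⊗[ℂ] A) : flip (x * y) = flip x * flip y := by
  induction x using TensorProduct.induction_on with
  | zero => simp
  | add x x' hx hx' => simp only [add_mul, map_add, hx, hx']
  | tmul a b =>
    induction y using TensorProduct.induction_on with
    | zero => simp
    | add y y' hy hy' => simp only [mul_add, map_add, hy, hy']
    | tmul c d => simp [flip]

/-- The extension of the flip automorphism of `A ⊗ A` to the multiplier algebra `M(A ⊗ A)`. -/
def Multiplier.flip : Multiplier (A ⊗[ℂ] A) →ₐ[ℂ] Multiplier (A ⊗[ℂ] A) where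
  toFun m := ⟨(MultiplierHopf.flip ∘ₗ lmul m ∘ₗ MultiplierHopf.flip,
      MulOpposite.op (MultiplierHopf.flip ∘ₗ rmul m ∘ₗ MultiplierHopf.flip)), by
    obtain ⟨m, h1, h2, h3⟩ := m
    refine ⟨fun a b => ?_, fun a b => ?_, fun a b => ?_⟩
    · simp only [LinearMap.comp_apply, flip_mul, lmul, h1, flip_flip]
    · simp only [LinearMap.comp_apply, flip_mul, rmul, h2, flip_flip,
        MulOpposite.unop_op]
    · have h := congrArg MultiplierHopf.flip
        (h3 (MultiplierHopf.flip a) (MultiplierHopf.flip b))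
      simpa only [LinearMap.comp_apply, flip_mul, rmul, lmul, flip_flip,
        MulOpposite.unop_op] using h⟩
  map_one' := by
    apply Subtype.ext
    refine Prod.ext ?_ (MulOpposite.unop_injective ?_)
    · exact LinearMap.ext fun x => flip_flip x
    · exact LinearMap.ext fun x => flip_flip x
  map_mul' m m' := by
    apply Subtype.ext
    refine Prod.ext ?_ (MulOpposite.unop_injective ?_)
    · refine LinearMap.ext fun x => ?_
      change _ = MultiplierHopf.flip (lmul m (MultiplierHopf.flip
        (MultiplierHopf.flip (lmul m' (MultiplierHopf.flip x)))))
      rw [flip_flip]; rfl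
    · refine LinearMap.ext fun x => ?_
      change _ = MultiplierHopf.flip (rmul m' (MultiplierHopf.flip
        (MultiplierHopf.flip (rmul m (MultiplierHopf.flip x)))))
      rw [flip_flip]; rfl
  map_zero' := by
    apply Subtype.ext
    refine Prod.ext ?_ (MulOpposite.unop_injective ?_)
    · exact LinearMap.ext fun x => map_zero MultiplierHopf.flip
    · exact LinearMap.ext fun x => map_zero MultiplierHopf.flip
  map_add' m m' := by
    apply Subtype.ext
    refine Prod.ext ?_ (MulOpposite.unop_injective ?_)
    · exact LinearMap.ext fun x => map_add MultiplierHopf.flip _ _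
    · exact LinearMap.ext fun x => map_add MultiplierHopf.flip _ _
  commutes' r := by
    apply Subtype.ext
    refine Prod.ext ?_ (MulOpposite.unop_injective ?_)
    · refine LinearMap.ext fun x => ?_
      change MultiplierHopf.flip (r • MultiplierHopf.flip x) = r • x
      rw [map_smul, flip_flip]
    · refine LinearMap.ext fun x => ?_
      change MultiplierHopf.flip (r • MultiplierHopf.flip x) = r • x
      rw [map_smul, flip_flip]

end Algebras

section HopfAlgebras

variable (A : Type u) [NonUnitalNonAssocRing A] [Module ℂ A] [IsScalarTower ℂ A A]
  [SMulCommClass ℂ A A]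

/-- A multiplier Hopf algebra: an associative algebra over `ℂ` with non-degenerate product and a
non-degenerate coassociative homomorphism `Δ : A → M(A ⊗ A)` such that
`T₁ (a ⊗ b) = Δ(a)(1 ⊗ b)` and `T₂ (a ⊗ b) = (a ⊗ 1)Δ(b)` define bijections of `A ⊗ A`.
As the product is non-degenerate, `T₁` and `T₂` are determined by `Δ`. -/
structure MultiplierHopfAlgebra where
  mul_assoc : ∀ a b c : A, a * b * c = a * (b * c)
  eq_zero_of_mul : ∀ a : A, (∀ b, a * b = 0) → a = 0
  eq_zero_of_mul' : ∀ a : A, (∀ b, b * a = 0) → a = 0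
  /-- the coproduct -/
  comul : A →ₙₐ[ℂ] Multiplier (A ⊗[ℂ] A)
  span_comul : Submodule.span ℂ {z | ∃ a x, z = lmul (comul a) x} = ⊤
  span_comul' : Submodule.span ℂ {z | ∃ a x, z = rmul (comul a) x} = ⊤
  /-- the map `a ⊗ b ↦ Δ(a)(1 ⊗ b)` -/
  T₁ : A ⊗[ℂ] A ≃ₗ[ℂ] A ⊗[ℂ] A
  T₁_mul : ∀ a b z,
    T₁ (a ⊗ₜ b) * z = lmul (comul a) ((LinearMap.mulLeft ℂ b).lTensor A z)
  /-- the map `a ⊗ b ↦ (a ⊗ 1)Δ(b)` -/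
  T₂ : A ⊗[ℂ] A ≃ₗ[ℂ] A ⊗[ℂ] A
  mul_T₂ : ∀ a b z,
    z * T₂ (a ⊗ₜ b) = rmul (comul b) ((LinearMap.mulRight ℂ a).rTensor A z)
  /-- coassociativity:
  `(a ⊗ 1 ⊗ 1)(Δ ⊗ ι)(Δ(b)(1 ⊗ c)) = (ι ⊗ Δ)((a ⊗ 1)Δ(b))(1 ⊗ 1 ⊗ c)` -/
  coassoc : ∀ a b c,
    T₂.toLinearMap.rTensor A ((TensorProduct.assoc ℂ A A A).symm (a ⊗ₜ T₁ (b ⊗ₜ c))) =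
      (TensorProduct.assoc ℂ A A A).symm
        (T₁.toLinearMap.lTensor A (TensorProduct.assoc ℂ A A A (T₂ (a ⊗ₜ b) ⊗ₜ c)))

/-- A regular multiplier Hopf algebra: the opposite coproduct also makes the algebra into a
multiplier Hopf algebra. -/
structure RegularMultiplierHopfAlgebra extends MultiplierHopfAlgebra A where
  /-- the same algebra with the opposite coproduct -/
  cop : MultiplierHopfAlgebra A
  comul_cop : ∀ a, cop.comul a = Multiplier.flip (comul a)

variable {A}

/-- The map `a ⊗ b ↦ Δ(a)(b ⊗ 1)` of a regular multiplier Hopf algebra. -/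
def RegularMultiplierHopfAlgebra.T₃ (H : RegularMultiplierHopfAlgebra A) :
    A ⊗[ℂ] A →ₗ[ℂ] A ⊗[ℂ] A :=
  flip ∘ₗ H.cop.T₁.toLinearMap

/-- The map `a ⊗ b ↦ (1 ⊗ a)Δ(b)` of a regular multiplier Hopf algebra. -/
def RegularMultiplierHopfAlgebra.T₄ (H : RegularMultiplierHopfAlgebra A) :
    A ⊗[ℂ] A →ₗ[ℂ] A ⊗[ℂ] A :=
  flip ∘ₗ H.cop.T₂.toLinearMap

namespace MultiplierHopfAlgebra

/-- `ε` is the counit: a homomorphism to `ℂ` with `(ε ⊗ ι)(Δ(a)(1 ⊗ b)) = ab` and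
`(ι ⊗ ε)((a ⊗ 1)Δ(b)) = ab`. -/
structure IsCounit (H : MultiplierHopfAlgebra A) (ε : A →ₗ[ℂ] ℂ) : Prop where
  map_mul : ∀ a b, ε (a * b) = ε a * ε b
  counit_left : ∀ a b, TensorProduct.lid ℂ A (ε.rTensor A (H.T₁ (a ⊗ₜ b))) = a * b
  counit_right : ∀ a b, TensorProduct.rid ℂ A (ε.lTensor A (H.T₂ (a ⊗ₜ b))) = a * b

theorem counit_unique (H : MultiplierHopfAlgebra A) {ε ε' : A →ₗ[ℂ] ℂ} (h : H.IsCounit ε)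
    (h' : H.IsCounit ε') : ε = ε' := by
  by_contra hne
  have e : ∀ x y : A, ε x • y = ε' x • y := by
    intro x y
    have : (TensorProduct.lid ℂ A).toLinearMap ∘ₗ ε.rTensor A ∘ₗ H.T₁.toLinearMap =
      (TensorProduct.lid ℂ A).toLinearMap ∘ₗ ε'.rTensor A ∘ₗ H.T₁.toLinearMap := by
      ext a b; simpa using (h.counit_left a b).trans (h'.counit_left a b).symm
    have := LinearMap.congr_fun this (H.T₁.symm (x ⊗ₜ y))
    simpa using this
  apply hne
  ext x
  by_contra hx
  have hx0 : x = 0 := by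
    have := e x x
    rw [← sub_eq_zero, ← sub_smul] at this
    exact (smul_eq_zero.mp this).resolve_left (sub_ne_zero.mpr hx)
  exact hx (by simp [hx0])

/-- The counit of a multiplier Hopf algebra. It exists and is unique. -/
noncomputable def counit (H : MultiplierHopfAlgebra A) : A →ₗ[ℂ] ℂ :=
  Classical.epsilon H.IsCounit

/-- `S : A → A` is the antipode: an anti-homomorphism with
`m(S ⊗ ι)(Δ(a)(1 ⊗ b)) = ε(a)b` and `m(ι ⊗ S)((a ⊗ 1)Δ(b)) = ε(b)a`, where `ε` is the counit.
(In general the antipode has values in `M(A)`; for a regular multiplier Hopf algebra it maps `A`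
to `A`.) -/
structure IsAntipode (H : MultiplierHopfAlgebra A) (ε : A →ₗ[ℂ] ℂ) (S : A →ₗ[ℂ] A) : Prop where
  map_mul : ∀ a b, S (a * b) = S b * S a
  antipode_left : ∀ a b, LinearMap.mul' ℂ A (S.rTensor A (H.T₁ (a ⊗ₜ b))) = ε a • b
  antipode_right : ∀ a b, LinearMap.mul' ℂ A (S.lTensor A (H.T₂ (a ⊗ₜ b))) = ε b • a

theorem antipode_unique (H : MultiplierHopfAlgebra A) {ε : A →ₗ[ℂ] ℂ} {S S' : A →ₗ[ℂ] A}
    (h : H.IsAntipode ε S) (h' : H.IsAntipode ε S') : S = S' := by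
  have : LinearMap.mul' ℂ A ∘ₗ S.rTensor A ∘ₗ H.T₁.toLinearMap =
      LinearMap.mul' ℂ A ∘ₗ S'.rTensor A ∘ₗ H.T₁.toLinearMap := by
    ext a b; simpa using (h.antipode_left a b).trans (h'.antipode_left a b).symm
  ext x
  refine sub_eq_zero.mp (H.eq_zero_of_mul _ fun y => ?_)
  have := LinearMap.congr_fun this (H.T₁.symm (x ⊗ₜ y))
  rw [sub_mul, sub_eq_zero]
  simpa using this

/-- The antipode of a regular multiplier Hopf algebra. It exists and is unique. -/
noncomputable def antipode (H : MultiplierHopfAlgebra A) : A →ₗ[ℂ] A :=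
  Classical.epsilon (H.IsAntipode H.counit)

end MultiplierHopfAlgebra

end HopfAlgebras

section Actions

variable {A : Type u} [NonUnitalNonAssocRing A] [Module ℂ A] [IsScalarTower ℂ A A]
  [SMulCommClass ℂ A A]
variable {B : Type v} [NonUnitalNonAssocRing B] [Module ℂ B] [IsScalarTower ℂ B B]
  [SMulCommClass ℂ B B]

/-- `B` is a right `A`-module algebra for the unital right action `b ◁ a = act b a`.
In `bb' ◁ a = ∑ (b ◁ a₍₁₎)(b' ◁ a₍₂₎)` the leg `a₍₁₎` is covered by writing `b ◁ c` for `b`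
(such elements span `B`): then `c a₍₁₎ ⊗ a₍₂₎ = (c ⊗ 1)Δ(a)` lies in `A ⊗ A`. -/
structure IsRightModuleAlgebra (H : MultiplierHopfAlgebra A) (act : B →ₗ[ℂ] A →ₗ[ℂ] B) :
    Prop where
  act_mul : ∀ b a a', act b (a * a') = act (act b a) a'
  unital : Submodule.span ℂ {x | ∃ b a, x = act b a} = ⊤
  mul_act : ∀ b c b' a, act (act b c * b') a =
    LinearMap.mul' ℂ B (TensorProduct.map (act b) (act b') (H.T₂ (c ⊗ₜ a)))

/-- `R : B ⊗ A → A ⊗ B` is the twist map `R (b ⊗ a) = ∑ a₍₁₎ ⊗ (b ◁ a₍₂₎)`, stated after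
multiplication by `d ⊗ 1` from the left, for every `d ∈ A`. -/
def IsTwist (H : MultiplierHopfAlgebra A) (act : B →ₗ[ℂ] A →ₗ[ℂ] B)
    (R : B ⊗[ℂ] A →ₗ[ℂ] A ⊗[ℂ] B) : Prop :=
  ∀ b a d, (LinearMap.mulLeft ℂ d).rTensor B (R (b ⊗ₜ a)) = (act b).lTensor A (H.T₂ (d ⊗ₜ a))

/-- The twist map `R (b ⊗ a) = ∑ a₍₁₎ ⊗ (b ◁ a₍₂₎)`. For a module algebra over a regular
multiplier Hopf algebra it exists and is unique; see `twist_spec` and `twist_unique`. -/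
noncomputable def twist (H : MultiplierHopfAlgebra A) (act : B →ₗ[ℂ] A →ₗ[ℂ] B) :
    B ⊗[ℂ] A →ₗ[ℂ] A ⊗[ℂ] B :=
  Classical.epsilon (IsTwist H act)

/-- The map `Rᵒᵖ (b ⊗ a) = ∑ a₍₂₎ ⊗ (b ◁ a₍₁₎)`. -/
noncomputable def twistOp (H : RegularMultiplierHopfAlgebra A) (act : B →ₗ[ℂ] A →ₗ[ℂ] B) :
    B ⊗[ℂ] A →ₗ[ℂ] A ⊗[ℂ] B :=
  twist H.cop act

theorem eq_zero_of_mulLeft {V : Type*} [AddCommGroup V] [Module ℂ V]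
    (h : ∀ a : A, (∀ b, b * a = 0) → a = 0) (u : A ⊗[ℂ] V)
    (hu : ∀ d, (LinearMap.mulLeft ℂ d).rTensor V u = 0) : u = 0 := by
  classical
  let 𝓑 := Module.Basis.ofVectorSpace ℂ V
  let e := TensorProduct.equivFinsuppOfBasisRight (M := A) 𝓑
  have nat : ∀ (f : A →ₗ[ℂ] A) (w : A ⊗[ℂ] V) i, e (f.rTensor V w) i = f (e w i) := by
    intro f w i
    induction w using TensorProduct.induction_on with
    | zero => simp
    | add x y hx hy => simp [hx, hy]
    | tmul a v => simp [e]
  apply e.injective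
  rw [map_zero]
  ext i
  refine h _ fun d => ?_
  have := nat (LinearMap.mulLeft ℂ d) u i
  rw [hu d] at this
  simpa using this.symm

theorem exists_twist (H : RegularMultiplierHopfAlgebra A) (act : B →ₗ[ℂ] A →ₗ[ℂ] B)
    (hmul : ∀ b a a', act b (a * a') = act (act b a) a')
    (hunital : Submodule.span ℂ {x | ∃ b a, x = act b a} = ⊤) :
    ∃ R, IsTwist H.toMultiplierHopfAlgebra act R := by
  -- `(d ⊗ 1)((1 ⊗ c)Δ(a)) = (1 ⊗ c)((d ⊗ 1)Δ(a))`
  have nd : ∀ u : A ⊗[ℂ] A, (∀ z, z * u = 0) → u = 0 := by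
    intro u hu
    refine eq_zero_of_mulLeft H.eq_zero_of_mul' u fun d => ?_
    have : (TensorProduct.comm ℂ A A) ((LinearMap.mulLeft ℂ d).rTensor A u) = 0 := by
      refine eq_zero_of_mulLeft H.eq_zero_of_mul' _ fun c => ?_
      have : ∀ u : A ⊗[ℂ] A, (LinearMap.mulLeft ℂ c).rTensor A
          ((TensorProduct.comm ℂ A A) ((LinearMap.mulLeft ℂ d).rTensor A u)) =
          (TensorProduct.comm ℂ A A) ((d ⊗ₜ c) * u) := by
        intro u
        induction u using TensorProduct.induction_on with
        | zero => simp
        | add x y hx hy => simp only [map_add, mul_add, hx, hy]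
        | tmul a v => simp
      rw [this, hu, map_zero]
    simpa using this
  have assocT : ∀ z (f : A) (u : A ⊗[ℂ] A), z * (LinearMap.mulLeft ℂ f).rTensor A u =
      (LinearMap.mulRight ℂ f).rTensor A z * u := by
    intro z f u
    induction z using TensorProduct.induction_on with
    | zero => simp
    | add x y hx hy => simp only [map_add, add_mul, hx, hy]
    | tmul p q =>
      induction u using TensorProduct.induction_on with
      | zero => simp
      | add x y hx hy => simp only [map_add, mul_add, hx, hy]
      | tmul a v => simp [H.mul_assoc]
  have assocT' : ∀ z (f : A) (u : A ⊗[ℂ] A), z * (LinearMap.mulLeft ℂ f).lTensor A u =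
      (LinearMap.mulRight ℂ f).lTensor A z * u := by
    intro z f u
    induction z using TensorProduct.induction_on with
    | zero => simp
    | add x y hx hy => simp only [map_add, add_mul, hx, hy]
    | tmul p q =>
      induction u using TensorProduct.induction_on with
      | zero => simp
      | add x y hx hy => simp only [map_add, mul_add, hx, hy]
      | tmul a v => simp [H.mul_assoc]
  have flipR : ∀ (f : A →ₗ[ℂ] A) (z : A ⊗[ℂ] A), flip (f.rTensor A (flip z)) = f.lTensor A z := by
    intro f z
    induction z using TensorProduct.induction_on with
    | zero => simp
    | add x y hx hy => simp only [map_add, hx, hy]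
    | tmul p q => simp [flip]
  have T4 : ∀ c a z, z * H.T₄ (c ⊗ₜ a) =
      rmul (H.comul a) ((LinearMap.mulRight ℂ c).lTensor A z) := by
    intro c a z
    have h := congrArg flip (H.cop.mul_T₂ c a (flip z))
    rw [flip_mul, flip_flip, H.comul_cop] at h
    refine h.trans ?_
    change flip (flip (rmul (H.comul a) (flip ((LinearMap.mulRight ℂ c).rTensor A (flip z))))) = _
    rw [flip_flip, flipR]
  have key : ∀ d c a, (LinearMap.mulLeft ℂ d).rTensor A (H.T₄ (c ⊗ₜ a)) =
      (LinearMap.mulLeft ℂ c).lTensor A (H.T₂ (d ⊗ₜ a)) := by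
    intro d c a
    refine sub_eq_zero.mp (nd _ fun z => ?_)
    rw [mul_sub, sub_eq_zero, assocT, assocT', T4, H.mul_T₂]
    congr 1
    simp only [← LinearMap.comp_apply, LinearMap.lTensor_comp_rTensor,
      LinearMap.rTensor_comp_lTensor]
  obtain ⟨s, hs⟩ := (TensorProduct.lift act).exists_rightInverse_of_surjective (by
    rw [eq_top_iff, ← hunital, Submodule.span_le]
    rintro _ ⟨b, a, rfl⟩
    exact ⟨b ⊗ₜ a, by simp⟩)
  let F : (B ⊗[ℂ] A) →ₗ[ℂ] A →ₗ[ℂ] A ⊗[ℂ] B := TensorProduct.lift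
    (LinearMap.mk₂ ℂ (fun b c => ((act b).lTensor A ∘ₗ H.T₄ ∘ₗ TensorProduct.mk ℂ A A c))
      (by intros; ext; simp [LinearMap.lTensor_add]) (by intros; ext; simp [LinearMap.lTensor_smul])
      (by intros; ext; simp) (by intros; ext; simp))
  have hF : ∀ (w : B ⊗[ℂ] A) a d, (LinearMap.mulLeft ℂ d).rTensor B (F w a) =
      (act (TensorProduct.lift act w)).lTensor A (H.T₂ (d ⊗ₜ a)) := by
    intro w a d
    induction w using TensorProduct.induction_on with
    | zero => simp
    | add x y hx hy => simp only [map_add, LinearMap.add_apply, hx, hy, LinearMap.lTensor_add]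
    | tmul b c =>
      have h1 : (LinearMap.mulLeft ℂ d).rTensor B (F (b ⊗ₜ c) a) =
          (act b).lTensor A ((LinearMap.mulLeft ℂ d).rTensor A (H.T₄ (c ⊗ₜ a))) := by
        simp only [F, TensorProduct.lift.tmul, LinearMap.mk₂_apply, LinearMap.comp_apply,
          TensorProduct.mk_apply]
        exact LinearMap.congr_fun ((LinearMap.rTensor_comp_lTensor A (f := LinearMap.mulLeft ℂ d)
          (g := act b)).trans (LinearMap.lTensor_comp_rTensor A (f := LinearMap.mulLeft ℂ d)
          (g := act b)).symm) (H.T₄ (c ⊗ₜ a))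
      rw [h1, key, ← LinearMap.comp_apply, ← LinearMap.lTensor_comp]
      congr 2
      ext x
      simp [hmul]
  refine ⟨TensorProduct.lift (F ∘ₗ s), fun b a d => ?_⟩
  have := hF (s b) a d
  rw [show TensorProduct.lift act (s b) = b from LinearMap.congr_fun hs b] at this
  simpa using this

theorem twist_unique (H : MultiplierHopfAlgebra A) (act : B →ₗ[ℂ] A →ₗ[ℂ] B)
    {R R' : B ⊗[ℂ] A →ₗ[ℂ] A ⊗[ℂ] B} (h : IsTwist H act R) (h' : IsTwist H act R') : R = R' := by
  refine TensorProduct.ext' fun b a => sub_eq_zero.mp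
    (eq_zero_of_mulLeft H.eq_zero_of_mul' _ fun d => ?_)
  rw [map_sub, h, h', sub_self]

theorem twist_spec (H : RegularMultiplierHopfAlgebra A) (act : B →ₗ[ℂ] A →ₗ[ℂ] B)
    (hact : IsRightModuleAlgebra H.toMultiplierHopfAlgebra act) :
    IsTwist H.toMultiplierHopfAlgebra act (twist H.toMultiplierHopfAlgebra act) :=
  Classical.epsilon_spec (exists_twist H act hact.act_mul hact.unital)

theorem twistOp_spec (H : RegularMultiplierHopfAlgebra A) (act : B →ₗ[ℂ] A →ₗ[ℂ] B)
    (hact : IsRightModuleAlgebra H.toMultiplierHopfAlgebra act) :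
    IsTwist H.cop act (twistOp H act) :=
  Classical.epsilon_spec (exists_twist
    { H.cop with
      cop := H.toMultiplierHopfAlgebra
      comul_cop := fun a => by
        rw [H.comul_cop]
        apply Subtype.ext
        refine Prod.ext ?_ (MulOpposite.unop_injective ?_)
        · exact LinearMap.ext fun x => (flip_flip _).symm.trans
            (congrArg (fun y => flip (flip (lmul (H.comul a) y))) (flip_flip x).symm)
        · exact LinearMap.ext fun x => (flip_flip _).symm.trans
            (congrArg (fun y => flip (flip (rmul (H.comul a) y))) (flip_flip x).symm) }
    act hact.act_mul hact.unital)

/-- `ι ⊗ f ⊗ ι` for a map `f : X ⊗ Y → Z ⊗ W` on the two middle legs. -/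
noncomputable def middle {U V X Y Z W : Type*} [AddCommGroup U] [AddCommGroup V] [AddCommGroup X]
    [AddCommGroup Y] [AddCommGroup Z] [AddCommGroup W] [Module ℂ U] [Module ℂ V] [Module ℂ X]
    [Module ℂ Y] [Module ℂ Z] [Module ℂ W] (f : X ⊗[ℂ] Y →ₗ[ℂ] Z ⊗[ℂ] W) :
    (V ⊗[ℂ] X) ⊗[ℂ] (Y ⊗[ℂ] U) →ₗ[ℂ] (V ⊗[ℂ] Z) ⊗[ℂ] (W ⊗[ℂ] U) :=
  (TensorProduct.assoc ℂ V Z (W ⊗[ℂ] U)).symm.toLinearMap ∘ₗ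
    ((TensorProduct.assoc ℂ Z W U).toLinearMap ∘ₗ f.rTensor U ∘ₗ
      (TensorProduct.assoc ℂ X Y U).symm.toLinearMap).lTensor V ∘ₗ
    (TensorProduct.assoc ℂ V X (Y ⊗[ℂ] U)).toLinearMap

/-- The smash product `A # B`: the vector space `A ⊗ B` with the product
`(a # b)(a' # b') = ∑ a a'₍₁₎ # (b ◁ a'₍₂₎) b'`, that is
`m = (m_A ⊗ m_B)(ι ⊗ R ⊗ ι)`. -/
def Smash (_H : MultiplierHopfAlgebra A) (_act : B →ₗ[ℂ] A →ₗ[ℂ] B) : Type (max u v) :=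
  A ⊗[ℂ] B

namespace Smash

variable (H : MultiplierHopfAlgebra A) (act : B →ₗ[ℂ] A →ₗ[ℂ] B)

/-- The multiplication map `(m_A ⊗ m_B)(ι ⊗ R ⊗ ι)` of the smash product. -/
noncomputable def mulMap : (A ⊗[ℂ] B) ⊗[ℂ] (A ⊗[ℂ] B) →ₗ[ℂ] A ⊗[ℂ] B :=
  TensorProduct.map (LinearMap.mul' ℂ A) (LinearMap.mul' ℂ B) ∘ₗ middle (twist H act)

noncomputable instance : AddCommGroup (Smash H act) := inferInstanceAs (AddCommGroup (A ⊗[ℂ] B))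

noncomputable instance : Mul (Smash H act) :=
  ⟨fun x y => mulMap H act ((show A ⊗[ℂ] B from x) ⊗ₜ[ℂ] (show A ⊗[ℂ] B from y))⟩

noncomputable instance : NonUnitalNonAssocRing (Smash H act) where
  toAddCommGroup := inferInstance
  toMul := inferInstance
  left_distrib _ _ _ := (congrArg (mulMap H act) (TensorProduct.tmul_add _ _ _)).trans
    (map_add (mulMap H act) _ _)
  right_distrib _ _ _ := (congrArg (mulMap H act) (TensorProduct.add_tmul _ _ _)).trans
    (map_add (mulMap H act) _ _)
  zero_mul _ := (congrArg (mulMap H act) (TensorProduct.zero_tmul _ _)).trans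
    (map_zero (mulMap H act))
  mul_zero _ := (congrArg (mulMap H act) (TensorProduct.tmul_zero _ _)).trans
    (map_zero (mulMap H act))

noncomputable instance : Module ℂ (Smash H act) := inferInstanceAs (Module ℂ (A ⊗[ℂ] B))

instance : IsScalarTower ℂ (Smash H act) (Smash H act) where
  smul_assoc r x y := (congrArg (mulMap H act)
    (TensorProduct.smul_tmul' (R := ℂ) r (show A ⊗[ℂ] B from x) (show A ⊗[ℂ] B from y)).symm).trans
    (map_smul (mulMap H act) r _)

instance : SMulCommClass ℂ (Smash H act) (Smash H act) where
  smul_comm r _ _ := ((congrArg (mulMap H act) (TensorProduct.tmul_smul r _ _)).trans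
    (map_smul (mulMap H act) r _)).symm

/-- The identification of `A ⊗ B` with `A # B`, `a ⊗ b ↦ a # b = ab`. -/
noncomputable def ofTensor : A ⊗[ℂ] B ≃ₗ[ℂ] Smash H act := LinearEquiv.refl ℂ (A ⊗[ℂ] B)

/-- Left multiplication on `A # B` by an element `a` of `A ⊆ M(A # B)`:
`a (a' # b') = a a' # b'`. -/
noncomputable def leftA (a : A) : Smash H act →ₗ[ℂ] Smash H act :=
  (ofTensor H act).toLinearMap ∘ₗ (LinearMap.mulLeft ℂ a).rTensor B ∘ₗ
    (ofTensor H act).symm.toLinearMap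

/-- Left multiplication on `A # B` by an element `b` of `B ⊆ M(A # B)`:
`b (a' # b') = ∑ a'₍₁₎ # (b ◁ a'₍₂₎) b'`. -/
noncomputable def leftB (b : B) : Smash H act →ₗ[ℂ] Smash H act :=
  (ofTensor H act).toLinearMap ∘ₗ
    (LinearMap.mul' ℂ B).lTensor A ∘ₗ (TensorProduct.assoc ℂ A B B).toLinearMap ∘ₗ
    (twist H act ∘ₗ TensorProduct.mk ℂ B A b).rTensor B ∘ₗ
    (ofTensor H act).symm.toLinearMap

end Smash

end Actions

section Coactions

variable {A : Type u} [NonUnitalNonAssocRing A] [Module ℂ A] [IsScalarTower ℂ A A]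
  [SMulCommClass ℂ A A]
variable {B : Type v} [NonUnitalNonAssocRing B] [Module ℂ B] [IsScalarTower ℂ B B]
  [SMulCommClass ℂ B B]

variable (A B) in
/-- The completion `M₀(B ⊗ A)` of the `B`-bimodule `B ⊗ A` (multiplication in the first factor):
its elements `y` are given by the two maps `b ↦ y(b ⊗ 1)` (first component) and
`b ↦ (b ⊗ 1)y` (second component) from `B` to `B ⊗ A`, which satisfy
`(b ⊗ 1)(y(b' ⊗ 1)) = ((b ⊗ 1)y)(b' ⊗ 1)`. -/
def LeftCompletion : Submodule ℂ ((B →ₗ[ℂ] B ⊗[ℂ] A) × (B →ₗ[ℂ] B ⊗[ℂ] A)) where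
  carrier := {y | ∀ b b', (LinearMap.mulLeft ℂ b).rTensor A (y.1 b') =
    (LinearMap.mulRight ℂ b').rTensor A (y.2 b)}
  add_mem' {y y'} h h' b b' := by simp [h b b', h' b b']
  zero_mem' b b' := by simp
  smul_mem' r y h b b' := by simp [h b b']

/-- The cotwist map `T (a ⊗ b) = Γ(a)(b ⊗ 1)`. -/
noncomputable def cotwist (Γ : A →ₗ[ℂ] LeftCompletion A B) : A ⊗[ℂ] B →ₗ[ℂ] B ⊗[ℂ] A :=
  TensorProduct.lift (LinearMap.fst ℂ _ _ ∘ₗ (LeftCompletion A B).subtype ∘ₗ Γ)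

/-- The map `Tᵒᵖ (a ⊗ b) = (b ⊗ 1)Γ(a)`. -/
noncomputable def cotwistOp (Γ : A →ₗ[ℂ] LeftCompletion A B) : A ⊗[ℂ] B →ₗ[ℂ] B ⊗[ℂ] A :=
  TensorProduct.lift (LinearMap.snd ℂ _ _ ∘ₗ (LeftCompletion A B).subtype ∘ₗ Γ)

/-- `Γ : A → M₀(B ⊗ A)` is a left coaction: it is injective and
`(ι ⊗ Γ)Γ(a) = (Δ ⊗ ι)Γ(a)` in the completion of `B ⊗ B ⊗ A`. The two sides are compared after
multiplication from the right by `Δ(b)(b' ⊗ 1) ⊗ 1` and from the left by `(b' ⊗ 1)Δ(b) ⊗ 1`;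
both kinds of elements span `B ⊗ B`. -/
structure IsLeftCoaction (HB : RegularMultiplierHopfAlgebra B)
    (Γ : A →ₗ[ℂ] LeftCompletion A B) : Prop where
  injective : Function.Injective Γ
  coassoc_right : ∀ a b b',
    (cotwist Γ).lTensor B (TensorProduct.assoc ℂ B A B ((cotwist Γ).rTensor B
        ((TensorProduct.assoc ℂ A B B).symm (a ⊗ₜ HB.T₃ (b ⊗ₜ b'))))) =
      TensorProduct.assoc ℂ B B A
        ((HB.T₃ ∘ₗ (TensorProduct.mk ℂ B B).flip b').rTensor A (cotwist Γ (a ⊗ₜ b)))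
  coassoc_left : ∀ a b b',
    (cotwistOp Γ).lTensor B (TensorProduct.assoc ℂ B A B ((cotwistOp Γ).rTensor B
        ((TensorProduct.assoc ℂ A B B).symm (a ⊗ₜ HB.T₂ (b' ⊗ₜ b))))) =
      TensorProduct.assoc ℂ B B A
        ((HB.T₂.toLinearMap ∘ₗ TensorProduct.mk ℂ B B b').rTensor A (cotwistOp Γ (a ⊗ₜ b)))

/-- `A` is a left `B`-comodule coalgebra: `Γ` is a left coaction, and
`(ι ⊗ Δ_A)T = (T ⊗ ι)(ι ⊗ T)(Δ_A ⊗ ι)` on `A ⊗ B`. To give a meaning to the right hand side,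
it is part of the notion that `((ι ⊗ T)(Δ_A(a) ⊗ b))(1 ⊗ 1 ⊗ a')` and
`(1 ⊗ 1 ⊗ a')((ι ⊗ T)(Δ_A(a) ⊗ b))`, which are defined after multiplication in the first factor
by elements `c ∈ A`, are elements `y` of `A ⊗ B ⊗ A`; then the equation is
`(T ⊗ ι)(y) = ((ι ⊗ Δ_A)T(a ⊗ b))(1 ⊗ 1 ⊗ a')`, respectively
`(T ⊗ ι)(y) = (1 ⊗ 1 ⊗ a')((ι ⊗ Δ_A)T(a ⊗ b))`. -/
structure IsLeftComoduleCoalgebra (HA : RegularMultiplierHopfAlgebra A)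
    (HB : RegularMultiplierHopfAlgebra B) (Γ : A →ₗ[ℂ] LeftCompletion A B) : Prop
    extends IsLeftCoaction HB Γ where
  comul_cotwist_right : ∀ a b a', ∃ y : A ⊗[ℂ] (B ⊗[ℂ] A),
    (∀ c, (LinearMap.mulLeft ℂ c).rTensor (B ⊗[ℂ] A) y =
      (((LinearMap.mulRight ℂ a').lTensor B).lTensor A) ((cotwist Γ).lTensor A
        (TensorProduct.assoc ℂ A A B (HA.T₂ (c ⊗ₜ a) ⊗ₜ b)))) ∧
    TensorProduct.assoc ℂ B A A
        ((cotwist Γ).rTensor A ((TensorProduct.assoc ℂ A B A).symm y)) =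
      (HA.T₁.toLinearMap ∘ₗ (TensorProduct.mk ℂ A A).flip a').lTensor B (cotwist Γ (a ⊗ₜ b))
  comul_cotwist_left : ∀ a b a', ∃ y : A ⊗[ℂ] (B ⊗[ℂ] A),
    (∀ c, (LinearMap.mulLeft ℂ c).rTensor (B ⊗[ℂ] A) y =
      (((LinearMap.mulLeft ℂ a').lTensor B).lTensor A) ((cotwist Γ).lTensor A
        (TensorProduct.assoc ℂ A A B (HA.T₂ (c ⊗ₜ a) ⊗ₜ b)))) ∧
    TensorProduct.assoc ℂ B A A
        ((cotwist Γ).rTensor A ((TensorProduct.assoc ℂ A B A).symm y)) =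
      (HA.T₄ ∘ₗ TensorProduct.mk ℂ A A a').lTensor B (cotwist Γ (a ⊗ₜ b))

/-- The map `P (b ⊗ a) = ∑ ((b ◁ a₍₁₎) ⊗ 1)Γ(a₍₂₎)` on `B ⊗ A`, that is `P = Tᵒᵖ ∘ Rᵒᵖ`. -/
noncomputable def pMap (HA : RegularMultiplierHopfAlgebra A) (act : B →ₗ[ℂ] A →ₗ[ℂ] B)
    (Γ : A →ₗ[ℂ] LeftCompletion A B) : B ⊗[ℂ] A →ₗ[ℂ] B ⊗[ℂ] A :=
  cotwistOp Γ ∘ₗ twistOp HA act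

/-- The compatibility conditions between the action and the coaction.
* `pMap_mul`: `P(ι ⊗ m_A) = (ι ⊗ m_A)P₁₃P₁₂` on `B ⊗ A ⊗ A`.
* `comul_pMap`: `(Δ_B ⊗ ι)P = P₂₃P₁₃(Δ_B ⊗ ι)` on `B ⊗ A`, stated after multiplication by
  `c ∈ B` in the first factor from the left: `z` is the element
  `(c ⊗ 1 ⊗ 1)P₁₃(Δ_B(b) ⊗ a)` of `B ⊗ B ⊗ A`, given by
  `z(1 ⊗ d ⊗ 1) = (c ⊗ 1 ⊗ 1)P₁₃(Δ_B(b)(1 ⊗ d) ⊗ a)` for all `d ∈ B`.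
* `cotwist_twist`: `T ∘ R = Tᵒᵖ ∘ Rᵒᵖ` on `B ⊗ A`. -/
structure IsCompatible (HA : RegularMultiplierHopfAlgebra A)
    (HB : RegularMultiplierHopfAlgebra B) (act : B →ₗ[ℂ] A →ₗ[ℂ] B)
    (Γ : A →ₗ[ℂ] LeftCompletion A B) : Prop where
  pMap_mul : ∀ x : (B ⊗[ℂ] A) ⊗[ℂ] A,
    pMap HA act Γ ((LinearMap.mul' ℂ A).lTensor B (TensorProduct.assoc ℂ B A A x)) =
      (LinearMap.mul' ℂ A).lTensor B (TensorProduct.assoc ℂ B A A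
        (TensorProduct.rightComm ℂ B A A ((pMap HA act Γ).rTensor A
          (TensorProduct.rightComm ℂ B A A ((pMap HA act Γ).rTensor A x)))))
  comul_pMap : ∀ a b c, ∃ z : (B ⊗[ℂ] B) ⊗[ℂ] A,
    (∀ d, ((LinearMap.mulRight ℂ d).lTensor B).rTensor A z =
      ((LinearMap.mulLeft ℂ c).rTensor B).rTensor A
        (TensorProduct.rightComm ℂ B A B ((pMap HA act Γ).rTensor B
          (TensorProduct.rightComm ℂ B B A (HB.T₁ (b ⊗ₜ d) ⊗ₜ a))))) ∧
    (pMap HA act Γ).lTensor B (TensorProduct.assoc ℂ B B A z) =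
      TensorProduct.assoc ℂ B B A
        ((HB.T₂.toLinearMap ∘ₗ TensorProduct.mk ℂ B B c).rTensor A (pMap HA act Γ (b ⊗ₜ a)))
  cotwist_twist : cotwist Γ ∘ₗ twist HA.toMultiplierHopfAlgebra act =
    cotwistOp Γ ∘ₗ twistOp HA act

variable (HA : RegularMultiplierHopfAlgebra A) (HB : RegularMultiplierHopfAlgebra B)
  (act : B →ₗ[ℂ] A →ₗ[ℂ] B) (Γ : A →ₗ[ℂ] LeftCompletion A B)

/-- The smash product `AB` of two regular multiplier Hopf algebras. -/
abbrev SmashProduct (HA : RegularMultiplierHopfAlgebra A) (act : B →ₗ[ℂ] A →ₗ[ℂ] B) :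
    Type (max u v) :=
  Smash HA.toMultiplierHopfAlgebra act

/-- `Δ : AB → M(AB ⊗ AB)` is the smash coproduct
`Δ(ab) = ∑ (a₍₁₎ ⊗ 1)Γ(a₍₂₎)Δ_B(b)`, formally `(ι ⊗ T ⊗ ι)(Δ_A(a) ⊗ Δ_B(b))`: for all
`a' ∈ A` and `b' ∈ B`, the multiplier `(a' ⊗ 1)Δ(ab)(1 ⊗ b')` is the element
`(ι ⊗ T ⊗ ι)((a' ⊗ 1)Δ_A(a) ⊗ Δ_B(b)(1 ⊗ b'))` of `A ⊗ B ⊗ A ⊗ B = AB ⊗ AB`. -/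
def IsSmashCoproduct (Δ : SmashProduct HA act →ₗ[ℂ]
    Multiplier (SmashProduct HA act ⊗[ℂ] SmashProduct HA act)) : Prop :=
  ∀ (a a' : A) (b b' : B) (z : SmashProduct HA act ⊗[ℂ] SmashProduct HA act),
    (Smash.leftA _ act a').rTensor _
        (lmul (Δ (Smash.ofTensor _ act (a ⊗ₜ b))) ((Smash.leftB _ act b').lTensor _ z)) =
      TensorProduct.map (Smash.ofTensor _ act).toLinearMap (Smash.ofTensor _ act).toLinearMap
        (middle (cotwist Γ) (HA.T₂ (a' ⊗ₜ a) ⊗ₜ HB.T₁ (b ⊗ₜ b'))) * z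

/-- The linear functional `ab ↦ ε_A(a) ε_B(b)` on `AB`. -/
noncomputable def smashCounit : SmashProduct HA act →ₗ[ℂ] ℂ :=
  LinearMap.mul' ℂ ℂ ∘ₗ TensorProduct.map HA.counit HB.counit ∘ₗ
    (Smash.ofTensor HA.toMultiplierHopfAlgebra act).symm.toLinearMap

/-- The linear map `ab ↦ ∑ S_B(b) S_B(a₍₋₁₎) S_A(a₍₀₎)` on `AB`. Here
`S_B(b) S_B(a₍₋₁₎) = S_B(a₍₋₁₎ b)` with `∑ a₍₋₁₎ b ⊗ a₍₀₎ = Γ(a)(b ⊗ 1)`, and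
the product in `AB` of `q ∈ B` and `p ∈ A` is `qp = R (q ⊗ p)`. -/
noncomputable def smashAntipode : SmashProduct HA act →ₗ[ℂ] SmashProduct HA act :=
  (Smash.ofTensor HA.toMultiplierHopfAlgebra act).toLinearMap ∘ₗ
    twist HA.toMultiplierHopfAlgebra act ∘ₗ
    TensorProduct.map HB.antipode HA.antipode ∘ₗ cotwist Γ ∘ₗ
    (Smash.ofTensor HA.toMultiplierHopfAlgebra act).symm.toLinearMap

end Coactions

end MultiplierHopf

/-!
# The smash product of two regular multiplier Hopf algebras

The argument is carried out with linear maps between tensor products, never with multipliers. A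
multiplier Hopf algebra is described by its two canonical maps `T₁ (x ⊗ y) = Δ(x)(1 ⊗ y)` and
`T₂ (w ⊗ x) = (w ⊗ 1)Δ(x)`, bijections that are compatible, coassociative and multiplicative
(`CanonicalPair`). Such a pair determines the counit and the antipode, and the coproduct with
values in the multiplier algebra is recovered from it. If the antipode is bijective, then the
canonical maps of the opposite coproduct can be written down with `S⁻¹`
(`CanonicalPair.exists_isOpposite`), so that regularity is a consequence of a bijective antipode
(`CanonicalPair.toRegular`). It remains to find the canonical maps of `AB` and to check three
identities and a formula for the antipode.

The twist map `R` is bijective because `A` is regular, which gives the second identification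
`B ⊗ A ≅ AB` with products `ba`. The cotwist map `T` is bijective because `B` is regular:
its inverse is obtained from `Tᵒᵖ` and the antipode of `B` (`IsLeftCoaction.cotwist_bijective`).
Hence `P = TR` is bijective as well.

*The map `T₂` and multiplicativity.* The map `w ⊗ ab ↦ (w ⊗ 1)Δ(a)Δ(b)` (`comulAB`) is composed of
`P` and of the maps `T₂` of `A` and `B`, so it is bijective (`comulAB_bijective`). Multiplicativity
on `A` is the relation `P(ι ⊗ m) = (ι ⊗ m)P₁₃P₁₂`, on `B` it is that of the coproduct of `B`, and
the relation `ba = R(b ⊗ a)` is respected because of `twist_legs₁₃_pMap`, which combines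
`(Δ ⊗ ι)P = P₂₃P₁₃(Δ ⊗ ι)` with `TR = TᵒᵖRᵒᵖ`. Together they give `smashT₂_mul`.

*The map `T₁` and coassociativity.* The map `T₁` is the composition of `b ⊗ y ↦ ∑ b₍₁₎ ⊗ b₍₂₎y`
(`CanonicalPair.freeT₁`) and of `a ⊗ b ⊗ m ↦ ∑ a₍₁₎ ⊗ Γ(a₍₂₎)(b ⊗ m)` (`comulCoact`). Since `Γ` is
compatible with the coproduct of `A`, the latter is the conjugate by `T` of the bijection
`a ⊗ m ↦ ∑ a₍₁₎ ⊗ a₍₂₎m`. This conjugation turns the coassociativity of `Δ(a)` into the fact that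
maps on different legs commute (`IsLeftComoduleCoalgebra.extendRight_cotwistComul`), from which
`assoc_smashT₂_smashT₁` follows. Compatibility of the two canonical maps is `smash_compat`.

*Counit and antipode.* The counit of a pair of canonical maps is unique, so it suffices to verify
`(ε ⊗ ι)(Δ(x)(1 ⊗ y)) = xy` (`smashCounit_eq`). The antipode `S(ab)` is the image of `T(a ⊗ b)`
under the antipodes of `B` and `A`; the same conjugation by `T` reduces its defining identity to
those of `A` and `B` (`isAntipode_smashAntipode`), and it is bijective as a composition of
bijections. Finally, the displayed formula for `(a' ⊗ 1)Δ(ab)(1 ⊗ b')` determines the coproduct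
because the products `b'x` span `AB` and `a'x = 0` for all `a'` only if `x = 0`
(`IsSmashCoproduct.unique`).
-/

set_option linter.unusedSectionVars false

open scoped TensorProduct

namespace MultiplierHopf

open LinearMap (mulLeft mulRight mul')
open TensorProduct (assoc comm lid rid lift)

/-! ### Maps on the legs of tensor products -/

section Legs

variable {X Y Z U V W : Type*} [AddCommGroup X] [AddCommGroup Y] [AddCommGroup Z]
  [AddCommGroup U] [AddCommGroup V] [AddCommGroup W] [Module ℂ X] [Module ℂ Y] [Module ℂ Z]
  [Module ℂ U] [Module ℂ V] [Module ℂ W]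

theorem rTensor_lTensor (f : X →ₗ[ℂ] Y) (g : V →ₗ[ℂ] W) (t : X ⊗[ℂ] V) :
    f.rTensor W (g.lTensor X t) = g.lTensor Y (f.rTensor V t) := by
  rw [← LinearMap.comp_apply, ← LinearMap.comp_apply, LinearMap.rTensor_comp_lTensor,
    LinearMap.lTensor_comp_rTensor]

theorem assoc_rTensor_rTensor (f : X →ₗ[ℂ] Y) (t : (X ⊗[ℂ] V) ⊗[ℂ] W) :
    assoc ℂ Y V W ((f.rTensor V).rTensor W t) = f.rTensor (V ⊗[ℂ] W) (assoc ℂ X V W t) := by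
  induction t using TensorProduct.induction_on with
  | zero => simp
  | add x y hx hy => simp only [map_add, hx, hy]
  | tmul x w =>
    induction x using TensorProduct.induction_on with
    | zero => simp
    | add x y hx hy => simp only [map_add, TensorProduct.add_tmul, hx, hy]
    | tmul x v => simp

theorem assoc_lTensor_rTensor (f : X →ₗ[ℂ] Y) (t : (V ⊗[ℂ] X) ⊗[ℂ] W) :
    assoc ℂ V Y W ((f.lTensor V).rTensor W t) = (f.rTensor W).lTensor V (assoc ℂ V X W t) := by
  induction t using TensorProduct.induction_on with
  | zero => simp
  | add x y hx hy => simp only [map_add, hx, hy]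
  | tmul x w =>
    induction x using TensorProduct.induction_on with
    | zero => simp
    | add x y hx hy => simp only [map_add, TensorProduct.add_tmul, hx, hy]
    | tmul x v => simp

theorem assoc_lTensor (f : X →ₗ[ℂ] Y) (t : (V ⊗[ℂ] W) ⊗[ℂ] X) :
    assoc ℂ V W Y (f.lTensor (V ⊗[ℂ] W) t) = (f.lTensor W).lTensor V (assoc ℂ V W X t) := by
  induction t using TensorProduct.induction_on with
  | zero => simp
  | add x y hx hy => simp only [map_add, hx, hy]
  | tmul x w =>
    induction x using TensorProduct.induction_on with
    | zero => simp
    | add x y hx hy => simp only [map_add, TensorProduct.add_tmul, hx, hy]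
    | tmul x v => simp

/-- A jointly injective family of linear maps stays jointly injective on the left leg of a tensor
product. -/
theorem eq_of_forall_rTensor {ι : Type*} (f : ι → X →ₗ[ℂ] Y)
    (hf : ∀ x, (∀ i, f i x = 0) → x = 0) {u v : X ⊗[ℂ] V}
    (h : ∀ i, (f i).rTensor V u = (f i).rTensor V v) : u = v := by
  classical
  rw [← sub_eq_zero]
  have h' : ∀ i, (f i).rTensor V (u - v) = 0 := fun i => by rw [map_sub, h, sub_self]
  generalize u - v = w at h'
  let 𝓑 := Module.Basis.ofVectorSpace ℂ V
  let e := TensorProduct.equivFinsuppOfBasisRight (M := X) 𝓑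
  let e' := TensorProduct.equivFinsuppOfBasisRight (M := Y) 𝓑
  have nat : ∀ (f : X →ₗ[ℂ] Y) (w : X ⊗[ℂ] V) i, e' (f.rTensor V w) i = f (e w i) := by
    intro f w i
    induction w using TensorProduct.induction_on with
    | zero => simp
    | add x y hx hy => simp [hx, hy]
    | tmul a v => simp [e, e']
  apply e.injective
  rw [map_zero]
  ext i
  refine hf _ fun d => ?_
  have := nat (f d) w i
  rw [h' d] at this
  simpa using this.symm

/-- A jointly injective family of linear maps stays jointly injective on the right leg of a tensor
product. -/
theorem eq_of_forall_lTensor {ι : Type*} (f : ι → X →ₗ[ℂ] Y)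
    (hf : ∀ x, (∀ i, f i x = 0) → x = 0) {u v : V ⊗[ℂ] X}
    (h : ∀ i, (f i).lTensor V u = (f i).lTensor V v) : u = v := by
  apply (comm ℂ V X).injective
  refine eq_of_forall_rTensor f hf fun i => ?_
  have key : ∀ w : V ⊗[ℂ] X, (f i).rTensor V (comm ℂ V X w) =
      comm ℂ V Y ((f i).lTensor V w) := fun w => by
    induction w using TensorProduct.induction_on with
    | zero => simp
    | add x y hx hy => simp only [map_add, hx, hy]
    | tmul a v => simp
  rw [key, key, h]

theorem eq_zero_of_forall_lTensor {ι : Type*} (f : ι → X →ₗ[ℂ] Y)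
    (hf : ∀ x, (∀ i, f i x = 0) → x = 0) (u : V ⊗[ℂ] X)
    (h : ∀ i, (f i).lTensor V u = 0) : u = 0 :=
  eq_of_forall_lTensor f hf fun i => by rw [h, map_zero]

theorem eq_zero_of_forall_rTensor {ι : Type*} (f : ι → X →ₗ[ℂ] Y)
    (hf : ∀ x, (∀ i, f i x = 0) → x = 0) (u : X ⊗[ℂ] V)
    (h : ∀ i, (f i).rTensor V u = 0) : u = 0 :=
  eq_of_forall_rTensor f hf fun i => by rw [h, map_zero]

/-- Linear maps that agree on the pure tensors agree. -/
theorem forall_of_tmul {f g : X ⊗[ℂ] Y →ₗ[ℂ] Z} (h : ∀ x y, f (x ⊗ₜ y) = g (x ⊗ₜ y))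
    (t : X ⊗[ℂ] Y) : f t = g t :=
  LinearMap.congr_fun (TensorProduct.ext' h) t

/-- `x ⊗ y ↦ (f x) · y` in the second leg: for `f : X → P ⊗ Q` and `β : Q → Y → W`, the map
`x ⊗ y ↦ ∑ p ⊗ β q y`, where `f x = ∑ p ⊗ q`. -/
noncomputable def contractRight {P Q : Type*} [AddCommGroup P] [Module ℂ P] [AddCommGroup Q]
    [Module ℂ Q] (f : X →ₗ[ℂ] P ⊗[ℂ] Q) (β : Q →ₗ[ℂ] Y →ₗ[ℂ] W) :
    X ⊗[ℂ] Y →ₗ[ℂ] P ⊗[ℂ] W :=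
  (lift β).lTensor P ∘ₗ (assoc ℂ P Q Y).toLinearMap ∘ₗ f.rTensor Y

theorem contractRight_tmul {P Q : Type*} [AddCommGroup P] [Module ℂ P] [AddCommGroup Q]
    [Module ℂ Q] (f : X →ₗ[ℂ] P ⊗[ℂ] Q) (β : Q →ₗ[ℂ] Y →ₗ[ℂ] W) (x : X) (y : Y) :
    contractRight f β (x ⊗ₜ y) = (β.flip y).lTensor P (f x) := by
  simp only [contractRight, LinearMap.comp_apply, LinearMap.rTensor_tmul, LinearEquiv.coe_coe]
  induction f x using TensorProduct.induction_on with
  | zero => simp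
  | add x y hx hy => simp only [map_add, TensorProduct.add_tmul, hx, hy]
  | tmul x v => simp

/-- For `f : Y → P ⊗ Q` and `β : X → P → W`, the map `x ⊗ y ↦ ∑ β x p ⊗ q`, where
`f y = ∑ p ⊗ q`. -/
noncomputable def contractLeft {P Q : Type*} [AddCommGroup P] [Module ℂ P] [AddCommGroup Q]
    [Module ℂ Q] (f : Y →ₗ[ℂ] P ⊗[ℂ] Q) (β : X →ₗ[ℂ] P →ₗ[ℂ] W) :
    X ⊗[ℂ] Y →ₗ[ℂ] W ⊗[ℂ] Q :=
  (lift β).rTensor Q ∘ₗ (assoc ℂ X P Q).symm.toLinearMap ∘ₗ f.lTensor X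

theorem contractLeft_tmul {P Q : Type*} [AddCommGroup P] [Module ℂ P] [AddCommGroup Q]
    [Module ℂ Q] (f : Y →ₗ[ℂ] P ⊗[ℂ] Q) (β : X →ₗ[ℂ] P →ₗ[ℂ] W) (x : X) (y : Y) :
    contractLeft f β (x ⊗ₜ y) = (β x).rTensor Q (f y) := by
  simp only [contractLeft, LinearMap.comp_apply, LinearMap.lTensor_tmul, LinearEquiv.coe_coe]
  induction f y using TensorProduct.induction_on with
  | zero => simp
  | add x y hx hy => simp only [map_add, TensorProduct.tmul_add, hx, hy]
  | tmul x v => simp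

end Legs

/-! ### The canonical maps of a multiplier Hopf algebra -/

section Canonical

variable {E : Type*} [NonUnitalNonAssocRing E] [Module ℂ E] [IsScalarTower ℂ E E]
  [SMulCommClass ℂ E E]

/-- For a map `T₂` thought of as `u ⊗ x ↦ (u ⊗ 1)Δ(x)`, right multiplication by `Δ(x)` on `E ⊗ E`,
that is `u ⊗ v ↦ (1 ⊗ v) T₂ (u ⊗ x)`. -/
noncomputable def rightMul (T : E ⊗[ℂ] E →ₗ[ℂ] E ⊗[ℂ] E) (x : E) :
    E ⊗[ℂ] E →ₗ[ℂ] E ⊗[ℂ] E :=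
  contractRight (T ∘ₗ (TensorProduct.mk ℂ E E).flip x) (LinearMap.mul ℂ E).flip

/-- For a map `T₁` thought of as `x ⊗ v ↦ Δ(x)(1 ⊗ v)`, left multiplication by `Δ(x)` on `E ⊗ E`,
that is `u ⊗ v ↦ T₁ (x ⊗ v) (u ⊗ 1)`. -/
noncomputable def leftMul (T : E ⊗[ℂ] E →ₗ[ℂ] E ⊗[ℂ] E) (x : E) :
    E ⊗[ℂ] E →ₗ[ℂ] E ⊗[ℂ] E :=
  contractLeft (T ∘ₗ TensorProduct.mk ℂ E E x) (LinearMap.mul ℂ E).flip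

theorem rightMul_tmul (T : E ⊗[ℂ] E →ₗ[ℂ] E ⊗[ℂ] E) (x u v : E) :
    rightMul T x (u ⊗ₜ v) = (mulLeft ℂ v).lTensor E (T (u ⊗ₜ x)) := by
  rw [rightMul, contractRight_tmul]; rfl

theorem leftMul_tmul (T : E ⊗[ℂ] E →ₗ[ℂ] E ⊗[ℂ] E) (x u v : E) :
    leftMul T x (u ⊗ₜ v) = (mulRight ℂ u).rTensor E (T (x ⊗ₜ v)) := by
  rw [leftMul, contractLeft_tmul]; rfl

variable (E) in
/-- A multiplier Hopf algebra described by its canonical maps `T₁ (x ⊗ y) = Δ(x)(1 ⊗ y)` and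
`T₂ (x ⊗ y) = (x ⊗ 1)Δ(y)` on `E ⊗ E` alone, without reference to multipliers: `compat` says
`(w ⊗ 1)(Δ(x)(1 ⊗ y)) = ((w ⊗ 1)Δ(x))(1 ⊗ y)`, and `T₂_mul` says that `Δ` is multiplicative. -/
structure CanonicalPair where
  mul_assoc : ∀ a b c : E, a * b * c = a * (b * c)
  eq_zero_of_mul : ∀ a : E, (∀ b, a * b = 0) → a = 0
  eq_zero_of_mul' : ∀ a : E, (∀ b, b * a = 0) → a = 0
  /-- the map `x ⊗ y ↦ Δ(x)(1 ⊗ y)` -/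
  T₁ : E ⊗[ℂ] E ≃ₗ[ℂ] E ⊗[ℂ] E
  /-- the map `x ⊗ y ↦ (x ⊗ 1)Δ(y)` -/
  T₂ : E ⊗[ℂ] E ≃ₗ[ℂ] E ⊗[ℂ] E
  compat : ∀ w x y, (mulLeft ℂ w).rTensor E (T₁ (x ⊗ₜ y)) =
    (mulRight ℂ y).lTensor E (T₂ (w ⊗ₜ x))
  T₂_mul : ∀ w x x', T₂ (w ⊗ₜ (x * x')) = rightMul T₂.toLinearMap x' (T₂ (w ⊗ₜ x))
  coassoc : ∀ a b c,
    T₂.toLinearMap.rTensor E ((assoc ℂ E E E).symm (a ⊗ₜ T₁ (b ⊗ₜ c))) =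
      (assoc ℂ E E E).symm (T₁.toLinearMap.lTensor E (assoc ℂ E E E (T₂ (a ⊗ₜ b) ⊗ₜ c)))

namespace CanonicalPair

variable (G : CanonicalPair E) {V W : Type*} [AddCommGroup V] [Module ℂ V] [AddCommGroup W]
  [Module ℂ W]

/-- `t₁ y x = Δ(x)(1 ⊗ y)`, linear in `x`. -/
noncomputable def t₁ (y : E) : E →ₗ[ℂ] E ⊗[ℂ] E :=
  G.T₁.toLinearMap ∘ₗ (TensorProduct.mk ℂ E E).flip y

/-- `t₂ w x = (w ⊗ 1)Δ(x)`, linear in `x`. -/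
noncomputable def t₂ (w : E) : E →ₗ[ℂ] E ⊗[ℂ] E := G.T₂.toLinearMap ∘ₗ TensorProduct.mk ℂ E E w

theorem t₁_apply (y x : E) : G.t₁ y x = G.T₁ (x ⊗ₜ y) := rfl

theorem t₂_apply (w x : E) : G.t₂ w x = G.T₂ (w ⊗ₜ x) := rfl

theorem t_compat (w x y : E) :
    (mulLeft ℂ w).rTensor E (G.t₁ y x) = (mulRight ℂ y).lTensor E (G.t₂ w x) := G.compat w x y

theorem t_coassoc (w x y : E) :
    assoc ℂ E E E ((G.t₂ w).rTensor E (G.t₁ y x)) = (G.t₁ y).lTensor E (G.t₂ w x) := by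
  have h := congrArg (assoc ℂ E E E) (G.coassoc w x y)
  rw [LinearEquiv.apply_symm_apply] at h
  convert h using 1
  · rw [t₁_apply]
    generalize G.T₁ (x ⊗ₜ y) = t
    induction t using TensorProduct.induction_on with
    | zero => simp
    | add x y hx hy => simp only [map_add, TensorProduct.tmul_add, hx, hy]
    | tmul x v => simp [t₂]
  · rw [t₂_apply]
    generalize G.T₂ (w ⊗ₜ x) = t
    induction t using TensorProduct.induction_on with
    | zero => simp
    | add x y hx hy => simp only [map_add, TensorProduct.add_tmul, hx, hy]
    | tmul x v => simp [t₁]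

theorem eq_of_mulLeft_rTensor (G : CanonicalPair E) {u v : E ⊗[ℂ] V}
    (h : ∀ d, (mulLeft ℂ d).rTensor V u = (mulLeft ℂ d).rTensor V v) : u = v :=
  eq_of_forall_rTensor (fun d : E => mulLeft ℂ d)
    (fun x hx => G.eq_zero_of_mul' x fun b => by simpa using hx b) h

theorem eq_of_mulRight_rTensor (G : CanonicalPair E) {u v : E ⊗[ℂ] V}
    (h : ∀ d, (mulRight ℂ d).rTensor V u = (mulRight ℂ d).rTensor V v) : u = v :=
  eq_of_forall_rTensor (fun d : E => mulRight ℂ d)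
    (fun x hx => G.eq_zero_of_mul x fun b => by simpa using hx b) h

theorem eq_of_mulLeft_lTensor (G : CanonicalPair E) {u v : V ⊗[ℂ] E}
    (h : ∀ d, (mulLeft ℂ d).lTensor V u = (mulLeft ℂ d).lTensor V v) : u = v :=
  eq_of_forall_lTensor (fun d : E => mulLeft ℂ d)
    (fun x hx => G.eq_zero_of_mul' x fun b => by simpa using hx b) h

theorem eq_of_mulRight_lTensor (G : CanonicalPair E) {u v : V ⊗[ℂ] E}
    (h : ∀ d, (mulRight ℂ d).lTensor V u = (mulRight ℂ d).lTensor V v) : u = v :=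
  eq_of_forall_lTensor (fun d : E => mulRight ℂ d)
    (fun x hx => G.eq_zero_of_mul x fun b => by simpa using hx b) h

theorem mulLeft_mul (G : CanonicalPair E) (a b : E) :
    mulLeft ℂ (a * b) = mulLeft ℂ a ∘ₗ mulLeft ℂ b := by
  ext x; simp [G.mul_assoc]

theorem mulRight_mul (G : CanonicalPair E) (a b : E) :
    mulRight ℂ (a * b) = mulRight ℂ b ∘ₗ mulRight ℂ a := by
  ext x; simp [G.mul_assoc]

theorem mulLeft_mulRight (G : CanonicalPair E) (a b x : E) :
    mulLeft ℂ a (mulRight ℂ b x) = mulRight ℂ b (mulLeft ℂ a x) := by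
  simp [G.mul_assoc]

/-- `Δ(x)(1 ⊗ y y') = (Δ(x)(1 ⊗ y))(1 ⊗ y')`. -/
theorem t₁_mul_right (x y y' : E) : G.t₁ (y * y') x = (mulRight ℂ y').lTensor E (G.t₁ y x) := by
  refine G.eq_of_mulLeft_rTensor fun w => ?_
  rw [G.t_compat, G.mulRight_mul, LinearMap.lTensor_comp_apply, ← G.t_compat, rTensor_lTensor]

/-- `(w w' ⊗ 1)Δ(x) = (w ⊗ 1)((w' ⊗ 1)Δ(x))`. -/
theorem t₂_mul_left (x w w' : E) : G.t₂ (w * w') x = (mulLeft ℂ w).rTensor E (G.t₂ w' x) := by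
  refine G.eq_of_mulRight_lTensor fun y => ?_
  rw [← G.t_compat, G.mulLeft_mul, LinearMap.rTensor_comp_apply, G.t_compat, rTensor_lTensor]

theorem t₂_mul (w x x' : E) : G.t₂ w (x * x') = rightMul G.T₂.toLinearMap x' (G.t₂ w x) :=
  G.T₂_mul w x x'

theorem rightMul_tmul (x u v : E) :
    rightMul G.T₂.toLinearMap x (u ⊗ₜ v) = (mulLeft ℂ v).lTensor E (G.t₂ u x) :=
  MultiplierHopf.rightMul_tmul _ _ _ _

theorem leftMul_tmul (x u v : E) :
    leftMul G.T₁.toLinearMap x (u ⊗ₜ v) = (mulRight ℂ u).rTensor E (G.t₁ v x) :=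
  MultiplierHopf.leftMul_tmul _ _ _ _

theorem mul_eq (G : CanonicalPair E) (s t u : E ⊗[ℂ] E) : s * t * u = s * (t * u) := by
  let _ : NonUnitalRing E := { ‹NonUnitalNonAssocRing E› with mul_assoc := G.mul_assoc }
  induction s using TensorProduct.induction_on with
  | zero => simp
  | add x y hx hy => simp only [add_mul, hx, hy]
  | tmul a b =>
    induction t using TensorProduct.induction_on with
    | zero => simp
    | add x y hx hy => simp only [mul_add, add_mul, hx, hy]
    | tmul c d =>
      induction u using TensorProduct.induction_on with
      | zero => simp
      | add x y hx hy => simp only [mul_add, hx, hy]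
      | tmul e f => simp [G.mul_assoc]

theorem tmul_mul (a b : E) (t : E ⊗[ℂ] E) :
    (a ⊗ₜ b) * t = (mulLeft ℂ a).rTensor E ((mulLeft ℂ b).lTensor E t) := by
  induction t using TensorProduct.induction_on with
  | zero => simp
  | add x y hx hy => simp only [mul_add, map_add, hx, hy]
  | tmul c d => simp

theorem mul_tmul (a b : E) (t : E ⊗[ℂ] E) :
    t * (a ⊗ₜ b) = (mulRight ℂ a).rTensor E ((mulRight ℂ b).lTensor E t) := by
  induction t using TensorProduct.induction_on with
  | zero => simp
  | add x y hx hy => simp only [add_mul, map_add, hx, hy]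
  | tmul c d => simp

theorem eq_of_mul_left (G : CanonicalPair E) {u v : E ⊗[ℂ] E} (h : ∀ z, z * u = z * v) : u = v := by
  refine G.eq_of_mulLeft_lTensor fun b => G.eq_of_mulLeft_rTensor fun a => ?_
  rw [← tmul_mul, ← tmul_mul, h]

theorem eq_of_mul_right (G : CanonicalPair E) {u v : E ⊗[ℂ] E} (h : ∀ z, u * z = v * z) :
    u = v := by
  refine G.eq_of_mulRight_lTensor fun b => G.eq_of_mulRight_rTensor fun a => ?_
  rw [← mul_tmul, ← mul_tmul, h]

/-- Left and right multiplication by `Δ(x)` form a double centralizer. -/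
theorem rightMul_mul (x : E) (s t : E ⊗[ℂ] E) :
    rightMul G.T₂.toLinearMap x s * t = s * leftMul G.T₁.toLinearMap x t := by
  induction s using TensorProduct.induction_on with
  | zero => simp
  | add x y hx hy => simp only [map_add, add_mul, hx, hy]
  | tmul a b =>
    induction t using TensorProduct.induction_on with
    | zero => simp
    | add x y hx hy => simp only [map_add, mul_add, hx, hy]
    | tmul c d =>
      rw [G.rightMul_tmul, G.leftMul_tmul, mul_tmul, tmul_mul]
      have h := G.t_compat a x d
      have l : ∀ (f g : E →ₗ[ℂ] E) t, (∀ x, f (g x) = g (f x)) →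
          f.lTensor E (g.lTensor E t) = g.lTensor E (f.lTensor E t) := fun f g t hfg => by
        rw [← LinearMap.lTensor_comp_apply, ← LinearMap.lTensor_comp_apply]
        congr 2; ext; simp [hfg]
      have r : ∀ (f g : E →ₗ[ℂ] E) t, (∀ x, f (g x) = g (f x)) →
          f.rTensor E (g.rTensor E t) = g.rTensor E (f.rTensor E t) := fun f g t hfg => by
        rw [← LinearMap.rTensor_comp_apply, ← LinearMap.rTensor_comp_apply]
        congr 2; ext; simp [hfg]
      rw [l (mulRight ℂ d) (mulLeft ℂ b) _ fun x => (G.mulLeft_mulRight _ _ _).symm, ← h,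
        ← rTensor_lTensor (mulLeft ℂ a), ← rTensor_lTensor (mulRight ℂ c),
        r (mulRight ℂ c) (mulLeft ℂ a) _ fun x => (G.mulLeft_mulRight _ _ _).symm]

theorem leftMul_mul (x x' : E) (t : E ⊗[ℂ] E) :
    leftMul G.T₁.toLinearMap (x * x') t =
      leftMul G.T₁.toLinearMap x (leftMul G.T₁.toLinearMap x' t) := by
  refine G.eq_of_mul_left fun z => ?_
  rw [← G.rightMul_mul, ← G.rightMul_mul, ← G.rightMul_mul]
  congr 1
  induction z using TensorProduct.induction_on with
  | zero => simp
  | add x y hx hy => simp only [map_add, hx, hy]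
  | tmul u v =>
    rw [G.rightMul_tmul, G.rightMul_tmul, G.t₂_mul]
    generalize G.t₂ u x = s
    induction s using TensorProduct.induction_on with
    | zero => simp
    | add x y hx hy => simp only [map_add, hx, hy]
    | tmul p q =>
      rw [LinearMap.lTensor_tmul, G.rightMul_tmul, G.rightMul_tmul, LinearMap.mulLeft_apply,
        G.mulLeft_mul, LinearMap.lTensor_comp_apply]

/-- `Δ(xx')(1 ⊗ y) = Δ(x)(Δ(x')(1 ⊗ y))`. -/
theorem t₁_mul (x x' y : E) : G.t₁ y (x * x') = leftMul G.T₁.toLinearMap x (G.t₁ y x') := by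
  refine G.eq_of_mulRight_rTensor fun u => ?_
  rw [← G.leftMul_tmul, G.leftMul_mul, G.leftMul_tmul]
  generalize G.t₁ y x' = s
  induction s using TensorProduct.induction_on with
  | zero => simp
  | add x y hx hy => simp only [map_add, hx, hy]
  | tmul p q =>
    rw [LinearMap.rTensor_tmul, G.leftMul_tmul, G.leftMul_tmul, LinearMap.mulRight_apply,
        G.mulRight_mul, LinearMap.rTensor_comp_apply]

end CanonicalPair

end Canonical

/-! ### Counit and antipode -/

section CounitAntipode

variable {E : Type*} [NonUnitalNonAssocRing E] [Module ℂ E] [IsScalarTower ℂ E E]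
  [SMulCommClass ℂ E E]

namespace CanonicalPair

variable (G : CanonicalPair E) {V W : Type*} [AddCommGroup V] [Module ℂ V] [AddCommGroup W]
  [Module ℂ W]

theorem coassoc_T₁ (w : E) (t : E ⊗[ℂ] E) :
    assoc ℂ E E E ((G.t₂ w).rTensor E (G.T₁ t)) =
      G.T₁.toLinearMap.lTensor E (assoc ℂ E E E ((G.t₂ w).rTensor E t)) := by
  induction t using TensorProduct.induction_on with
  | zero => simp
  | add x y hx hy => simp only [map_add, hx, hy]
  | tmul x y =>
    rw [← t₁_apply, t_coassoc, LinearMap.rTensor_tmul]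
    generalize G.t₂ w x = s
    induction s using TensorProduct.induction_on with
    | zero => simp
    | add x y hx hy => simp only [map_add, TensorProduct.add_tmul, hx, hy]
    | tmul p q => simp [t₁]

theorem coassoc_T₁_symm (w : E) (t : E ⊗[ℂ] E) :
    G.T₁.symm.toLinearMap.lTensor E (assoc ℂ E E E ((G.t₂ w).rTensor E t)) =
      assoc ℂ E E E ((G.t₂ w).rTensor E (G.T₁.symm t)) := by
  obtain ⟨s, rfl⟩ := G.T₁.surjective t
  rw [coassoc_T₁, LinearEquiv.symm_apply_apply, ← LinearMap.lTensor_comp_apply]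
  simp

theorem lTensor_mul_assoc_t₂ (w : E) (t : E ⊗[ℂ] E) :
    (mul' ℂ E).lTensor E (assoc ℂ E E E ((G.t₂ w).rTensor E t)) =
      (mulLeft ℂ w).rTensor E (G.T₁ t) := by
  induction t using TensorProduct.induction_on with
  | zero => simp
  | add x y hx hy => simp only [map_add, hx, hy]
  | tmul x y =>
    rw [← t₁_apply, t_compat, LinearMap.rTensor_tmul]
    generalize G.t₂ w x = s
    induction s using TensorProduct.induction_on with
    | zero => simp
    | add x y hx hy => simp only [map_add, TensorProduct.add_tmul, hx, hy]
    | tmul p q => simp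

theorem tmul_mul_T₁_symm (x y b : E) :
    x ⊗ₜ[ℂ] mul' ℂ E (G.T₁.symm (y ⊗ₜ b)) = mul' ℂ E (G.T₂.symm (x ⊗ₜ y)) ⊗ₜ[ℂ] b := by
  have key : ∀ t : E ⊗[ℂ] E, (mul' ℂ E).lTensor E (G.T₁.symm.toLinearMap.lTensor E
      (assoc ℂ E E E (G.T₂ t ⊗ₜ b))) = mul' ℂ E t ⊗ₜ[ℂ] b := fun t => by
    induction t using TensorProduct.induction_on with
    | zero => simp
    | add x y hx hy => simp only [map_add, TensorProduct.add_tmul, hx, hy]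
    | tmul c a =>
      have := G.coassoc_T₁_symm c (a ⊗ₜ b)
      rw [LinearMap.rTensor_tmul, t₂_apply] at this
      rw [this, lTensor_mul_assoc_t₂]
      simp
  have := key (G.T₂.symm (x ⊗ₜ y))
  simpa using this

theorem exists_scalar : ∃ ε : E →ₗ[ℂ] ℂ,
    (∀ y b, mul' ℂ E (G.T₁.symm (y ⊗ₜ b)) = ε y • b) ∧
      ∀ x y, mul' ℂ E (G.T₂.symm (x ⊗ₜ y)) = ε y • x := by
  by_cases hE : ∃ x₀ : E, x₀ ≠ 0
  · obtain ⟨x₀, hx₀⟩ := hE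
    obtain ⟨f, hf⟩ : ∃ f : E →ₗ[ℂ] ℂ, f x₀ ≠ 0 := by
      by_contra! h
      exact hx₀ ((Module.forall_dual_apply_eq_zero_iff ℂ x₀).mp h)
    have h1 : ∀ y b, mul' ℂ E (G.T₁.symm (y ⊗ₜ b)) =
        ((f x₀)⁻¹ * f (mul' ℂ E (G.T₂.symm (x₀ ⊗ₜ y)))) • b := fun y b => by
      have := congrArg (lid ℂ E ∘ f.rTensor E) (G.tmul_mul_T₁_symm x₀ y b)
      simp only [Function.comp, LinearMap.rTensor_tmul, TensorProduct.lid_tmul] at this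
      rw [mul_smul, ← this, smul_smul, inv_mul_cancel₀ hf, one_smul]
    refine ⟨(f x₀)⁻¹ • (f ∘ₗ mul' ℂ E ∘ₗ G.T₂.symm.toLinearMap ∘ₗ TensorProduct.mk ℂ E E x₀),
      h1, fun x y => ?_⟩
    have := congrArg (rid ℂ E ∘ f.lTensor E) (G.tmul_mul_T₁_symm x y x₀)
    simp only [Function.comp, LinearMap.lTensor_tmul, TensorProduct.rid_tmul, h1, map_smul] at this
    have h2 := congrArg ((f x₀)⁻¹ • ·) this
    simp only [smul_smul, smul_eq_mul] at h2
    rw [inv_mul_cancel₀ hf, one_smul] at h2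
    rw [← h2]
    congr 1
    simp only [LinearMap.smul_apply, LinearMap.comp_apply, LinearEquiv.coe_coe,
      TensorProduct.mk_apply, smul_eq_mul]
    field_simp
  · push Not at hE
    exact ⟨0, fun y b => by rw [hE (mul' ℂ E _), hE b, smul_zero],
      fun y b => by rw [hE (mul' ℂ E _), hE y, smul_zero]⟩

/-- The counit `ε`, the functional with `m T₁⁻¹ (y ⊗ b) = ε(y) b`. -/
noncomputable def counit : E →ₗ[ℂ] ℂ := G.exists_scalar.choose

theorem mul_T₁_symm (t : E ⊗[ℂ] E) :
    mul' ℂ E (G.T₁.symm t) = lid ℂ E (G.counit.rTensor E t) := by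
  induction t using TensorProduct.induction_on with
  | zero => simp
  | add x y hx hy => simp only [map_add, hx, hy]
  | tmul x y => rw [G.exists_scalar.choose_spec.1]; simp [counit]

theorem mul_T₂_symm (t : E ⊗[ℂ] E) :
    mul' ℂ E (G.T₂.symm t) = rid ℂ E (G.counit.lTensor E t) := by
  induction t using TensorProduct.induction_on with
  | zero => simp
  | add x y hx hy => simp only [map_add, hx, hy]
  | tmul x y => rw [G.exists_scalar.choose_spec.2]; simp [counit]

theorem counit_left (x y : E) : lid ℂ E (G.counit.rTensor E (G.t₁ y x)) = x * y := by
  rw [← mul_T₁_symm, t₁_apply, LinearEquiv.symm_apply_apply, LinearMap.mul'_apply]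

theorem counit_right (x y : E) : rid ℂ E (G.counit.lTensor E (G.t₂ x y)) = x * y := by
  rw [← mul_T₂_symm, t₂_apply, LinearEquiv.symm_apply_apply, LinearMap.mul'_apply]

/-- The counit is determined by its left counit property. -/
theorem eq_counit {ε : E →ₗ[ℂ] ℂ} (h : ∀ x y, lid ℂ E (ε.rTensor E (G.t₁ y x)) = x * y) :
    ε = G.counit := by
  have key : ∀ t : E ⊗[ℂ] E, lid ℂ E (ε.rTensor E t) = lid ℂ E (G.counit.rTensor E t) := fun t => by
    obtain ⟨t, rfl⟩ := G.T₁.surjective t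
    induction t using TensorProduct.induction_on with
    | zero => simp
    | add x y hx hy => simp only [map_add, hx, hy]
    | tmul x y => rw [← t₁_apply, h, counit_left]
  ext x
  by_contra hx
  have := key (x ⊗ₜ x)
  simp only [LinearMap.rTensor_tmul, TensorProduct.lid_tmul] at this
  rw [← sub_eq_zero, ← sub_smul] at this
  exact hx (by simp [(smul_eq_zero.mp this).resolve_left (sub_ne_zero.mpr hx)])

theorem eq_zero_of_counit_smul {v : E} (h : ∀ x, G.counit x • v = 0) : v = 0 := by
  by_contra hv
  have h0 : G.counit = 0 := by
    ext x
    exact (smul_eq_zero.mp (h x)).resolve_right hv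
  refine hv (G.eq_zero_of_mul v fun b => ?_)
  rw [← G.counit_left, h0]
  simp

/-- The counit takes the value `1` unless the algebra is zero. -/
theorem exists_counit_eq_one {v : E} (hv : v ≠ 0) : ∃ x, G.counit x = 1 := by
  by_contra! h
  refine hv (G.eq_zero_of_counit_smul fun x => ?_)
  have : G.counit x = 0 := by
    by_contra hx
    exact h ((G.counit x)⁻¹ • x) (by simp [hx])
  rw [this, zero_smul]

theorem counit_leftMul (x : E) (t : E ⊗[ℂ] E) :
    lid ℂ E (G.counit.rTensor E (leftMul G.T₁.toLinearMap x t)) =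
      x * lid ℂ E (G.counit.rTensor E t) := by
  obtain ⟨t, rfl⟩ := G.T₁.surjective t
  induction t using TensorProduct.induction_on with
  | zero => simp
  | add x y hx hy => simp only [map_add, mul_add, hx, hy]
  | tmul p q => rw [← t₁_apply, ← t₁_mul, counit_left, counit_left, G.mul_assoc]

theorem counit_mul (x y : E) : G.counit (x * y) = G.counit x * G.counit y := by
  have key : ∀ (t : E ⊗[ℂ] E) u, lid ℂ E (G.counit.rTensor E ((mulRight ℂ u).rTensor E t)) =
      G.counit u • lid ℂ E (G.counit.rTensor E t) := fun t u => by
    obtain ⟨t, rfl⟩ := G.T₁.surjective t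
    induction t using TensorProduct.induction_on with
    | zero => simp
    | add x y hx hy => simp only [map_add, smul_add, hx, hy]
    | tmul p q =>
      rw [← t₁_apply, ← leftMul_tmul, counit_leftMul, counit_left]
      simp [mul_smul_comm]
  have h := key (x ⊗ₜ x) y
  simp only [LinearMap.rTensor_tmul, TensorProduct.lid_tmul, LinearMap.mulRight_apply,
    smul_smul] at h
  rw [← sub_eq_zero, ← sub_smul, smul_eq_zero, sub_eq_zero] at h
  rcases h with h | rfl
  · rw [h, mul_comm]
  · simp

/-- The map `x ⊗ b ↦ S(x)b`, where `S` is the antipode. -/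
noncomputable def antipodeMul : E ⊗[ℂ] E →ₗ[ℂ] E :=
  (lid ℂ E).toLinearMap ∘ₗ G.counit.rTensor E ∘ₗ G.T₁.symm.toLinearMap

theorem antipodeMul_T₁ (t : E ⊗[ℂ] E) :
    G.antipodeMul (G.T₁ t) = lid ℂ E (G.counit.rTensor E t) := by
  simp [antipodeMul]

theorem antipodeMul_t₁ (x y : E) : G.antipodeMul (G.t₁ y x) = G.counit x • y := by
  simp [t₁_apply, antipodeMul_T₁]

theorem T₁_mulRight_lTensor (c : E) (t : E ⊗[ℂ] E) :
    G.T₁ ((mulRight ℂ c).lTensor E t) = (mulRight ℂ c).lTensor E (G.T₁ t) := by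
  induction t using TensorProduct.induction_on with
  | zero => simp
  | add x y hx hy => simp only [map_add, hx, hy]
  | tmul x y =>
    rw [LinearMap.lTensor_tmul, LinearMap.mulRight_apply, ← t₁_apply, t₁_mul_right, t₁_apply]

theorem antipodeMul_mulRight (c : E) (t : E ⊗[ℂ] E) :
    G.antipodeMul ((mulRight ℂ c).lTensor E t) = G.antipodeMul t * c := by
  obtain ⟨t, rfl⟩ := G.T₁.surjective t
  rw [← T₁_mulRight_lTensor, antipodeMul_T₁, antipodeMul_T₁]
  induction t using TensorProduct.induction_on with
  | zero => simp
  | add x y hx hy => simp only [map_add, add_mul, hx, hy]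
  | tmul x y => simp [smul_mul_assoc]

theorem antipodeMul_leftMul (x : E) (t : E ⊗[ℂ] E) :
    G.antipodeMul (leftMul G.T₁.toLinearMap x t) = G.counit x • G.antipodeMul t := by
  obtain ⟨t, rfl⟩ := G.T₁.surjective t
  induction t using TensorProduct.induction_on with
  | zero => simp
  | add x y hx hy => simp only [map_add, smul_add, hx, hy]
  | tmul p q =>
    rw [← t₁_apply, ← t₁_mul, antipodeMul_t₁, antipodeMul_t₁, counit_mul, mul_smul]

/-- `S(xy)b = S(y)(S(x)b)`. -/
theorem antipodeMul_mul (x y b : E) :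
    G.antipodeMul ((x * y) ⊗ₜ b) = G.antipodeMul (y ⊗ₜ G.antipodeMul (x ⊗ₜ b)) := by
  have key : ∀ t : E ⊗[ℂ] E, G.antipodeMul ((mulRight ℂ y).rTensor E t) =
      G.antipodeMul (y ⊗ₜ G.antipodeMul t) := fun t => by
    obtain ⟨t, rfl⟩ := G.T₁.surjective t
    induction t using TensorProduct.induction_on with
    | zero => simp
    | add x y hx hy => simp only [map_add, TensorProduct.tmul_add, hx, hy]
    | tmul p q =>
      rw [← t₁_apply, ← leftMul_tmul, antipodeMul_leftMul, antipodeMul_t₁]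
      simp
  simpa using key (x ⊗ₜ b)

/-- `S` represents the antipode, as a map with values in the algebra. -/
def IsAntipode (S : E →ₗ[ℂ] E) : Prop := ∀ x b, S x * b = G.antipodeMul (x ⊗ₜ b)

/-- A map satisfying the left antipode identity is the antipode. -/
theorem isAntipode_of_left {S : E →ₗ[ℂ] E}
    (h : ∀ x y, mul' ℂ E (S.rTensor E (G.t₁ y x)) = G.counit x • y) : G.IsAntipode S := by
  have key : ∀ t : E ⊗[ℂ] E, mul' ℂ E (S.rTensor E t) = G.antipodeMul t := fun t => by
    obtain ⟨t, rfl⟩ := G.T₁.surjective t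
    induction t using TensorProduct.induction_on with
    | zero => simp
    | add x y hx hy => simp only [map_add, hx, hy]
    | tmul x y => rw [← t₁_apply, h, antipodeMul_t₁]
  intro x b
  simpa using key (x ⊗ₜ b)

namespace IsAntipode

variable {G} {S : E →ₗ[ℂ] E} (hS : G.IsAntipode S)
include hS

theorem mul'_rTensor (t : E ⊗[ℂ] E) : mul' ℂ E (S.rTensor E t) = G.antipodeMul t := by
  induction t using TensorProduct.induction_on with
  | zero => simp
  | add x y hx hy => simp only [map_add, hx, hy]
  | tmul x y => simpa using hS x y

theorem left (x y : E) : mul' ℂ E (S.rTensor E (G.t₁ y x)) = G.counit x • y := by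
  rw [hS.mul'_rTensor, antipodeMul_t₁]

theorem map_mul (x y : E) : S (x * y) = S y * S x := by
  refine sub_eq_zero.mp (G.eq_zero_of_mul _ fun b => ?_)
  rw [sub_mul, sub_eq_zero, hS, antipodeMul_mul, ← hS, ← hS, G.mul_assoc]

theorem right (w x : E) : mul' ℂ E (S.lTensor E (G.t₂ w x)) = G.counit x • w := by
  refine sub_eq_zero.mp (G.eq_zero_of_mul _ fun c => ?_)
  rw [sub_mul, sub_eq_zero]
  have h1 : ∀ t : E ⊗[ℂ] E, mul' ℂ E (S.lTensor E t) * c =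
      mul' ℂ E (G.antipodeMul.lTensor E (assoc ℂ E E E (t ⊗ₜ c))) := fun t => by
    induction t using TensorProduct.induction_on with
    | zero => simp
    | add x y hx hy => simp only [map_add, add_mul, TensorProduct.add_tmul, hx, hy]
    | tmul x y => simp [G.mul_assoc, hS y c]
  have h2 : ∀ t : E ⊗[ℂ] E, mul' ℂ E (((lid ℂ E).toLinearMap ∘ₗ G.counit.rTensor E).lTensor E
      (assoc ℂ E E E ((G.t₂ w).rTensor E t))) = w * mul' ℂ E t := fun t => by
    induction t using TensorProduct.induction_on with
    | zero => simp
    | add x y hx hy => simp only [map_add, mul_add, hx, hy]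
    | tmul x y =>
      rw [LinearMap.mul'_apply, ← G.mul_assoc, ← G.counit_right w x, LinearMap.rTensor_tmul]
      generalize G.t₂ w x = s
      induction s using TensorProduct.induction_on with
      | zero => simp
      | add x y hx hy => simp only [map_add, add_mul, TensorProduct.add_tmul, hx, hy]
      | tmul x y => simp [smul_mul_assoc]
  have h3 := G.coassoc_T₁_symm w (x ⊗ₜ c)
  rw [LinearMap.rTensor_tmul] at h3
  rw [h1, antipodeMul, ← LinearMap.comp_assoc, LinearMap.lTensor_comp_apply, h3, h2, mul_T₁_symm]
  simp [smul_mul_assoc, mul_smul_comm]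

theorem eq_zero_of_antipode_mul {x : E} (h : ∀ b, S b * x = 0) : x = 0 := by
  refine G.eq_zero_of_mul' x fun w => G.eq_zero_of_counit_smul fun b => ?_
  rw [← smul_mul_assoc, ← hS.right]
  generalize G.t₂ w b = t
  induction t using TensorProduct.induction_on with
  | zero => simp
  | add x y hx hy => simp only [map_add, add_mul, hx, hy, add_zero]
  | tmul p q => simp [G.mul_assoc, h]

end IsAntipode

end CanonicalPair

end CounitAntipode

/-! ### Opposite coproducts and regularity -/

section Regular

variable {E : Type*} [NonUnitalNonAssocRing E] [Module ℂ E] [IsScalarTower ℂ E E]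
  [SMulCommClass ℂ E E]

theorem comm_rTensor {X Y V : Type*} [AddCommGroup X] [Module ℂ X] [AddCommGroup Y] [Module ℂ Y]
    [AddCommGroup V] [Module ℂ V] (f : X →ₗ[ℂ] Y) (t : X ⊗[ℂ] V) :
    comm ℂ Y V (f.rTensor V t) = f.lTensor V (comm ℂ X V t) := by
  induction t using TensorProduct.induction_on with
  | zero => simp
  | add x y hx hy => simp only [map_add, hx, hy]
  | tmul x y => simp

theorem comm_lTensor {X Y V : Type*} [AddCommGroup X] [Module ℂ X] [AddCommGroup Y] [Module ℂ Y]
    [AddCommGroup V] [Module ℂ V] (f : X →ₗ[ℂ] Y) (t : V ⊗[ℂ] X) :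
    comm ℂ V Y (f.lTensor V t) = f.rTensor V (comm ℂ V X t) := by
  induction t using TensorProduct.induction_on with
  | zero => simp
  | add x y hx hy => simp only [map_add, hx, hy]
  | tmul x y => simp

namespace CanonicalPair

theorem lTensor_mulRight_mulLeft (G : CanonicalPair E) {V : Type*} [AddCommGroup V] [Module ℂ V]
    (a b : E) (t : V ⊗[ℂ] E) : (mulRight ℂ a).lTensor V ((mulLeft ℂ b).lTensor V t) =
      (mulLeft ℂ b).lTensor V ((mulRight ℂ a).lTensor V t) := by
  rw [← LinearMap.lTensor_comp_apply, ← LinearMap.lTensor_comp_apply]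
  congr 2
  ext x
  simp [G.mul_assoc]

theorem rTensor_mulRight_mulLeft (G : CanonicalPair E) {V : Type*} [AddCommGroup V] [Module ℂ V]
    (a b : E) (t : E ⊗[ℂ] V) : (mulRight ℂ a).rTensor V ((mulLeft ℂ b).rTensor V t) =
      (mulLeft ℂ b).rTensor V ((mulRight ℂ a).rTensor V t) := by
  rw [← LinearMap.rTensor_comp_apply, ← LinearMap.rTensor_comp_apply]
  congr 2
  ext x
  simp [G.mul_assoc]

/-- `G'` is the opposite coproduct of `G`: the two ways to form `Δ(p)(c ⊗ q)` agree. -/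
def IsOpposite (G G' : CanonicalPair E) : Prop :=
  ∀ p q c, (mulRight ℂ c).rTensor E (G.t₁ q p) =
    comm ℂ E E ((mulRight ℂ q).rTensor E (G'.t₁ c p))

namespace IsOpposite

variable {G G' : CanonicalPair E} (h : G.IsOpposite G')
include h

theorem symm : G'.IsOpposite G := fun p q c => by
  have := congrArg (comm ℂ E E) (h p c q)
  rw [← LinearEquiv.trans_apply, TensorProduct.comm_trans_comm] at this
  exact this.symm

/-- `((w ⊗ 1)Δ(p))(c ⊗ 1) = (w ⊗ 1)(Δ(p)(c ⊗ 1))`. -/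
theorem t₂_mulRight (w p c : E) : (mulRight ℂ c).rTensor E (G.t₂ w p) =
    comm ℂ E E ((mulLeft ℂ w).lTensor E (G'.t₁ c p)) := by
  refine G.eq_of_mulRight_lTensor fun y => ?_
  rw [← rTensor_lTensor, ← t_compat, ← comm_rTensor, rTensor_lTensor, comm_lTensor, ← h,
    ← LinearMap.rTensor_comp_apply, ← LinearMap.rTensor_comp_apply]
  congr 2
  ext x
  simp [G.mul_assoc]

/-- `(w ⊗ c)Δ(p)`, computed with either of the two coproducts. -/
theorem t₂_mulLeft (w p c : E) : (mulLeft ℂ c).lTensor E (G.t₂ w p) =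
    comm ℂ E E ((mulLeft ℂ w).lTensor E (G'.t₂ c p)) := by
  refine G.eq_of_mulRight_rTensor fun y => ?_
  rw [rTensor_lTensor, h.t₂_mulRight, ← comm_rTensor, ← comm_lTensor,
    G'.lTensor_mulRight_mulLeft, ← G'.t_compat, rTensor_lTensor]

theorem counit_eq : G'.counit = G.counit := by
  refine (G'.eq_counit fun x y => ?_).symm
  refine sub_eq_zero.mp (G.eq_zero_of_mul' _ fun w => ?_)
  rw [mul_sub, sub_eq_zero, ← G.mul_assoc, ← G.counit_right w x]
  have := h.t₂_mulRight w x y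
  have h1 : ∀ t : E ⊗[ℂ] E, rid ℂ E (G.counit.lTensor E t) * y =
      rid ℂ E (G.counit.lTensor E ((mulRight ℂ y).rTensor E t)) := fun t => by
    induction t using TensorProduct.induction_on with
    | zero => simp
    | add x y hx hy => simp only [map_add, add_mul, hx, hy]
    | tmul p q => simp [smul_mul_assoc]
  rw [h1, this]
  generalize G'.t₁ y x = t
  induction t using TensorProduct.induction_on with
  | zero => simp
  | add x y hx hy => simp only [map_add, mul_add, hx, hy]
  | tmul p q => simp [mul_smul_comm]

/-- If `S` and `S'` denote the antipodes of `Δ` and of the opposite coproduct, then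
`S'(S(a)b)c = S'(b)ac`. -/
theorem antipodeMul_antipodeMul (a b c : E) :
    G'.antipodeMul (G.antipodeMul (a ⊗ₜ b) ⊗ₜ c) = G'.antipodeMul (b ⊗ₜ (a * c)) := by
  have key : ∀ t : E ⊗[ℂ] E, G'.antipodeMul (G.antipodeMul t ⊗ₜ c) =
      G'.antipodeMul (comm ℂ E E ((mulRight ℂ c).rTensor E t)) := fun t => by
    obtain ⟨t, rfl⟩ := G.T₁.surjective t
    induction t using TensorProduct.induction_on with
    | zero => simp
    | add x y hx hy => simp only [map_add, TensorProduct.add_tmul, hx, hy]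
    | tmul p q =>
      rw [← t₁_apply, h p q c, antipodeMul_t₁, ← LinearEquiv.trans_apply,
        TensorProduct.comm_trans_comm, LinearEquiv.refl_apply, ← leftMul_tmul, antipodeMul_leftMul,
        h.counit_eq, ← TensorProduct.smul_tmul', map_smul]
  simpa using key (a ⊗ₜ b)

/-- The antipode of the opposite coproduct takes values in the algebra. -/
theorem exists_isAntipode' : ∃ S' : E →ₗ[ℂ] E, G'.IsAntipode S' := by
  by_cases hE : ∃ v : E, v ≠ 0
  · obtain ⟨v, hv⟩ := hE
    obtain ⟨p, hp⟩ := G.exists_counit_eq_one hv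
    refine ⟨G'.antipodeMul ∘ₗ (comm ℂ E E).toLinearMap ∘ₗ G.T₁.toLinearMap ∘ₗ
      TensorProduct.mk ℂ E E p, fun y c => ?_⟩
    have key : ∀ t : E ⊗[ℂ] E, G'.antipodeMul (comm ℂ E E t) * c =
        G'.antipodeMul (G.antipodeMul t ⊗ₜ c) := fun t => by
      induction t using TensorProduct.induction_on with
      | zero => simp
      | add x y hx hy => simp only [map_add, add_mul, TensorProduct.add_tmul, hx, hy]
      | tmul a b =>
        rw [h.antipodeMul_antipodeMul, TensorProduct.comm_tmul, ← antipodeMul_mulRight,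
          LinearMap.lTensor_tmul, LinearMap.mulRight_apply]
    refine (key (G.T₁ (p ⊗ₜ y))).trans ?_
    rw [← t₁_apply, antipodeMul_t₁, hp, one_smul]
  · push Not at hE
    exact ⟨0, fun x b => by rw [hE (_ * _), hE (antipodeMul _ _)]⟩

theorem exists_isAntipode : ∃ S : E →ₗ[ℂ] E, G.IsAntipode S := h.symm.exists_isAntipode'

/-- The antipodes of the two coproducts are inverse to each other. -/
theorem antipode_antipode {S S' : E →ₗ[ℂ] E} (hS : G.IsAntipode S) (hS' : G'.IsAntipode S')
    (a : E) : S' (S a) = a := by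
  refine sub_eq_zero.mp (hS'.eq_zero_of_antipode_mul fun b => ?_)
  refine G.eq_zero_of_mul _ fun c => ?_
  rw [mul_sub, sub_mul, sub_eq_zero, ← hS'.map_mul, hS, hS', h.antipodeMul_antipodeMul, ← hS',
    G.mul_assoc]

theorem antipode_bijective {S : E →ₗ[ℂ] E} (hS : G.IsAntipode S) : Function.Bijective S := by
  obtain ⟨S', hS'⟩ := h.exists_isAntipode'
  exact ⟨Function.LeftInverse.injective (h.antipode_antipode hS hS'),
    Function.RightInverse.surjective (h.symm.antipode_antipode hS' hS)⟩

end IsOpposite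

end CanonicalPair

end Regular

section Interface

variable {E : Type*} [NonUnitalNonAssocRing E] [Module ℂ E] [IsScalarTower ℂ E E]
  [SMulCommClass ℂ E E]

theorem mulRight_rTensor_mul (hE : ∀ a b c : E, a * b * c = a * (b * c)) (w : E)
    (s t : E ⊗[ℂ] E) :
    (mulRight ℂ w).rTensor E s * t = s * (mulLeft ℂ w).rTensor E t := by
  induction s using TensorProduct.induction_on with
  | zero => simp
  | add x y hx hy => simp only [map_add, add_mul, hx, hy]
  | tmul a b =>
    induction t using TensorProduct.induction_on with
    | zero => simp
    | add x y hx hy => simp only [map_add, mul_add, hx, hy]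
    | tmul c d => simp [hE]

theorem mulRight_lTensor_mul (hE : ∀ a b c : E, a * b * c = a * (b * c)) (w : E)
    (s t : E ⊗[ℂ] E) :
    (mulRight ℂ w).lTensor E s * t = s * (mulLeft ℂ w).lTensor E t := by
  induction s using TensorProduct.induction_on with
  | zero => simp
  | add x y hx hy => simp only [map_add, add_mul, hx, hy]
  | tmul a b =>
    induction t using TensorProduct.induction_on with
    | zero => simp
    | add x y hx hy => simp only [map_add, mul_add, hx, hy]
    | tmul c d => simp [hE]

theorem mul_mul_tensor (hE : ∀ a b c : E, a * b * c = a * (b * c)) (s t u : E ⊗[ℂ] E) :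
    s * t * u = s * (t * u) := by
  let _ : NonUnitalRing E := { ‹NonUnitalNonAssocRing E› with mul_assoc := hE }
  induction s using TensorProduct.induction_on with
  | zero => simp
  | add x y hx hy => simp only [add_mul, hx, hy]
  | tmul a b =>
    induction t using TensorProduct.induction_on with
    | zero => simp
    | add x y hx hy => simp only [mul_add, add_mul, hx, hy]
    | tmul c d =>
      induction u using TensorProduct.induction_on with
      | zero => simp
      | add x y hx hy => simp only [mul_add, hx, hy]
      | tmul e f => simp [hE]

theorem eq_of_tensor_mul_right (hE : ∀ a : E, (∀ b, a * b = 0) → a = 0) {u v : E ⊗[ℂ] E}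
    (h : ∀ z, u * z = v * z) : u = v := by
  refine eq_of_forall_lTensor (fun d : E => mulRight ℂ d)
    (fun x hx => hE x fun b => by simpa using hx b) fun b =>
      eq_of_forall_rTensor (fun d : E => mulRight ℂ d)
        (fun x hx => hE x fun b => by simpa using hx b) fun a => ?_
  rw [← CanonicalPair.mul_tmul, ← CanonicalPair.mul_tmul, h]

theorem eq_of_tensor_mul_left (hE : ∀ a : E, (∀ b, b * a = 0) → a = 0) {u v : E ⊗[ℂ] E}
    (h : ∀ z, z * u = z * v) : u = v := by
  refine eq_of_forall_lTensor (fun d : E => mulLeft ℂ d)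
    (fun x hx => hE x fun b => by simpa using hx b) fun b =>
      eq_of_forall_rTensor (fun d : E => mulLeft ℂ d)
        (fun x hx => hE x fun b => by simpa using hx b) fun a => ?_
  rw [← CanonicalPair.tmul_mul, ← CanonicalPair.tmul_mul, h]

theorem mul_rmul {D : Type*} [NonUnitalNonAssocRing D] [Module ℂ D] [IsScalarTower ℂ D D]
    [SMulCommClass ℂ D D] (m : Multiplier D) (a b : D) : rmul m (a * b) = a * rmul m b :=
  m.2.2.1 a b

theorem rmul_mul {D : Type*} [NonUnitalNonAssocRing D] [Module ℂ D] [IsScalarTower ℂ D D]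
    [SMulCommClass ℂ D D] (m : Multiplier D) (a b : D) : rmul m a * b = a * lmul m b :=
  m.2.2.2 a b

theorem Multiplier.ext {D : Type*} [NonUnitalNonAssocRing D] [Module ℂ D] [IsScalarTower ℂ D D]
    [SMulCommClass ℂ D D] {m m' : Multiplier D} (h : ∀ x, lmul m x = lmul m' x)
    (h' : ∀ x, rmul m x = rmul m' x) : m = m' :=
  Subtype.ext (Prod.ext (LinearMap.ext h) (MulOpposite.unop_injective (LinearMap.ext h')))

namespace MultiplierHopfAlgebra

variable (H : MultiplierHopfAlgebra E)

theorem rmul_comul_tmul (u v x : E) :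
    rmul (H.comul x) (u ⊗ₜ v) = (mulLeft ℂ v).lTensor E (H.T₂ (u ⊗ₜ x)) := by
  refine eq_of_tensor_mul_left H.eq_zero_of_mul' fun z => ?_
  rw [← mul_rmul, ← mulRight_lTensor_mul H.mul_assoc, H.mul_T₂, CanonicalPair.mul_tmul]

/-- The canonical maps of a multiplier Hopf algebra. -/
noncomputable def canonicalPair : CanonicalPair E where
  mul_assoc := H.mul_assoc
  eq_zero_of_mul := H.eq_zero_of_mul
  eq_zero_of_mul' := H.eq_zero_of_mul'
  T₁ := H.T₁
  T₂ := H.T₂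
  compat w x y := by
    refine eq_of_tensor_mul_left H.eq_zero_of_mul' fun z =>
      eq_of_tensor_mul_right H.eq_zero_of_mul fun z' => ?_
    rw [← mulRight_rTensor_mul H.mul_assoc, mul_mul_tensor H.mul_assoc, H.T₁_mul, ← rmul_mul,
      ← H.mul_T₂, mul_mul_tensor H.mul_assoc, mul_mul_tensor H.mul_assoc,
      mulRight_lTensor_mul H.mul_assoc]
  T₂_mul w x x' := by
    have h1 : ∀ t, rightMul H.T₂.toLinearMap x' t = rmul (H.comul x') t := fun t => by
      induction t using TensorProduct.induction_on with
      | zero => simp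
      | add x y hx hy => simp only [map_add, hx, hy]
      | tmul u v => rw [rightMul_tmul, rmul_comul_tmul]; rfl
    refine eq_of_tensor_mul_left H.eq_zero_of_mul' fun z => ?_
    rw [h1, ← mul_rmul, H.mul_T₂, H.mul_T₂, map_mul]
    rfl
  coassoc := H.coassoc

theorem canonicalPair_t₁ (x y : E) : H.canonicalPair.t₁ y x = H.T₁ (x ⊗ₜ y) := rfl

theorem isCounit_counit : H.IsCounit H.canonicalPair.counit where
  map_mul := H.canonicalPair.counit_mul
  counit_left := H.canonicalPair.counit_left
  counit_right := H.canonicalPair.counit_right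

theorem counit_eq : H.counit = H.canonicalPair.counit :=
  H.counit_unique (Classical.epsilon_spec ⟨_, H.isCounit_counit⟩) H.isCounit_counit

theorem isAntipode_of {S : E →ₗ[ℂ] E} (hS : H.canonicalPair.IsAntipode S) :
    H.IsAntipode H.canonicalPair.counit S where
  map_mul := hS.map_mul
  antipode_left := hS.left
  antipode_right w x := hS.right w x

end MultiplierHopfAlgebra

namespace RegularMultiplierHopfAlgebra

variable (H : RegularMultiplierHopfAlgebra E)

theorem isOpposite : H.canonicalPair.IsOpposite H.cop.canonicalPair := fun p q c => by
  refine eq_of_tensor_mul_right H.eq_zero_of_mul fun z => ?_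
  rw [mulRight_rTensor_mul H.mul_assoc, MultiplierHopfAlgebra.canonicalPair_t₁, H.T₁_mul]
  have h1 : flip (flip z) = z := flip_flip z
  rw [← h1]
  change _ = flip _ * _
  rw [← flip_mul, mulRight_rTensor_mul H.mul_assoc, MultiplierHopfAlgebra.canonicalPair_t₁,
    H.cop.T₁_mul, H.comul_cop]
  change _ = flip (flip (lmul (H.comul p) (flip _)))
  rw [flip_flip, flip_flip]
  refine congrArg (lmul (H.comul p)) ?_
  change _ = comm ℂ E E _
  rw [comm_lTensor, comm_rTensor, ← rTensor_lTensor]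
  change _ = LinearMap.rTensor _ _ (LinearMap.lTensor _ _ (flip (flip z)))
  rw [h1]

theorem isAntipode_antipode : H.canonicalPair.IsAntipode H.antipode := by
  obtain ⟨S, hS⟩ := H.isOpposite.exists_isAntipode
  have h1 := H.isAntipode_of hS
  rw [← H.counit_eq] at h1
  have h2 : H.IsAntipode H.counit H.antipode := Classical.epsilon_spec ⟨_, h1⟩
  rwa [H.antipode_unique h2 h1]

theorem antipode_bijective : Function.Bijective H.antipode :=
  H.isOpposite.antipode_bijective H.isAntipode_antipode

end RegularMultiplierHopfAlgebra

end Interface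

/-! ### The pentagon equation and maps commuting with the coproduct -/

section Pentagon

variable {E : Type*} [NonUnitalNonAssocRing E] [Module ℂ E] [IsScalarTower ℂ E E]
  [SMulCommClass ℂ E E] {V W : Type*} [AddCommGroup V] [Module ℂ V] [AddCommGroup W] [Module ℂ W]

namespace CanonicalPair

variable (G : CanonicalPair E)

/-- `mulComul (c ⊗ d) x = (c ⊗ d)Δ(x)`, linear in both arguments. -/
noncomputable def mulComul : E ⊗[ℂ] E →ₗ[ℂ] E →ₗ[ℂ] E ⊗[ℂ] E :=
  lift (LinearMap.mk₂ ℂ (fun c d => (mulLeft ℂ d).lTensor E ∘ₗ G.t₂ c)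
    (fun _ _ _ => by ext; simp [t₂_apply, TensorProduct.add_tmul])
    (fun _ _ _ => by ext; simp [t₂_apply, ← TensorProduct.smul_tmul'])
    (fun _ d d' => by
      change (LinearMap.mul ℂ E (d + d')).lTensor E ∘ₗ _ = _
      rw [map_add, LinearMap.lTensor_add, LinearMap.add_comp]
      rfl)
    (fun r _ d => by
      change (LinearMap.mul ℂ E (r • d)).lTensor E ∘ₗ _ = _
      rw [map_smul, LinearMap.lTensor_smul, LinearMap.smul_comp]
      rfl))

theorem mulComul_tmul (c d : E) :
    G.mulComul (c ⊗ₜ d) = (mulLeft ℂ d).lTensor E ∘ₗ G.t₂ c := by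
  simp [mulComul]

theorem mulComul_apply (t : E ⊗[ℂ] E) (x : E) :
    G.mulComul t x = rightMul G.T₂.toLinearMap x t := by
  induction t using TensorProduct.induction_on with
  | zero => simp
  | add x y hx hy => simp only [map_add, LinearMap.add_apply, hx, hy]
  | tmul c d => rw [mulComul_tmul, rightMul_tmul]; rfl

theorem mulComul_T₂ (r s : E) : G.mulComul (G.T₂ (r ⊗ₜ s)) = G.t₂ r ∘ₗ mulLeft ℂ s := by
  ext x
  rw [mulComul_apply, ← G.T₂_mul]
  rfl

/-- `c ⊗ d ↦ ∑ c x₍₁₎ ⊗ d x₍₂₎ ⊗ x₍₃₎`. -/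
noncomputable def mulComul₂ (x : E) : E ⊗[ℂ] E →ₗ[ℂ] E ⊗[ℂ] (E ⊗[ℂ] E) :=
  contractRight (G.T₂.toLinearMap ∘ₗ (TensorProduct.mk ℂ E E).flip x)
    (TensorProduct.curry G.T₂.toLinearMap).flip

theorem mulComul₂_tmul (x c d : E) :
    G.mulComul₂ x (c ⊗ₜ d) = (G.t₂ d).lTensor E (G.t₂ c x) := by
  rw [mulComul₂, contractRight_tmul]
  rfl

theorem mulRight_mulComul₂ (x y : E) (t : E ⊗[ℂ] E) :
    ((mulRight ℂ y).lTensor E).lTensor E (G.mulComul₂ x t) =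
      assoc ℂ E E E ((G.mulComul t).rTensor E (G.t₁ y x)) := by
  induction t using TensorProduct.induction_on with
  | zero => simp
  | add x y hx hy => simp only [map_add, LinearMap.rTensor_add, LinearMap.add_apply, hx, hy]
  | tmul c d =>
    have h : (mulRight ℂ y).lTensor E ∘ₗ G.t₂ d = (mulLeft ℂ d).rTensor E ∘ₗ G.t₁ y :=
      LinearMap.ext fun q => (G.t_compat d q y).symm
    rw [mulComul₂_tmul, ← LinearMap.lTensor_comp_apply, h, LinearMap.lTensor_comp_apply,
      ← t_coassoc, ← assoc_lTensor_rTensor, ← LinearMap.rTensor_comp_apply, mulComul_tmul]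

/-- The pentagon equation for `T₂`: both sides are `∑ r s₍₁₎ x₍₁₎ ⊗ s₍₂₎ x₍₂₎ ⊗ x₍₃₎`. -/
theorem mulComul₂_T₂ (r s x : E) :
    G.mulComul₂ x (G.T₂ (r ⊗ₜ s)) = assoc ℂ E E E ((G.t₂ r).rTensor E (G.t₂ s x)) := by
  refine eq_of_forall_lTensor (fun y : E => (mulRight ℂ y).lTensor E)
    (fun x hx => eq_zero_of_forall_lTensor (fun y : E => mulRight ℂ y)
      (fun x hx => G.eq_zero_of_mul x fun b => by simpa using hx b) x hx) fun y => ?_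
  rw [mulRight_mulComul₂, mulComul_T₂, LinearMap.rTensor_comp_apply, t_compat, rTensor_lTensor,
    assoc_lTensor]

/-- A map `F : a ↦ ∑ a₍₁₎ ⊗ f(a₍₂₎)` is compatible with the coproduct:
`∑ (c a₍₁₎ ⊗ a₍₂₎) ⊗ f(a₍₃₎) = ∑ c a₍₁₎ ⊗ F(a₍₂₎)`. -/
theorem assoc_t₂_rTensor {F : E →ₗ[ℂ] E ⊗[ℂ] V} {f : E →ₗ[ℂ] V}
    (h : ∀ c a, (mulLeft ℂ c).rTensor V (F a) = f.lTensor E (G.t₂ c a)) (c a : E) :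
    assoc ℂ E E V ((G.t₂ c).rTensor V (F a)) = F.lTensor E (G.t₂ c a) := by
  have key : ∀ t : E ⊗[ℂ] E, assoc ℂ E E V ((G.mulComul t).rTensor V (F a)) =
      (f.lTensor E).lTensor E (G.mulComul₂ a t) := fun t => by
    obtain ⟨t, rfl⟩ := G.T₂.surjective t
    induction t using TensorProduct.induction_on with
    | zero => simp
    | add x y hx hy => simp only [map_add, LinearMap.rTensor_add, LinearMap.add_apply, hx, hy]
    | tmul r s =>
      rw [mulComul₂_T₂, mulComul_T₂, LinearMap.rTensor_comp_apply, h, rTensor_lTensor,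
        assoc_lTensor]
  refine eq_of_forall_lTensor (fun d : E => (mulLeft ℂ d).rTensor V)
    (fun x hx => eq_zero_of_forall_rTensor (fun y : E => mulLeft ℂ y)
      (fun x hx => G.eq_zero_of_mul' x fun b => by simpa using hx b) x hx) fun d => ?_
  have hd : (mulLeft ℂ d).rTensor V ∘ₗ F = f.lTensor E ∘ₗ G.t₂ d := LinearMap.ext fun a => h d a
  rw [← LinearMap.lTensor_comp_apply, hd, LinearMap.lTensor_comp_apply, ← mulComul₂_tmul, ← key,
    ← assoc_lTensor_rTensor, ← LinearMap.rTensor_comp_apply, mulComul_tmul]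

theorem rightMul_mulLeft_lTensor (x w : E) (t : E ⊗[ℂ] E) :
    rightMul G.T₂.toLinearMap x ((mulLeft ℂ w).lTensor E t) =
      (mulLeft ℂ w).lTensor E (rightMul G.T₂.toLinearMap x t) := by
  induction t using TensorProduct.induction_on with
  | zero => simp
  | add x y hx hy => simp only [map_add, hx, hy]
  | tmul u v =>
    rw [LinearMap.lTensor_tmul, rightMul_tmul, rightMul_tmul, LinearMap.mulLeft_apply,
      G.mulLeft_mul, LinearMap.lTensor_comp_apply]

theorem rightMul_mulLeft_rTensor (x w : E) (t : E ⊗[ℂ] E) :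
    rightMul G.T₂.toLinearMap x ((mulLeft ℂ w).rTensor E t) =
      (mulLeft ℂ w).rTensor E (rightMul G.T₂.toLinearMap x t) := by
  induction t using TensorProduct.induction_on with
  | zero => simp
  | add x y hx hy => simp only [map_add, hx, hy]
  | tmul u v =>
    rw [LinearMap.rTensor_tmul, rightMul_tmul, rightMul_tmul, LinearMap.mulLeft_apply,
      t₂_mul_left, rTensor_lTensor]

end CanonicalPair

end Pentagon

/-! ### From canonical maps to regular multiplier Hopf algebras -/

section Construction

variable {E : Type*} [NonUnitalNonAssocRing E] [Module ℂ E] [IsScalarTower ℂ E E]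
  [SMulCommClass ℂ E E]

namespace CanonicalPair

variable (G : CanonicalPair E)

/-- The coproduct, as a multiplier of `E ⊗ E`. -/
noncomputable def comulFun (x : E) : Multiplier (E ⊗[ℂ] E) :=
  ⟨(leftMul G.T₁.toLinearMap x, MulOpposite.op (rightMul G.T₂.toLinearMap x)), by
    refine ⟨fun a b => ?_, fun a b => ?_, fun a b => G.rightMul_mul x a b⟩
    · refine G.eq_of_mul_left fun z => ?_
      rw [← G.mul_eq, ← G.rightMul_mul, ← G.rightMul_mul, G.mul_eq]
    · refine G.eq_of_mul_right fun z => ?_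
      change rightMul _ _ _ * _ = _ * rightMul _ _ _ * _
      rw [G.mul_eq, G.rightMul_mul, G.rightMul_mul, G.mul_eq]⟩

/-- Multipliers of `E ⊗ E` are determined by their left multiplication. -/
theorem ext_lmul (G : CanonicalPair E) {m m' : Multiplier (E ⊗[ℂ] E)}
    (h : ∀ t, lmul m t = lmul m' t) : m = m' := by
  refine Multiplier.ext h fun s => G.eq_of_mul_right fun t => ?_
  rw [rmul_mul, rmul_mul, h]

/-- The coproduct `E → M(E ⊗ E)`. -/
noncomputable def comul : E →ₙₐ[ℂ] Multiplier (E ⊗[ℂ] E) where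
  toFun := G.comulFun
  map_smul' r x := by
    refine G.ext_lmul fun t => ?_
    change leftMul _ _ _ = r • leftMul _ _ _
    induction t using TensorProduct.induction_on with
    | zero => simp
    | add x y hx hy => simp only [map_add, smul_add, hx, hy]
    | tmul u v => simp [leftMul_tmul]
  map_zero' := by
    refine G.ext_lmul fun t => ?_
    change leftMul _ _ _ = 0
    induction t using TensorProduct.induction_on with
    | zero => simp
    | add x y hx hy => simp only [map_add, hx, hy, add_zero]
    | tmul u v => simp [leftMul_tmul]
  map_add' x y := by
    refine G.ext_lmul fun t => ?_
    change leftMul _ _ _ = leftMul _ _ _ + leftMul _ _ _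
    induction t using TensorProduct.induction_on with
    | zero => simp
    | add x y hx hy => simp only [map_add, hx, hy]; abel
    | tmul u v => simp [leftMul_tmul]
  map_mul' x y := G.ext_lmul fun t => G.leftMul_mul x y t

theorem mem_span_of_mul (G : CanonicalPair E) {p : Submodule ℂ (E ⊗[ℂ] E)}
    (h : ∀ (u : E) (t : E ⊗[ℂ] E), (mulRight ℂ u).rTensor E t ∈ p) : p = ⊤ := by
  rw [eq_top_iff]
  rintro t -
  induction t using TensorProduct.induction_on with
  | zero => exact p.zero_mem
  | add x y hx hy => exact p.add_mem hx hy
  | tmul a b =>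
    by_cases ha : a = 0
    · simp [ha]
    obtain ⟨y, hy⟩ := G.exists_counit_eq_one ha
    have h1 : mul' ℂ E (G.T₁.symm (y ⊗ₜ a)) = a := by simp [mul_T₁_symm, hy]
    rw [← h1]
    generalize G.T₁.symm (y ⊗ₜ a) = s
    induction s using TensorProduct.induction_on with
    | zero => simp
    | add x y hx hy => simp only [map_add, TensorProduct.add_tmul]; exact p.add_mem hx hy
    | tmul c d => simpa using h d (c ⊗ₜ b)

theorem mem_span_of_mul' (G : CanonicalPair E) {p : Submodule ℂ (E ⊗[ℂ] E)}
    (h : ∀ (u : E) (t : E ⊗[ℂ] E), (mulLeft ℂ u).lTensor E t ∈ p) : p = ⊤ := by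
  rw [eq_top_iff]
  rintro t -
  induction t using TensorProduct.induction_on with
  | zero => exact p.zero_mem
  | add x y hx hy => exact p.add_mem hx hy
  | tmul b a =>
    by_cases ha : a = 0
    · simp [ha]
    obtain ⟨y, hy⟩ := G.exists_counit_eq_one ha
    have h1 : mul' ℂ E (G.T₁.symm (y ⊗ₜ a)) = a := by simp [mul_T₁_symm, hy]
    rw [← h1]
    generalize G.T₁.symm (y ⊗ₜ a) = s
    induction s using TensorProduct.induction_on with
    | zero => simp
    | add x y hx hy => simp only [map_add, TensorProduct.tmul_add]; exact p.add_mem hx hy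
    | tmul c d => simpa using h c (b ⊗ₜ d)

/-- The multiplier Hopf algebra with given canonical maps. -/
noncomputable def toMultiplierHopfAlgebra : MultiplierHopfAlgebra E where
  mul_assoc := G.mul_assoc
  eq_zero_of_mul := G.eq_zero_of_mul
  eq_zero_of_mul' := G.eq_zero_of_mul'
  comul := G.comul
  span_comul := by
    refine G.mem_span_of_mul fun u t => ?_
    obtain ⟨t, rfl⟩ := G.T₁.surjective t
    induction t using TensorProduct.induction_on with
    | zero => simp
    | add x y hx hy => simp only [map_add]; exact Submodule.add_mem _ hx hy
    | tmul x v =>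
      refine Submodule.subset_span ⟨x, u ⊗ₜ v, ?_⟩
      exact (G.leftMul_tmul x u v).symm
  span_comul' := by
    refine G.mem_span_of_mul' fun u t => ?_
    obtain ⟨t, rfl⟩ := G.T₂.surjective t
    induction t using TensorProduct.induction_on with
    | zero => simp
    | add x y hx hy => simp only [map_add]; exact Submodule.add_mem _ hx hy
    | tmul v x =>
      refine Submodule.subset_span ⟨x, v ⊗ₜ u, ?_⟩
      exact (G.rightMul_tmul x v u).symm
  T₁ := G.T₁
  T₁_mul a b z := by
    change _ = leftMul _ _ _
    induction z using TensorProduct.induction_on with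
    | zero => simp
    | add x y hx hy => simp only [map_add, mul_add, hx, hy]
    | tmul u v =>
      rw [LinearMap.lTensor_tmul, LinearMap.mulLeft_apply, leftMul_tmul, t₁_mul_right, mul_tmul]
      rfl
  T₂ := G.T₂
  mul_T₂ a b z := by
    change _ = rightMul _ _ _
    induction z using TensorProduct.induction_on with
    | zero => simp
    | add x y hx hy => simp only [map_add, add_mul, hx, hy]
    | tmul u v =>
      rw [LinearMap.rTensor_tmul, LinearMap.mulRight_apply, rightMul_tmul, t₂_mul_left, tmul_mul,
        rTensor_lTensor]
      rfl
  coassoc := G.coassoc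

theorem comm_comm (t : E ⊗[ℂ] E) : comm ℂ E E (comm ℂ E E t) = t := by
  rw [← LinearEquiv.trans_apply, TensorProduct.comm_trans_comm, LinearEquiv.refl_apply]

/-- The regular multiplier Hopf algebra given by a pair of canonical maps and its opposite. -/
noncomputable def toRegular {G' : CanonicalPair E} (h : G.IsOpposite G') :
    RegularMultiplierHopfAlgebra E where
  toMultiplierHopfAlgebra := G.toMultiplierHopfAlgebra
  cop := G'.toMultiplierHopfAlgebra
  comul_cop a := by
    refine G.ext_lmul fun t => ?_
    change leftMul _ _ _ = comm ℂ E E (leftMul _ _ (comm ℂ E E t))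
    induction t using TensorProduct.induction_on with
    | zero => simp
    | add x y hx hy => simp only [map_add, hx, hy]
    | tmul u v =>
      rw [TensorProduct.comm_tmul, leftMul_tmul, leftMul_tmul, h, comm_comm]

end CanonicalPair

end Construction

/-! ### The opposite of a pair of canonical maps with bijective antipode -/

section Opposite

variable {E : Type*} [NonUnitalNonAssocRing E] [Module ℂ E] [IsScalarTower ℂ E E]
  [SMulCommClass ℂ E E]

namespace CanonicalPair

variable (G : CanonicalPair E)

section

variable (T₁' T₂' : E ⊗[ℂ] E ≃ₗ[ℂ] E ⊗[ℂ] E)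
  (h₁ : ∀ p q c, (mulRight ℂ c).rTensor E (G.t₁ q p) =
    comm ℂ E E ((mulRight ℂ q).rTensor E (T₁' (p ⊗ₜ c))))
  (h₂ : ∀ w p c, (mulLeft ℂ c).lTensor E (G.t₂ w p) =
    comm ℂ E E ((mulLeft ℂ w).lTensor E (T₂' (c ⊗ₜ p))))

include h₁ in
theorem t₂_mulRight_of (w p c : E) : (mulRight ℂ c).rTensor E (G.t₂ w p) =
    comm ℂ E E ((mulLeft ℂ w).lTensor E (T₁' (p ⊗ₜ c))) := by
  refine G.eq_of_mulRight_lTensor fun y => ?_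
  rw [← rTensor_lTensor, ← t_compat, ← comm_rTensor, rTensor_lTensor, comm_lTensor, ← h₁,
    G.rTensor_mulRight_mulLeft]

include h₂ in
theorem rightMul_of (x : E) (t : E ⊗[ℂ] E) : rightMul T₂'.toLinearMap x t =
    comm ℂ E E (rightMul G.T₂.toLinearMap x (comm ℂ E E t)) := by
  induction t using TensorProduct.induction_on with
  | zero => simp
  | add x y hx hy => simp only [map_add, hx, hy]
  | tmul u v =>
    rw [TensorProduct.comm_tmul, rightMul_tmul, h₂, comm_comm, MultiplierHopf.rightMul_tmul]
    rfl

include h₁ h₂ in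
theorem compat_of (w x y : E) : (mulLeft ℂ w).rTensor E (T₁' (x ⊗ₜ y)) =
    (mulRight ℂ y).lTensor E (T₂' (w ⊗ₜ x)) := by
  refine G.eq_of_mulRight_rTensor fun q => G.eq_of_mulLeft_lTensor fun d => ?_
  apply (comm ℂ E E).injective
  calc comm ℂ E E ((mulLeft ℂ d).lTensor E ((mulRight ℂ q).rTensor E
        ((mulLeft ℂ w).rTensor E (T₁' (x ⊗ₜ y)))))
      = (mulLeft ℂ d).rTensor E ((mulLeft ℂ w).lTensor E ((mulRight ℂ y).rTensor E
          (G.t₁ q x))) := by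
        rw [comm_lTensor, G.rTensor_mulRight_mulLeft, comm_rTensor, h₁]
    _ = (mulLeft ℂ w).lTensor E ((mulRight ℂ y).rTensor E ((mulLeft ℂ d).rTensor E
          (G.t₁ q x))) := by
        rw [rTensor_lTensor, G.rTensor_mulRight_mulLeft]
    _ = (mulRight ℂ q).lTensor E ((mulRight ℂ y).rTensor E ((mulLeft ℂ w).lTensor E
          (G.t₂ d x))) := by
        rw [t_compat, rTensor_lTensor, rTensor_lTensor, G.lTensor_mulRight_mulLeft]
    _ = _ := by
        rw [h₂, ← rTensor_lTensor (mulRight ℂ q), comm_rTensor, ← G.lTensor_mulRight_mulLeft,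
          comm_lTensor, comm_lTensor, comm_lTensor]

include h₂ in
theorem T₂_mul_of (w x x' : E) : T₂' (w ⊗ₜ (x * x')) =
    rightMul T₂'.toLinearMap x' (T₂' (w ⊗ₜ x)) := by
  refine G.eq_of_mulLeft_lTensor fun d => ?_
  apply (comm ℂ E E).injective
  rw [← h₂, t₂_mul, ← rightMul_mulLeft_lTensor, h₂, G.rightMul_of T₂' h₂, comm_lTensor,
    comm_lTensor, comm_comm, rightMul_mulLeft_rTensor]

include h₁ h₂ in
theorem coassoc_of (w x y : E) :
    assoc ℂ E E E ((T₂'.toLinearMap ∘ₗ TensorProduct.mk ℂ E E w).rTensor E (T₁' (x ⊗ₜ y))) =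
      (T₁'.toLinearMap ∘ₗ (TensorProduct.mk ℂ E E).flip y).lTensor E (T₂' (w ⊗ₜ x)) := by
  set t₂' := T₂'.toLinearMap ∘ₗ TensorProduct.mk ℂ E E w with ht₂'
  set t₁' := T₁'.toLinearMap ∘ₗ (TensorProduct.mk ℂ E E).flip y with ht₁'
  let rev : E ⊗[ℂ] (E ⊗[ℂ] E) →ₗ[ℂ] E ⊗[ℂ] (E ⊗[ℂ] E) := (assoc ℂ E E E).toLinearMap ∘ₗ
    (comm ℂ E (E ⊗[ℂ] E)).toLinearMap ∘ₗ (comm ℂ E E).toLinearMap.lTensor E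
  have key : ∀ t : E ⊗[ℂ] E, rev (((mulLeft ℂ w).lTensor E).lTensor E
      ((mulRight ℂ y).rTensor (E ⊗[ℂ] E) (G.mulComul₂ x t))) =
      ((comm ℂ E E).toLinearMap ∘ₗ (mulRight ℂ y).rTensor E ∘ₗ G.mulComul t).lTensor E
        (T₂' (w ⊗ₜ x)) := fun t => by
    obtain ⟨t, rfl⟩ := G.T₂.surjective t
    induction t using TensorProduct.induction_on with
    | zero => simp
    | add x y hx hy =>
      simp only [map_add, LinearMap.lTensor_add, LinearMap.add_apply, LinearMap.comp_add, hx, hy]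
    | tmul r s =>
      have h3 : (mulLeft ℂ s).lTensor E (T₂' (w ⊗ₜ x)) =
          comm ℂ E E ((mulLeft ℂ w).lTensor E (G.t₂ s x)) := by rw [h₂, comm_comm]
      rw [mulComul₂_T₂, mulComul_T₂, ← LinearMap.comp_assoc, ← LinearMap.comp_assoc,
        LinearMap.lTensor_comp_apply, h3]
      generalize G.t₂ s x = z
      induction z using TensorProduct.induction_on with
      | zero => simp
      | add x y hx hy => simp only [map_add, hx, hy]
      | tmul p q =>
        simp only [LinearMap.rTensor_tmul, LinearMap.lTensor_tmul, TensorProduct.comm_tmul,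
          LinearMap.comp_apply]
        generalize G.t₂ r p = z
        induction z using TensorProduct.induction_on with
        | zero => simp
        | add x y hx hy => simp only [map_add, TensorProduct.add_tmul, TensorProduct.tmul_add,
            hx, hy]
        | tmul u v => simp [rev]
  refine eq_of_forall_lTensor (fun d : E => (mulLeft ℂ d).rTensor E)
    (fun x hx => eq_zero_of_forall_rTensor (fun y : E => mulLeft ℂ y)
      (fun x hx => G.eq_zero_of_mul' x fun b => by simpa using hx b) x hx) fun d => ?_
  refine eq_of_forall_lTensor (fun d : E => (mulLeft ℂ d).lTensor E)
    (fun x hx => eq_zero_of_forall_lTensor (fun y : E => mulLeft ℂ y)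
      (fun x hx => G.eq_zero_of_mul' x fun b => by simpa using hx b) x hx) fun g => ?_
  have e1 : (mulLeft ℂ g).lTensor E (T₁' (x ⊗ₜ y)) =
      comm ℂ E E ((mulRight ℂ y).rTensor E (G.t₂ g x)) := by
    rw [G.t₂_mulRight_of T₁' h₁, comm_comm]
  have e2 : (mulLeft ℂ d).lTensor E ∘ₗ t₂' =
      (comm ℂ E E).toLinearMap ∘ₗ (mulLeft ℂ w).lTensor E ∘ₗ G.t₂ d := LinearMap.ext fun p =>
    ((comm_comm _).symm.trans (congrArg (comm ℂ E E) (h₂ d p w).symm) :)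
  have e3 : (mulLeft ℂ g).lTensor E ∘ₗ (mulLeft ℂ d).rTensor E ∘ₗ t₁' =
      (comm ℂ E E).toLinearMap ∘ₗ (mulRight ℂ y).rTensor E ∘ₗ G.mulComul (g ⊗ₜ d) := by
    refine LinearMap.ext fun p => ?_
    change (mulLeft ℂ g).lTensor E ((mulLeft ℂ d).rTensor E (T₁' (p ⊗ₜ y))) =
      comm ℂ E E ((mulRight ℂ y).rTensor E (G.mulComul (g ⊗ₜ d) p))
    rw [mulComul_tmul, LinearMap.comp_apply, rTensor_lTensor, comm_lTensor,
      G.t₂_mulRight_of T₁' h₁, comm_comm, rTensor_lTensor]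
  clear_value t₁' t₂'
  have e4 : ((mulLeft ℂ g).lTensor E).lTensor E (((mulLeft ℂ d).rTensor E).lTensor E
      (t₁'.lTensor E (T₂' (w ⊗ₜ x)))) = ((comm ℂ E E).toLinearMap ∘ₗ (mulRight ℂ y).rTensor E ∘ₗ
        G.mulComul (g ⊗ₜ d)).lTensor E (T₂' (w ⊗ₜ x)) := by
    rw [← e3, LinearMap.lTensor_comp_apply, LinearMap.lTensor_comp_apply]
  rw [e4, ← key,
    mulComul₂_tmul, ← assoc_lTensor_rTensor, ← assoc_lTensor, ← LinearMap.rTensor_comp_apply, e2,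
    ← rTensor_lTensor, e1]
  generalize G.t₂ g x = z
  induction z using TensorProduct.induction_on with
  | zero => simp
  | add x y hx hy => simp only [map_add, hx, hy]
  | tmul p q => simp [rev]

/-- Two maps that represent `Δ(x)(y ⊗ 1)` and `(1 ⊗ x)Δ(y)`, up to the flip, are the canonical
maps of the opposite coproduct. -/
noncomputable def opposite : CanonicalPair E where
  mul_assoc := G.mul_assoc
  eq_zero_of_mul := G.eq_zero_of_mul
  eq_zero_of_mul' := G.eq_zero_of_mul'
  T₁ := T₁'
  T₂ := T₂'
  compat := G.compat_of T₁' T₂' h₁ h₂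
  T₂_mul := G.T₂_mul_of T₂' h₂
  coassoc w x y := by
    apply (assoc ℂ E E E).injective
    rw [LinearEquiv.apply_symm_apply]
    convert G.coassoc_of T₁' T₂' h₁ h₂ w x y using 1
    · generalize T₁' (x ⊗ₜ y) = t
      induction t using TensorProduct.induction_on with
      | zero => simp
      | add x y hx hy => simp only [map_add, TensorProduct.tmul_add, hx, hy]
      | tmul x v => simp
    · generalize T₂' (w ⊗ₜ x) = t
      induction t using TensorProduct.induction_on with
      | zero => simp
      | add x y hx hy => simp only [map_add, TensorProduct.add_tmul, hx, hy]
      | tmul x v => simp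

theorem isOpposite_opposite : G.IsOpposite (G.opposite T₁' T₂' h₁ h₂) := h₁

end

/-- A multiplier Hopf algebra whose antipode is a bijection of the algebra onto itself is regular:
`Δ(a)(b ⊗ 1)` and `(1 ⊗ a)Δ(b)` are inverted with the help of `S⁻¹`. -/
theorem exists_isOpposite (S : E ≃ₗ[ℂ] E) (hS : G.IsAntipode S.toLinearMap) :
    ∃ G' : CanonicalPair E, G.IsOpposite G' := by
  let T₁' : E ⊗[ℂ] E ≃ₗ[ℂ] E ⊗[ℂ] E :=
    comm ℂ E E ≪≫ₗ TensorProduct.congr S (LinearEquiv.refl ℂ E) ≪≫ₗ G.T₂.symm ≪≫ₗ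
      TensorProduct.congr S.symm (LinearEquiv.refl ℂ E) ≪≫ₗ comm ℂ E E
  let T₂' : E ⊗[ℂ] E ≃ₗ[ℂ] E ⊗[ℂ] E :=
    comm ℂ E E ≪≫ₗ TensorProduct.congr (LinearEquiv.refl ℂ E) S ≪≫ₗ G.T₁.symm ≪≫ₗ
      TensorProduct.congr (LinearEquiv.refl ℂ E) S.symm ≪≫ₗ comm ℂ E E
  have hmul : ∀ x y, S (x * y) = S y * S x := hS.map_mul
  refine ⟨G.opposite T₁' T₂' (fun p q c => ?_) (fun w p c => ?_), G.isOpposite_opposite _ _ _ _⟩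
  · -- after applying `S` to the first leg, both sides are values of `u ⊗ v ↦ ∑ u S(v₍₁₎) ⊗ v₍₂₎q`
    let M := contractLeft (G.t₁ q) ((LinearMap.mul ℂ E).compl₂ S.toLinearMap)
    have hM : ∀ t, M (G.T₂ t) = S.toLinearMap.rTensor E (comm ℂ E E ((mulRight ℂ q).rTensor E
        (comm ℂ E E (S.symm.toLinearMap.rTensor E t)))) := fun t => by
      induction t using TensorProduct.induction_on with
      | zero => simp
      | add x y hx hy => simp only [map_add, hx, hy]
      | tmul x y =>
        have h1 : ∀ t, lift ((LinearMap.mul ℂ E).compl₂ S.toLinearMap) t =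
            mul' ℂ E (S.toLinearMap.lTensor E t) := forall_of_tmul
          (g := mul' ℂ E ∘ₗ S.toLinearMap.lTensor E) fun x y => by simp
        have h2 : lift ((LinearMap.mul ℂ E).compl₂ S.toLinearMap) ∘ₗ G.t₂ x =
            LinearMap.toSpanSingleton ℂ E x ∘ₗ G.counit := LinearMap.ext fun z => by
          rw [LinearMap.comp_apply, h1, hS.right]
          rfl
        have h3 : ∀ t, (LinearMap.toSpanSingleton ℂ E x ∘ₗ G.counit).rTensor E t =
            x ⊗ₜ lid ℂ E (G.counit.rTensor E t) := forall_of_tmul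
          (g := TensorProduct.mk ℂ E E x ∘ₗ (lid ℂ E).toLinearMap ∘ₗ G.counit.rTensor E)
            fun x y => by simp [TensorProduct.smul_tmul]
        simp only [M, contractLeft, LinearMap.comp_apply]
        rw [← t₂_apply, ← t_coassoc, LinearEquiv.coe_coe, LinearEquiv.symm_apply_apply,
          ← LinearMap.rTensor_comp_apply, h2, h3, counit_left]
        simp
    have hS1 : Function.Injective (S.toLinearMap.rTensor E) :=
      Function.LeftInverse.injective (g := S.symm.toLinearMap.rTensor E) fun t => by
        rw [← LinearMap.rTensor_comp_apply]
        simp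
    apply hS1
    have h4 := hM (G.T₂.symm (S c ⊗ₜ p))
    rw [LinearEquiv.apply_symm_apply] at h4
    have h5 : S.toLinearMap ∘ₗ mulRight ℂ c =
        ((LinearMap.mul ℂ E).compl₂ S.toLinearMap) (S c) := by
      ext x; simp [hmul]
    rw [← LinearMap.rTensor_comp_apply, h5, ← contractLeft_tmul]
    exact h4
  · -- after applying `S` to the second leg, both sides are values of `u ⊗ v ↦ ∑ wu₍₁₎ ⊗ S(u₍₂₎)v`
    let M := contractRight (G.t₂ w) (LinearMap.mul ℂ E ∘ₗ S.toLinearMap)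
    have hM : ∀ t, M (G.T₁ t) = S.toLinearMap.lTensor E (comm ℂ E E ((mulLeft ℂ w).lTensor E
        (comm ℂ E E (S.symm.toLinearMap.lTensor E t)))) := fun t => by
      induction t using TensorProduct.induction_on with
      | zero => simp
      | add x y hx hy => simp only [map_add, hx, hy]
      | tmul x y =>
        have h1 : ∀ t, lift (LinearMap.mul ℂ E ∘ₗ S.toLinearMap) t =
            mul' ℂ E (S.toLinearMap.rTensor E t) := forall_of_tmul
          (g := mul' ℂ E ∘ₗ S.toLinearMap.rTensor E) fun x y => by simp
        have h2 : lift (LinearMap.mul ℂ E ∘ₗ S.toLinearMap) ∘ₗ G.t₁ y =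
            LinearMap.toSpanSingleton ℂ E y ∘ₗ G.counit := LinearMap.ext fun z => by
          rw [LinearMap.comp_apply, h1, hS.left]
          rfl
        have h3 : ∀ t, (LinearMap.toSpanSingleton ℂ E y ∘ₗ G.counit).lTensor E t =
            rid ℂ E (G.counit.lTensor E t) ⊗ₜ y := forall_of_tmul
          (g := (TensorProduct.mk ℂ E E).flip y ∘ₗ (rid ℂ E).toLinearMap ∘ₗ G.counit.lTensor E)
            fun x y => by simp
        simp only [M, contractRight, LinearMap.comp_apply]
        rw [← t₁_apply, LinearEquiv.coe_coe, t_coassoc, ← LinearMap.lTensor_comp_apply, h2, h3,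
          counit_right]
        simp
    have hS1 : Function.Injective (S.toLinearMap.lTensor E) :=
      Function.LeftInverse.injective (g := S.symm.toLinearMap.lTensor E) fun t => by
        rw [← LinearMap.lTensor_comp_apply]
        simp
    apply hS1
    have h4 := hM (G.T₁.symm (p ⊗ₜ S c))
    rw [LinearEquiv.apply_symm_apply] at h4
    have h5 : S.toLinearMap ∘ₗ mulLeft ℂ c =
        (LinearMap.mul ℂ E ∘ₗ S.toLinearMap).flip (S c) := by
      ext x; simp [hmul]
    rw [← LinearMap.lTensor_comp_apply, h5, ← contractRight_tmul]
    exact h4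

end CanonicalPair

end Opposite

/-! ### Module algebras and the twist map -/

section Action

variable {A : Type*} [NonUnitalNonAssocRing A] [Module ℂ A] [IsScalarTower ℂ A A]
  [SMulCommClass ℂ A A]
variable {B : Type*} [NonUnitalNonAssocRing B] [Module ℂ B] [IsScalarTower ℂ B B]
  [SMulCommClass ℂ B B]
variable {V : Type*} [AddCommGroup V] [Module ℂ V]

namespace IsRightModuleAlgebra

/-- Linear maps out of `B` that agree on the elements `b ◁ a` are equal. -/
theorem hom_ext {H : MultiplierHopfAlgebra A} {act : B →ₗ[ℂ] A →ₗ[ℂ] B}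
    (hact : IsRightModuleAlgebra H act) {f g : B →ₗ[ℂ] V}
    (h : ∀ b a, f (act b a) = g (act b a)) : f = g := by
  refine LinearMap.ext_on hact.unital ?_
  rintro _ ⟨b, a, rfl⟩
  exact h b a

theorem lift_surjective {H : MultiplierHopfAlgebra A} {act : B →ₗ[ℂ] A →ₗ[ℂ] B}
    (hact : IsRightModuleAlgebra H act) : Function.Surjective (lift act) := by
  rw [← LinearMap.range_eq_top, eq_top_iff, ← hact.unital, Submodule.span_le]
  rintro _ ⟨b, a, rfl⟩
  exact ⟨b ⊗ₜ a, by simp⟩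

theorem act_comp_mulLeft {H : MultiplierHopfAlgebra A} {act : B →ₗ[ℂ] A →ₗ[ℂ] B}
    (hact : IsRightModuleAlgebra H act) (b : B) (a : A) :
    act b ∘ₗ mulLeft ℂ a = act (act b a) :=
  LinearMap.ext fun x => hact.act_mul b a x

variable {HA : RegularMultiplierHopfAlgebra A} {act : B →ₗ[ℂ] A →ₗ[ℂ] B}
  (hact : IsRightModuleAlgebra HA.toMultiplierHopfAlgebra act)
include hact

theorem twist_cover (b : B) (a d : A) :
    (mulLeft ℂ d).rTensor B (twist HA.toMultiplierHopfAlgebra act (b ⊗ₜ a)) =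
      (act b).lTensor A (HA.canonicalPair.t₂ d a) := twist_spec HA act hact b a d

theorem twistOp_cover (b : B) (a d : A) :
    (mulLeft ℂ d).rTensor B (twistOp HA act (b ⊗ₜ a)) =
      (act b).lTensor A (HA.cop.canonicalPair.t₂ d a) := twistOp_spec HA act hact b a d

/-- `R((b ◁ c) ⊗ a) = ∑ a₍₁₎ ⊗ (b ◁ c a₍₂₎)`. -/
theorem twist_act (b : B) (c a : A) :
    twist HA.toMultiplierHopfAlgebra act (act b c ⊗ₜ a) =
      (act b).lTensor A (comm ℂ A A (HA.cop.canonicalPair.t₂ c a)) := by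
  refine HA.canonicalPair.eq_of_mulLeft_rTensor fun d => ?_
  rw [hact.twist_cover, rTensor_lTensor, ← comm_lTensor, ← HA.isOpposite.t₂_mulLeft,
    ← LinearMap.lTensor_comp_apply, hact.act_comp_mulLeft]

/-- `Rᵒᵖ((b ◁ c) ⊗ a) = ∑ a₍₂₎ ⊗ (b ◁ c a₍₁₎)`. -/
theorem twistOp_act (b : B) (c a : A) :
    twistOp HA act (act b c ⊗ₜ a) =
      (act b).lTensor A (comm ℂ A A (HA.canonicalPair.t₂ c a)) := by
  refine HA.canonicalPair.eq_of_mulLeft_rTensor fun d => ?_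
  rw [hact.twistOp_cover, rTensor_lTensor, ← comm_lTensor, ← HA.isOpposite.symm.t₂_mulLeft,
    ← LinearMap.lTensor_comp_apply, hact.act_comp_mulLeft]

theorem twist_rTensor_act (b : B) (t : A ⊗[ℂ] A) :
    twist HA.toMultiplierHopfAlgebra act ((act b).rTensor A t) =
      (act b).lTensor A (comm ℂ A A (HA.cop.canonicalPair.T₂ t)) := by
  induction t using TensorProduct.induction_on with
  | zero => simp
  | add x y hx hy => simp only [map_add, hx, hy]
  | tmul c a => exact hact.twist_act b c a

theorem twist_surjective : Function.Surjective (twist HA.toMultiplierHopfAlgebra act) := by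
  rw [← LinearMap.range_eq_top, eq_top_iff]
  rintro t -
  induction t using TensorProduct.induction_on with
  | zero => exact zero_mem _
  | add x y hx hy => exact add_mem hx hy
  | tmul a b =>
    obtain ⟨t, rfl⟩ := hact.lift_surjective b
    induction t using TensorProduct.induction_on with
    | zero => simp
    | add x y hx hy => rw [map_add, TensorProduct.tmul_add]; exact add_mem hx hy
    | tmul b e =>
      refine ⟨(act b).rTensor A (HA.cop.canonicalPair.T₂.symm (e ⊗ₜ a)), ?_⟩
      rw [hact.twist_rTensor_act, LinearEquiv.apply_symm_apply]
      simp

theorem twist_injective : Function.Injective (twist HA.toMultiplierHopfAlgebra act) := by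
  set G := HA.canonicalPair
  set G' := HA.cop.canonicalPair
  have hop : G.IsOpposite G' := HA.isOpposite
  rw [← LinearMap.ker_eq_bot, LinearMap.ker_eq_bot']
  intro t ht
  let T₄ : A ⊗[ℂ] A ≃ₗ[ℂ] A ⊗[ℂ] A := G'.T₂ ≪≫ₗ comm ℂ A A
  -- `T₄⁻¹(x ⊗ y)(1 ⊗ e) = (y ⊗ 1)T₄⁻¹((x ⊗ 1)Δ(e))`
  have h1 : ∀ e x y, (mulRight ℂ e).lTensor A (T₄.symm (x ⊗ₜ y)) =
      (mulLeft ℂ y).rTensor A (T₄.symm (G.t₂ x e)) := fun e x y => by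
    apply T₄.injective
    have h2 : ∀ s, T₄ ((mulRight ℂ e).lTensor A s) = rightMul G.T₂.toLinearMap e (T₄ s) :=
      forall_of_tmul (f := T₄.toLinearMap ∘ₗ (mulRight ℂ e).lTensor A)
        (g := rightMul G.T₂.toLinearMap e ∘ₗ T₄.toLinearMap) fun c a => by
          change comm ℂ A A (G'.t₂ c (a * e)) =
            rightMul G.T₂.toLinearMap e (comm ℂ A A (G'.t₂ c a))
          rw [G'.t₂_mul, G.rightMul_of _ fun w p c => hop.t₂_mulLeft w p c,
            CanonicalPair.comm_comm]
    have h3 : ∀ s, T₄ ((mulLeft ℂ y).rTensor A s) = (mulLeft ℂ y).lTensor A (T₄ s) :=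
      forall_of_tmul (f := T₄.toLinearMap ∘ₗ (mulLeft ℂ y).rTensor A)
        (g := (mulLeft ℂ y).lTensor A ∘ₗ T₄.toLinearMap) fun c a => by
          change comm ℂ A A (G'.t₂ (y * c) a) = (mulLeft ℂ y).lTensor A (comm ℂ A A (G'.t₂ c a))
          rw [G'.t₂_mul_left, comm_rTensor]
    rw [h2, h3, LinearEquiv.apply_symm_apply, LinearEquiv.apply_symm_apply, G.rightMul_tmul]
  let Ψ : B ⊗[ℂ] (A ⊗[ℂ] A) →ₗ[ℂ] B ⊗[ℂ] A :=
    (lift act).rTensor A ∘ₗ (assoc ℂ B A A).symm.toLinearMap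
  have hΨ : ∀ b s, Ψ (b ⊗ₜ s) = (act b).rTensor A s := fun b => forall_of_tmul
    (f := Ψ ∘ₗ TensorProduct.mk ℂ B (A ⊗[ℂ] A) b) (g := (act b).rTensor A) fun x y => by simp [Ψ]
  obtain ⟨s, rfl⟩ : ∃ s, Ψ s = t := by
    obtain ⟨u, rfl⟩ := LinearMap.rTensor_surjective A hact.lift_surjective t
    exact ⟨assoc ℂ B A A u, by simp [Ψ]⟩
  let K : B ⊗[ℂ] (A ⊗[ℂ] A) →ₗ[ℂ] A ⊗[ℂ] B :=
    twist HA.toMultiplierHopfAlgebra act ∘ₗ Ψ ∘ₗ T₄.symm.toLinearMap.lTensor B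
  have hK : ∀ b x y, K (b ⊗ₜ (x ⊗ₜ y)) = x ⊗ₜ act b y := fun b x y => by
    simp only [K, LinearMap.comp_apply, LinearMap.lTensor_tmul, hΨ]
    rw [hact.twist_rTensor_act]
    change (act b).lTensor A (T₄ (T₄.symm (x ⊗ₜ y))) = _
    rw [LinearEquiv.apply_symm_apply, LinearMap.lTensor_tmul]
  refine HA.canonicalPair.eq_of_mulRight_lTensor fun e => ?_
  let Ξ : A ⊗[ℂ] B →ₗ[ℂ] B ⊗[ℂ] A := contractLeft (T₄.symm.toLinearMap ∘ₗ G.T₂.toLinearMap ∘ₗ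
    (TensorProduct.mk ℂ A A).flip e) act ∘ₗ (comm ℂ A B).toLinearMap
  have hΞ : ∀ u : B ⊗[ℂ] (A ⊗[ℂ] A), (mulRight ℂ e).lTensor B
      (Ψ (T₄.symm.toLinearMap.lTensor B u)) = Ξ (K u) := fun u => by
    induction u using TensorProduct.induction_on with
    | zero => simp
    | add x y hx hy => simp only [map_add, hx, hy]
    | tmul b u =>
      induction u using TensorProduct.induction_on with
      | zero => simp
      | add x y hx hy => simp only [map_add, TensorProduct.tmul_add, hx, hy]
      | tmul x y =>
        rw [hK, LinearMap.lTensor_tmul, hΨ, ← rTensor_lTensor, LinearEquiv.coe_coe, h1,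
          ← LinearMap.rTensor_comp_apply, hact.act_comp_mulLeft]
        simp only [Ξ, LinearMap.comp_apply, LinearEquiv.coe_coe, TensorProduct.comm_tmul,
          contractLeft_tmul]
        rfl
  have h5 : T₄.symm.toLinearMap.lTensor B (T₄.toLinearMap.lTensor B s) = s := by
    rw [← LinearMap.lTensor_comp_apply]; simp
  have h6 : K (T₄.toLinearMap.lTensor B s) = 0 := by
    simp only [K, LinearMap.comp_apply, h5, ht]
  have h7 := hΞ (T₄.toLinearMap.lTensor B s)
  rw [h5, h6, map_zero] at h7
  rw [h7, map_zero]

theorem twist_bijective : Function.Bijective (twist HA.toMultiplierHopfAlgebra act) :=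
  ⟨hact.twist_injective, hact.twist_surjective⟩

/-- `∑ c a₍₁₎ ⊗ R(b ⊗ a₍₂₎) = ∑ c a₍₁₎ ⊗ a₍₂₎ ⊗ (b ◁ a₍₃₎)`. -/
theorem assoc_t₂_twist (b : B) (c a : A) :
    assoc ℂ A A B ((HA.canonicalPair.t₂ c).rTensor B
      (twist HA.toMultiplierHopfAlgebra act (b ⊗ₜ a))) =
      (twist HA.toMultiplierHopfAlgebra act ∘ₗ TensorProduct.mk ℂ B A b).lTensor A
        (HA.canonicalPair.t₂ c a) :=
  HA.canonicalPair.assoc_t₂_rTensor (F := twist HA.toMultiplierHopfAlgebra act ∘ₗ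
    TensorProduct.mk ℂ B A b) (fun c a => hact.twist_cover b a c) c a

/-- `bb' ◁ a = ∑ (b ◁ a₍₁₎)(b' ◁ a₍₂₎)`. -/
theorem act_mul_eq (b b' : B) (a : A) : act (b * b') a =
    mul' ℂ B ((act b).rTensor B (twist HA.toMultiplierHopfAlgebra act (b' ⊗ₜ a))) := by
  refine LinearMap.congr_fun (hact.hom_ext (f := act.flip a ∘ₗ mulRight ℂ b')
    (g := mul' ℂ B ∘ₗ (LinearMap.rTensorHom B ∘ₗ act).flip
      (twist HA.toMultiplierHopfAlgebra act (b' ⊗ₜ a))) fun b c => ?_) b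
  change act (act b c * b') a = mul' ℂ B ((act (act b c)).rTensor B
    (twist HA.toMultiplierHopfAlgebra act (b' ⊗ₜ a)))
  rw [hact.mul_act, ← hact.act_comp_mulLeft, LinearMap.rTensor_comp_apply, hact.twist_cover,
    rTensor_lTensor, ← LinearMap.comp_apply (LinearMap.lTensor _ _),
    LinearMap.lTensor_comp_rTensor]
  rfl

/-- `R(b ⊗ aa')` is the product of `R(b ⊗ a)` and `a'` in the smash product. -/
theorem twist_mul_right (b : B) (a a' : A) :
    twist HA.toMultiplierHopfAlgebra act (b ⊗ₜ (a * a')) =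
      contractLeft (twist HA.toMultiplierHopfAlgebra act ∘ₗ (TensorProduct.mk ℂ B A).flip a')
        (LinearMap.mul ℂ A) (twist HA.toMultiplierHopfAlgebra act (b ⊗ₜ a)) := by
  set G := HA.canonicalPair
  set R := twist HA.toMultiplierHopfAlgebra act
  refine G.eq_of_mulLeft_rTensor fun d => ?_
  have h1 : ∀ t, (mulLeft ℂ d).rTensor B
      (contractLeft (R ∘ₗ (TensorProduct.mk ℂ B A).flip a') (LinearMap.mul ℂ A) t) =
      contractLeft (R ∘ₗ (TensorProduct.mk ℂ B A).flip a') (LinearMap.mul ℂ A)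
        ((mulLeft ℂ d).rTensor B t) := forall_of_tmul (f := (mulLeft ℂ d).rTensor B ∘ₗ
      contractLeft (R ∘ₗ (TensorProduct.mk ℂ B A).flip a') (LinearMap.mul ℂ A))
    (g := contractLeft (R ∘ₗ (TensorProduct.mk ℂ B A).flip a') (LinearMap.mul ℂ A) ∘ₗ
      (mulLeft ℂ d).rTensor B) fun x y => by
    simp only [LinearMap.comp_apply, LinearMap.rTensor_tmul, contractLeft_tmul]
    change _ = (mulLeft ℂ (d * x)).rTensor B _
    rw [G.mulLeft_mul, LinearMap.rTensor_comp_apply]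
    rfl
  rw [h1, hact.twist_cover, hact.twist_cover, G.t₂_mul]
  refine forall_of_tmul (f := (act b).lTensor A ∘ₗ rightMul G.T₂.toLinearMap a')
    (g := contractLeft (R ∘ₗ (TensorProduct.mk ℂ B A).flip a') (LinearMap.mul ℂ A) ∘ₗ
      (act b).lTensor A) (fun u v => ?_) (G.t₂ d a)
  simp only [LinearMap.comp_apply, G.rightMul_tmul, LinearMap.lTensor_tmul, contractLeft_tmul]
  rw [← LinearMap.lTensor_comp_apply, hact.act_comp_mulLeft]
  exact (hact.twist_cover _ _ _).symm

/-- `R(bb' ⊗ a)` is the product of `b` and `R(b' ⊗ a)` in the smash product. -/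
theorem twist_mul_left (b b' : B) (a : A) :
    twist HA.toMultiplierHopfAlgebra act ((b * b') ⊗ₜ a) =
      contractRight (twist HA.toMultiplierHopfAlgebra act ∘ₗ TensorProduct.mk ℂ B A b)
        (LinearMap.mul ℂ B) (twist HA.toMultiplierHopfAlgebra act (b' ⊗ₜ a)) := by
  set G := HA.canonicalPair
  set R := twist HA.toMultiplierHopfAlgebra act with hR
  refine G.eq_of_mulLeft_rTensor fun d => ?_
  have h1 : act (b * b') = mul' ℂ B ∘ₗ (act b).rTensor B ∘ₗ R ∘ₗ TensorProduct.mk ℂ B A b' :=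
    LinearMap.ext fun a => hact.act_mul_eq b b' a
  rw [hact.twist_cover, h1, LinearMap.lTensor_comp_apply, LinearMap.lTensor_comp_apply,
    ← hact.assoc_t₂_twist]
  refine forall_of_tmul (f := (mul' ℂ B).lTensor A ∘ₗ ((act b).rTensor B).lTensor A ∘ₗ
    (assoc ℂ A A B).toLinearMap ∘ₗ (G.t₂ d).rTensor B) (g := (mulLeft ℂ d).rTensor B ∘ₗ
    contractRight (R ∘ₗ TensorProduct.mk ℂ B A b) (LinearMap.mul ℂ B)) (fun α β => ?_) _
  simp only [LinearMap.comp_apply, LinearMap.rTensor_tmul, contractRight_tmul]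
  rw [rTensor_lTensor]
  change _ = ((LinearMap.mul ℂ B).flip β).lTensor A ((mulLeft ℂ d).rTensor B (R (b ⊗ₜ α)))
  rw [hact.twist_cover]
  refine forall_of_tmul (f := (mul' ℂ B).lTensor A ∘ₗ ((act b).rTensor B).lTensor A ∘ₗ
    (assoc ℂ A A B).toLinearMap ∘ₗ (TensorProduct.mk ℂ (A ⊗[ℂ] A) B).flip β)
    (g := ((LinearMap.mul ℂ B).flip β).lTensor A ∘ₗ (act b).lTensor A) (fun u v => ?_) (G.t₂ d α)
  simp

end IsRightModuleAlgebra

/-- `actComul c a = ∑ (c ◁ a₍₁₎) ⊗ a₍₂₎`, the flipped `Rᵒᵖ`. -/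
noncomputable def actComul (HA : RegularMultiplierHopfAlgebra A) (act : B →ₗ[ℂ] A →ₗ[ℂ] B) (c : B) :
    A →ₗ[ℂ] B ⊗[ℂ] A :=
  (comm ℂ A B).toLinearMap ∘ₗ twistOp HA act ∘ₗ TensorProduct.mk ℂ B A c

namespace IsRightModuleAlgebra

variable {HA : RegularMultiplierHopfAlgebra A} {act : B →ₗ[ℂ] A →ₗ[ℂ] B}
  (hact : IsRightModuleAlgebra HA.toMultiplierHopfAlgebra act)
include hact

theorem actComul_act (c : B) (e a : A) :
    actComul HA act (act c e) a = (act c).rTensor A (HA.canonicalPair.t₂ e a) := by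
  change comm ℂ A B (twistOp HA act (act c e ⊗ₜ a)) = _
  rw [hact.twistOp_act, comm_lTensor, CanonicalPair.comm_comm]

/-- `∑ (c ◁ a₍₁₎) ⊗ F(a₍₂₎)` for a map `F : a ↦ ∑ a₍₁₎ ⊗ f(a₍₂₎)`. -/
theorem assoc_actComul_rTensor {F : A →ₗ[ℂ] A ⊗[ℂ] V} {f : A →ₗ[ℂ] V}
    (h : ∀ c a, (mulLeft ℂ c).rTensor V (F a) = f.lTensor A (HA.canonicalPair.t₂ c a))
    (c : B) (a : A) :
    assoc ℂ B A V ((actComul HA act c).rTensor V (F a)) = F.lTensor B (actComul HA act c a) := by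
  obtain ⟨t, rfl⟩ := hact.lift_surjective c
  induction t using TensorProduct.induction_on with
  | zero => simp [actComul]
  | add x y hx hy =>
    have : actComul HA act (lift act (x + y)) =
        actComul HA act (lift act x) + actComul HA act (lift act y) := by
      simp [actComul, LinearMap.comp_add]
    rw [this, LinearMap.rTensor_add, LinearMap.add_apply, map_add, hx, hy, LinearMap.add_apply,
      map_add]
  | tmul c e =>
    have : actComul HA act (act c e) = (act c).rTensor A ∘ₗ HA.canonicalPair.t₂ e :=
      LinearMap.ext fun a => hact.actComul_act c e a
    rw [lift.tmul, this, LinearMap.rTensor_comp_apply, assoc_rTensor_rTensor,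
      HA.canonicalPair.assoc_t₂_rTensor h, rTensor_lTensor, LinearMap.comp_apply]

theorem actComul_mul (c β : B) (a : A) :
    actComul HA act (c * β) a =
      contractLeft (actComul HA act β) (LinearMap.mul ℂ B) (actComul HA act c a) := by
  set G := HA.canonicalPair
  refine LinearMap.congr_fun (hact.hom_ext (f := ((comm ℂ A B).toLinearMap ∘ₗ twistOp HA act ∘ₗ
    (TensorProduct.mk ℂ B A).flip a) ∘ₗ mulRight ℂ β)
    (g := contractLeft (actComul HA act β) (LinearMap.mul ℂ B) ∘ₗ (comm ℂ A B).toLinearMap ∘ₗ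
      twistOp HA act ∘ₗ (TensorProduct.mk ℂ B A).flip a) fun c e => ?_) c
  change actComul HA act (act c e * β) a = contractLeft (actComul HA act β) (LinearMap.mul ℂ B)
    (actComul HA act (act c e) a)
  refine G.eq_of_mulLeft_lTensor fun d => ?_
  let T₄ : A →ₗ[ℂ] A ⊗[ℂ] A := (comm ℂ A A).toLinearMap ∘ₗ HA.cop.canonicalPair.t₂ d
  have hT₄ : ∀ c a, (mulLeft ℂ c).rTensor A (T₄ a) = (mulLeft ℂ d).lTensor A (G.t₂ c a) :=
    fun c a => by
      rw [HA.isOpposite.t₂_mulLeft, comm_lTensor]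
      rfl
  have h1 : ∀ b a, (mulLeft ℂ d).lTensor B (actComul HA act b a) = (act b).rTensor A (T₄ a) :=
    fun b a => by
      change (mulLeft ℂ d).lTensor B (comm ℂ A B (twistOp HA act (b ⊗ₜ a))) = _
      rw [← comm_rTensor, hact.twistOp_cover, comm_lTensor]
      rfl
  have h2 : act (act c e * β) = mul' ℂ B ∘ₗ (act c).rTensor B ∘ₗ (act β).lTensor A ∘ₗ G.t₂ e := by
    ext a
    rw [hact.mul_act, ← LinearMap.rTensor_comp_lTensor]
    rfl
  have h3 : (G.t₂ e).rTensor A (T₄ a) = (assoc ℂ A A A).symm (T₄.lTensor A (G.t₂ e a)) := by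
    rw [← G.assoc_t₂_rTensor hT₄, LinearEquiv.symm_apply_apply]
  rw [h1, h2, hact.actComul_act, LinearMap.rTensor_comp_apply, LinearMap.rTensor_comp_apply,
    LinearMap.rTensor_comp_apply, h3]
  refine forall_of_tmul (f := (mul' ℂ B).rTensor A ∘ₗ ((act c).rTensor B).rTensor A ∘ₗ
    ((act β).lTensor A).rTensor A ∘ₗ (assoc ℂ A A A).symm.toLinearMap ∘ₗ T₄.lTensor A)
    (g := (mulLeft ℂ d).lTensor B ∘ₗ contractLeft (actComul HA act β) (LinearMap.mul ℂ B) ∘ₗ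
      (act c).rTensor A) (fun u v => ?_) (G.t₂ e a)
  simp only [LinearMap.comp_apply, LinearMap.rTensor_tmul, contractLeft_tmul]
  rw [← rTensor_lTensor, h1]
  refine forall_of_tmul (f := (mul' ℂ B).rTensor A ∘ₗ ((act c).rTensor B).rTensor A ∘ₗ
    ((act β).lTensor A).rTensor A ∘ₗ (assoc ℂ A A A).symm.toLinearMap ∘ₗ
      TensorProduct.mk ℂ A (A ⊗[ℂ] A) u)
    (g := (LinearMap.mul ℂ B (act c u)).rTensor A ∘ₗ (act β).rTensor A) (fun x y => ?_) (T₄ v)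
  simp

end IsRightModuleAlgebra

end Action

/-! ### Coactions and the cotwist map -/

section Regular

variable {B : Type*} [NonUnitalNonAssocRing B] [Module ℂ B] [IsScalarTower ℂ B B]
  [SMulCommClass ℂ B B]

theorem CanonicalPair.mul'_surjective (G : CanonicalPair B) : Function.Surjective (mul' ℂ B) := by
  intro z
  by_cases hz : z = 0
  · exact ⟨0, by rw [hz, map_zero]⟩
  · obtain ⟨x, hx⟩ := G.exists_counit_eq_one hz
    refine ⟨G.T₁.symm (x ⊗ₜ z), ?_⟩
    rw [G.mul_T₁_symm]
    simp [hx]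

theorem CanonicalPair.counit_rTensor_mulRight (G : CanonicalPair B) (c : B) (t : B ⊗[ℂ] B) :
    lid ℂ B (G.counit.rTensor B ((mulRight ℂ c).rTensor B t)) =
      G.counit c • lid ℂ B (G.counit.rTensor B t) :=
  forall_of_tmul (f := (lid ℂ B).toLinearMap ∘ₗ G.counit.rTensor B ∘ₗ (mulRight ℂ c).rTensor B)
    (g := G.counit c • ((lid ℂ B).toLinearMap ∘ₗ G.counit.rTensor B))
    (fun x y => by simp [G.counit_mul, smul_smul, mul_comm]) t

/-- `(ε ⊗ ι)((w ⊗ 1)Δ(x)) = ε(w)x`. -/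
theorem CanonicalPair.counit_rTensor_t₂ (G : CanonicalPair B) (w x : B) :
    lid ℂ B (G.counit.rTensor B (G.t₂ w x)) = G.counit w • x := by
  refine sub_eq_zero.mp (G.eq_zero_of_mul _ fun y => ?_)
  have h1 : ∀ t : B ⊗[ℂ] B, lid ℂ B (G.counit.rTensor B t) * y =
      lid ℂ B (G.counit.rTensor B ((mulRight ℂ y).lTensor B t)) :=
    forall_of_tmul (f := mulRight ℂ y ∘ₗ (lid ℂ B).toLinearMap ∘ₗ G.counit.rTensor B)
      (g := (lid ℂ B).toLinearMap ∘ₗ G.counit.rTensor B ∘ₗ (mulRight ℂ y).lTensor B)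
      fun u v => by simp
  have h2 : ∀ t : B ⊗[ℂ] B, lid ℂ B (G.counit.rTensor B ((mulLeft ℂ w).rTensor B t)) =
      G.counit w • lid ℂ B (G.counit.rTensor B t) :=
    forall_of_tmul (f := (lid ℂ B).toLinearMap ∘ₗ G.counit.rTensor B ∘ₗ (mulLeft ℂ w).rTensor B)
      (g := G.counit w • ((lid ℂ B).toLinearMap ∘ₗ G.counit.rTensor B))
      fun u v => by simp [G.counit_mul, smul_smul]
  rw [sub_mul, sub_eq_zero, h1, ← G.t_compat, h2, G.counit_left, smul_mul_assoc]

namespace RegularMultiplierHopfAlgebra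

variable (H : RegularMultiplierHopfAlgebra B)

/-- `t₃ c x = Δ(x)(c ⊗ 1)`, linear in `x`. -/
noncomputable def t₃ (c : B) : B →ₗ[ℂ] B ⊗[ℂ] B := H.T₃ ∘ₗ (TensorProduct.mk ℂ B B).flip c

theorem T₃_surjective : Function.Surjective H.T₃ :=
  (comm ℂ B B).surjective.comp H.cop.T₁.surjective

theorem t₃_mulRight_lTensor (c x y : B) : (mulRight ℂ y).lTensor B (H.t₃ c x) =
    (mulRight ℂ c).rTensor B (H.canonicalPair.t₁ y x) := by
  rw [H.isOpposite, comm_rTensor]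
  rfl

theorem t₃_mulLeft_rTensor (c w x : B) : (mulLeft ℂ w).rTensor B (H.t₃ c x) =
    (mulRight ℂ c).rTensor B (H.canonicalPair.t₂ w x) := by
  rw [H.isOpposite.t₂_mulRight, comm_lTensor]
  rfl

/-- `(ε ⊗ ι)(Δ(x)(c ⊗ 1)) = ε(c)x`. -/
theorem counit_rTensor_t₃ (c x : B) :
    lid ℂ B (H.canonicalPair.counit.rTensor B (H.t₃ c x)) = H.canonicalPair.counit c • x := by
  set G := H.canonicalPair
  refine sub_eq_zero.mp (G.eq_zero_of_mul _ fun y => ?_)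
  have h1 : ∀ t : B ⊗[ℂ] B, lid ℂ B (G.counit.rTensor B t) * y =
      lid ℂ B (G.counit.rTensor B ((mulRight ℂ y).lTensor B t)) :=
    forall_of_tmul (f := mulRight ℂ y ∘ₗ (lid ℂ B).toLinearMap ∘ₗ G.counit.rTensor B)
      (g := (lid ℂ B).toLinearMap ∘ₗ G.counit.rTensor B ∘ₗ (mulRight ℂ y).lTensor B)
      fun u v => by simp
  rw [sub_mul, sub_eq_zero, h1, H.t₃_mulRight_lTensor, G.counit_rTensor_mulRight, G.counit_left,
    smul_mul_assoc]

/-- `∑ S(x₍₁₎ c) x₍₂₎ = ε(x) S(c)`. -/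
theorem antipode_rTensor_t₃ {S : B →ₗ[ℂ] B} (hS : H.canonicalPair.IsAntipode S) (c x : B) :
    mul' ℂ B (S.rTensor B (H.t₃ c x)) = H.canonicalPair.counit x • S c := by
  set G := H.canonicalPair
  refine sub_eq_zero.mp (G.eq_zero_of_mul _ fun y => ?_)
  have h1 : ∀ t : B ⊗[ℂ] B, mul' ℂ B (S.rTensor B t) * y =
      mul' ℂ B (S.rTensor B ((mulRight ℂ y).lTensor B t)) :=
    forall_of_tmul (f := mulRight ℂ y ∘ₗ mul' ℂ B ∘ₗ S.rTensor B)
      (g := mul' ℂ B ∘ₗ S.rTensor B ∘ₗ (mulRight ℂ y).lTensor B)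
      fun u v => by simp [G.mul_assoc]
  have h2 : ∀ t : B ⊗[ℂ] B, mul' ℂ B (S.rTensor B ((mulRight ℂ c).rTensor B t)) =
      S c * mul' ℂ B (S.rTensor B t) :=
    forall_of_tmul (f := mul' ℂ B ∘ₗ S.rTensor B ∘ₗ (mulRight ℂ c).rTensor B)
      (g := mulLeft ℂ (S c) ∘ₗ mul' ℂ B ∘ₗ S.rTensor B)
      fun u v => by simp [hS.map_mul, G.mul_assoc]
  rw [sub_mul, sub_eq_zero, h1, H.t₃_mulRight_lTensor, h2, hS.left, mul_smul_comm, smul_mul_assoc]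

end RegularMultiplierHopfAlgebra

end Regular

section Coaction

variable {A : Type*} [NonUnitalNonAssocRing A] [Module ℂ A] [IsScalarTower ℂ A A]
  [SMulCommClass ℂ A A]
variable {B : Type*} [NonUnitalNonAssocRing B] [Module ℂ B] [IsScalarTower ℂ B B]
  [SMulCommClass ℂ B B]
variable (Γ : A →ₗ[ℂ] LeftCompletion A B)

/-- `(c ⊗ 1)(Γ(a)(b ⊗ 1)) = ((c ⊗ 1)Γ(a))(b ⊗ 1)`. -/
theorem cotwist_compat (a : A) (b c : B) : (mulLeft ℂ c).rTensor A (cotwist Γ (a ⊗ₜ b)) =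
    (mulRight ℂ b).rTensor A (cotwistOp Γ (a ⊗ₜ c)) := (Γ a).2 c b

theorem cotwistOp_mul (G : CanonicalPair B) (a : A) (c b : B) : cotwistOp Γ (a ⊗ₜ (c * b)) =
    (mulLeft ℂ c).rTensor A (cotwistOp Γ (a ⊗ₜ b)) := by
  refine G.eq_of_mulRight_rTensor fun d => ?_
  rw [← cotwist_compat, G.mulLeft_mul, LinearMap.rTensor_comp_apply, cotwist_compat,
    G.rTensor_mulRight_mulLeft]

/-- An element `a` of `A` is determined by the elements `Γ(a)(b ⊗ 1)`. -/
theorem eq_of_cotwist (G : CanonicalPair B) (hΓ : Function.Injective Γ) {a a' : A}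
    (h : ∀ b, cotwist Γ (a ⊗ₜ b) = cotwist Γ (a' ⊗ₜ b)) : a = a' := by
  refine hΓ (Subtype.ext (Prod.ext (LinearMap.ext h) (LinearMap.ext fun b => ?_)))
  change cotwistOp Γ (a ⊗ₜ b) = cotwistOp Γ (a' ⊗ₜ b)
  refine G.eq_of_mulRight_rTensor fun d => ?_
  rw [← cotwist_compat, ← cotwist_compat, h]

/-- `b ⊗ c ↦ ∑ a₍₋₁₎b ⊗ Γ(a₍₀₎)(c ⊗ 1)`. -/
noncomputable def cotwistTwice (a : A) : B ⊗[ℂ] B →ₗ[ℂ] B ⊗[ℂ] (B ⊗[ℂ] A) :=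
  (cotwist Γ).lTensor B ∘ₗ (assoc ℂ B A B).toLinearMap ∘ₗ
    (cotwist Γ ∘ₗ TensorProduct.mk ℂ A B a).rTensor B

/-- `b ⊗ c ↦ ∑ ba₍₋₁₎ ⊗ (c ⊗ 1)Γ(a₍₀₎)`. -/
noncomputable def cotwistOpTwice (a : A) : B ⊗[ℂ] B →ₗ[ℂ] B ⊗[ℂ] (B ⊗[ℂ] A) :=
  (cotwistOp Γ).lTensor B ∘ₗ (assoc ℂ B A B).toLinearMap ∘ₗ
    (cotwistOp Γ ∘ₗ TensorProduct.mk ℂ A B a).rTensor B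

theorem lTensor_assoc_tmul {X Y Z U : Type*} [AddCommGroup X] [AddCommGroup Y] [AddCommGroup Z]
    [AddCommGroup U] [Module ℂ X] [Module ℂ Y] [Module ℂ Z] [Module ℂ U]
    (f : Y ⊗[ℂ] Z →ₗ[ℂ] U) (t : X ⊗[ℂ] Y) (z : Z) :
    f.lTensor X (assoc ℂ X Y Z (t ⊗ₜ z)) = (f ∘ₗ (TensorProduct.mk ℂ Y Z).flip z).lTensor X t :=
  forall_of_tmul (f := f.lTensor X ∘ₗ (assoc ℂ X Y Z).toLinearMap ∘ₗ
      (TensorProduct.mk ℂ (X ⊗[ℂ] Y) Z).flip z)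
    (g := (f ∘ₗ (TensorProduct.mk ℂ Y Z).flip z).lTensor X) (fun x y => by simp) t

theorem cotwistTwice_tmul (a : A) (b c : B) : cotwistTwice Γ a (b ⊗ₜ c) =
    (cotwist Γ ∘ₗ (TensorProduct.mk ℂ A B).flip c).lTensor B (cotwist Γ (a ⊗ₜ b)) := by
  rw [← lTensor_assoc_tmul]
  rfl

theorem cotwistOpTwice_tmul (a : A) (b c : B) : cotwistOpTwice Γ a (b ⊗ₜ c) =
    (cotwistOp Γ ∘ₗ (TensorProduct.mk ℂ A B).flip c).lTensor B (cotwistOp Γ (a ⊗ₜ b)) := by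
  rw [← lTensor_assoc_tmul]
  rfl

namespace IsLeftCoaction

variable {Γ} {HB : RegularMultiplierHopfAlgebra B} (hΓ : IsLeftCoaction HB Γ)
include hΓ

theorem cotwistTwice_t₃ (a : A) (b b' : B) : cotwistTwice Γ a (HB.t₃ b' b) =
    assoc ℂ B B A ((HB.t₃ b').rTensor A (cotwist Γ (a ⊗ₜ b))) := by
  refine Eq.trans ?_ (hΓ.coassoc_right a b b')
  change cotwistTwice Γ a (HB.T₃ (b ⊗ₜ b')) = _
  exact forall_of_tmul (f := cotwistTwice Γ a) (g := (cotwist Γ).lTensor B ∘ₗ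
    (assoc ℂ B A B).toLinearMap ∘ₗ (cotwist Γ).rTensor B ∘ₗ
      (assoc ℂ A B B).symm.toLinearMap ∘ₗ TensorProduct.mk ℂ A (B ⊗[ℂ] B) a)
    (fun x y => by simp [cotwistTwice]) _

theorem cotwistOpTwice_t₂ (a : A) (b b' : B) :
    cotwistOpTwice Γ a (HB.canonicalPair.t₂ b' b) =
      assoc ℂ B B A ((HB.canonicalPair.t₂ b').rTensor A (cotwistOp Γ (a ⊗ₜ b))) := by
  refine Eq.trans ?_ (hΓ.coassoc_left a b b')
  change cotwistOpTwice Γ a (HB.T₂ (b' ⊗ₜ b)) = _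
  exact forall_of_tmul (f := cotwistOpTwice Γ a) (g := (cotwistOp Γ).lTensor B ∘ₗ
    (assoc ℂ B A B).toLinearMap ∘ₗ (cotwistOp Γ).rTensor B ∘ₗ
      (assoc ℂ A B B).symm.toLinearMap ∘ₗ TensorProduct.mk ℂ A (B ⊗[ℂ] B) a)
    (fun x y => by simp [cotwistOpTwice]) _

/-- `(ε ⊗ ι)(Γ(a)(b ⊗ 1)) = ε(b)a`. -/
theorem counit_cotwist (a : A) (b : B) :
    lid ℂ A (HB.canonicalPair.counit.rTensor A (cotwist Γ (a ⊗ₜ b))) =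
      HB.canonicalPair.counit b • a := by
  set G := HB.canonicalPair
  by_cases hb : b = 0
  · simp [hb]
  obtain ⟨c₀, hc₀⟩ := G.exists_counit_eq_one hb
  -- the map `(ε ⊗ ι)Γ`, to be identified with the identity
  let e : A →ₗ[ℂ] A := (lid ℂ A).toLinearMap ∘ₗ G.counit.rTensor A ∘ₗ cotwistOp Γ ∘ₗ
    (TensorProduct.mk ℂ A B).flip c₀
  have hr : ∀ c (t : B ⊗[ℂ] A), lid ℂ A (G.counit.rTensor A ((mulRight ℂ c).rTensor A t)) =
      G.counit c • lid ℂ A (G.counit.rTensor A t) := fun c =>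
    forall_of_tmul (f := (lid ℂ A).toLinearMap ∘ₗ G.counit.rTensor A ∘ₗ (mulRight ℂ c).rTensor A)
      (g := G.counit c • ((lid ℂ A).toLinearMap ∘ₗ G.counit.rTensor A))
      fun u v => by simp [G.counit_mul, smul_smul, mul_comm]
  have hl : ∀ c (t : B ⊗[ℂ] A), lid ℂ A (G.counit.rTensor A ((mulLeft ℂ c).rTensor A t)) =
      G.counit c • lid ℂ A (G.counit.rTensor A t) := fun c =>
    forall_of_tmul (f := (lid ℂ A).toLinearMap ∘ₗ G.counit.rTensor A ∘ₗ (mulLeft ℂ c).rTensor A)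
      (g := G.counit c • ((lid ℂ A).toLinearMap ∘ₗ G.counit.rTensor A))
      fun u v => by simp [G.counit_mul, smul_smul]
  have he : ∀ a b, lid ℂ A (G.counit.rTensor A (cotwist Γ (a ⊗ₜ b))) = G.counit b • e a :=
    fun a b => by
      have := congrArg (fun t => lid ℂ A (G.counit.rTensor A t)) (cotwist_compat Γ a b c₀)
      rw [hr, hl, hc₀, one_smul] at this
      exact this
  have h1 : ∀ (a : A) (s : B ⊗[ℂ] B), lid ℂ (B ⊗[ℂ] A) (G.counit.rTensor _ (cotwistTwice Γ a s)) =
      cotwist Γ (e a ⊗ₜ lid ℂ B (G.counit.rTensor B s)) := fun a => by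
    refine forall_of_tmul (f := (lid ℂ (B ⊗[ℂ] A)).toLinearMap ∘ₗ G.counit.rTensor _ ∘ₗ
      cotwistTwice Γ a) (g := cotwist Γ ∘ₗ TensorProduct.mk ℂ A B (e a) ∘ₗ (lid ℂ B).toLinearMap ∘ₗ
        G.counit.rTensor B) fun u v => ?_
    simp only [LinearMap.comp_apply, cotwistTwice_tmul, LinearEquiv.coe_coe]
    rw [rTensor_lTensor]
    have h2 : ∀ t : B ⊗[ℂ] A, lid ℂ (B ⊗[ℂ] A)
        ((cotwist Γ ∘ₗ (TensorProduct.mk ℂ A B).flip v).lTensor ℂ (G.counit.rTensor A t)) =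
        cotwist Γ (lid ℂ A (G.counit.rTensor A t) ⊗ₜ v) :=
      forall_of_tmul (f := (lid ℂ (B ⊗[ℂ] A)).toLinearMap ∘ₗ
        (cotwist Γ ∘ₗ (TensorProduct.mk ℂ A B).flip v).lTensor ℂ ∘ₗ G.counit.rTensor A)
        (g := cotwist Γ ∘ₗ (TensorProduct.mk ℂ A B).flip v ∘ₗ (lid ℂ A).toLinearMap ∘ₗ
          G.counit.rTensor A) fun x y => by simp
    rw [h2, he]
    simp [← TensorProduct.smul_tmul']
  have h3 : e a = a := by
    refine eq_of_cotwist Γ G hΓ.injective fun b => ?_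
    have h4 := congrArg (fun t => lid ℂ (B ⊗[ℂ] A) (G.counit.rTensor _ t))
      (hΓ.cotwistTwice_t₃ a b c₀)
    simp only [h1] at h4
    rw [HB.counit_rTensor_t₃, hc₀, one_smul] at h4
    rw [h4]
    refine (forall_of_tmul (f := (lid ℂ (B ⊗[ℂ] A)).toLinearMap ∘ₗ G.counit.rTensor _ ∘ₗ
      (assoc ℂ B B A).toLinearMap ∘ₗ (HB.t₃ c₀).rTensor A) (g := LinearMap.id)
      (fun x y => ?_) (cotwist Γ (a ⊗ₜ b)))
    have h5 : ∀ s : B ⊗[ℂ] B, lid ℂ (B ⊗[ℂ] A) (G.counit.rTensor _ (assoc ℂ B B A (s ⊗ₜ y))) =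
        lid ℂ B (G.counit.rTensor B s) ⊗ₜ y :=
      forall_of_tmul (f := (lid ℂ (B ⊗[ℂ] A)).toLinearMap ∘ₗ G.counit.rTensor _ ∘ₗ
        (assoc ℂ B B A).toLinearMap ∘ₗ (TensorProduct.mk ℂ (B ⊗[ℂ] B) A).flip y)
        (g := (TensorProduct.mk ℂ B A).flip y ∘ₗ (lid ℂ B).toLinearMap ∘ₗ G.counit.rTensor B)
        fun u v => by simp
    simp only [LinearMap.comp_apply, LinearMap.rTensor_tmul, LinearEquiv.coe_coe, h5]
    rw [HB.counit_rTensor_t₃, hc₀, one_smul, LinearMap.id_apply]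
  rw [he, h3]

/-- `(ε ⊗ ι)((b ⊗ 1)Γ(a)) = ε(b)a`. -/
theorem counit_cotwistOp (a : A) (b : B) :
    lid ℂ A (HB.canonicalPair.counit.rTensor A (cotwistOp Γ (a ⊗ₜ b))) =
      HB.canonicalPair.counit b • a := by
  set G := HB.canonicalPair
  by_cases hb : b = 0
  · simp [hb]
  obtain ⟨c₀, hc₀⟩ := G.exists_counit_eq_one hb
  have hr : ∀ c (t : B ⊗[ℂ] A), lid ℂ A (G.counit.rTensor A ((mulRight ℂ c).rTensor A t)) =
      G.counit c • lid ℂ A (G.counit.rTensor A t) := fun c =>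
    forall_of_tmul (f := (lid ℂ A).toLinearMap ∘ₗ G.counit.rTensor A ∘ₗ (mulRight ℂ c).rTensor A)
      (g := G.counit c • ((lid ℂ A).toLinearMap ∘ₗ G.counit.rTensor A))
      fun u v => by simp [G.counit_mul, smul_smul, mul_comm]
  have hl : ∀ c (t : B ⊗[ℂ] A), lid ℂ A (G.counit.rTensor A ((mulLeft ℂ c).rTensor A t)) =
      G.counit c • lid ℂ A (G.counit.rTensor A t) := fun c =>
    forall_of_tmul (f := (lid ℂ A).toLinearMap ∘ₗ G.counit.rTensor A ∘ₗ (mulLeft ℂ c).rTensor A)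
      (g := G.counit c • ((lid ℂ A).toLinearMap ∘ₗ G.counit.rTensor A))
      fun u v => by simp [G.counit_mul, smul_smul]
  have := congrArg (fun t => lid ℂ A (G.counit.rTensor A t)) (cotwist_compat Γ a c₀ b)
  rw [hr, hl, hΓ.counit_cotwist, hc₀, one_smul, one_smul] at this
  exact this.symm

end IsLeftCoaction

end Coaction

/-! ### Bijectivity of the cotwist map -/

/-- `f` on the first and the third leg. -/
noncomputable def legs₁₃ {X Y Z U V : Type*} [AddCommGroup X] [AddCommGroup Y] [AddCommGroup Z]
    [AddCommGroup U] [AddCommGroup V] [Module ℂ X] [Module ℂ Y] [Module ℂ Z] [Module ℂ U]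
    [Module ℂ V] (f : X ⊗[ℂ] Y →ₗ[ℂ] U ⊗[ℂ] V) : (X ⊗[ℂ] Z) ⊗[ℂ] Y →ₗ[ℂ] U ⊗[ℂ] (Z ⊗[ℂ] V) :=
  (assoc ℂ U Z V).toLinearMap ∘ₗ (TensorProduct.rightComm ℂ U V Z).toLinearMap ∘ₗ f.rTensor Z ∘ₗ
    (TensorProduct.rightComm ℂ X Z Y).toLinearMap

theorem legs₁₃_tmul {X Y Z U V : Type*} [AddCommGroup X] [AddCommGroup Y] [AddCommGroup Z]
    [AddCommGroup U] [AddCommGroup V] [Module ℂ X] [Module ℂ Y] [Module ℂ Z] [Module ℂ U]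
    [Module ℂ V] (f : X ⊗[ℂ] Y →ₗ[ℂ] U ⊗[ℂ] V) (x : X) (z : Z) (y : Y) :
    legs₁₃ f ((x ⊗ₜ z) ⊗ₜ y) = (TensorProduct.mk ℂ Z V z).lTensor U (f (x ⊗ₜ y)) := by
  simp only [legs₁₃, LinearMap.comp_apply, LinearEquiv.coe_coe, TensorProduct.rightComm_tmul,
    LinearMap.rTensor_tmul]
  exact forall_of_tmul (f := (assoc ℂ U Z V).toLinearMap ∘ₗ
    (TensorProduct.rightComm ℂ U V Z).toLinearMap ∘ₗ (TensorProduct.mk ℂ (U ⊗[ℂ] V) Z).flip z)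
    (g := (TensorProduct.mk ℂ Z V z).lTensor U) (fun x y => by simp) _

namespace IsLeftCoaction

variable {A : Type*} [NonUnitalNonAssocRing A] [Module ℂ A] [IsScalarTower ℂ A A]
  [SMulCommClass ℂ A A]
variable {B : Type*} [NonUnitalNonAssocRing B] [Module ℂ B] [IsScalarTower ℂ B B]
  [SMulCommClass ℂ B B]
variable {Γ : A →ₗ[ℂ] LeftCompletion A B} {HB : RegularMultiplierHopfAlgebra B}
  (hΓ : IsLeftCoaction HB Γ)
include hΓ

/-- `Tᵒᵖ(ι ⊗ S)σT = (S ⊗ ι)σ`, since `∑ S(a₍₋₂₎ b) a₍₋₁₎ ⊗ a₍₀₎ = S(b) ⊗ a`. -/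
theorem cotwistOp_antipode {S : B →ₗ[ℂ] B} (hS : HB.canonicalPair.IsAntipode S) (a : A) (b : B) :
    cotwistOp Γ (S.lTensor A (comm ℂ B A (cotwist Γ (a ⊗ₜ b)))) = S b ⊗ₜ a := by
  set G := HB.canonicalPair
  let Θ : B ⊗[ℂ] (B ⊗[ℂ] A) →ₗ[ℂ] B ⊗[ℂ] A :=
    (mul' ℂ B).rTensor A ∘ₗ (assoc ℂ B B A).symm.toLinearMap ∘ₗ S.rTensor _
  have hΘ : ∀ q t, Θ (q ⊗ₜ t) = (mulLeft ℂ (S q)).rTensor A t := fun q =>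
    forall_of_tmul (f := Θ ∘ₗ TensorProduct.mk ℂ B (B ⊗[ℂ] A) q) fun x y => by simp [Θ]
  have h1 : ∀ u v, Θ (cotwistTwice Γ a (u ⊗ₜ v)) = (mulRight ℂ v).rTensor A
      (cotwistOp Γ (S.lTensor A (comm ℂ B A (cotwist Γ (a ⊗ₜ u))))) := fun u v => by
    rw [cotwistTwice_tmul]
    refine forall_of_tmul (f := Θ ∘ₗ (cotwist Γ ∘ₗ (TensorProduct.mk ℂ A B).flip v).lTensor B)
      (g := (mulRight ℂ v).rTensor A ∘ₗ cotwistOp Γ ∘ₗ S.lTensor A ∘ₗ (comm ℂ B A).toLinearMap)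
      (fun q x => ?_) _
    simp only [LinearMap.comp_apply, LinearMap.lTensor_tmul, hΘ, LinearEquiv.coe_coe,
      TensorProduct.comm_tmul, ← cotwist_compat]
    rfl
  have h2 : ∀ s, Θ (cotwistTwice Γ a s) = mul' ℂ B (S.rTensor B s) ⊗ₜ a := fun s => by
    obtain ⟨s, rfl⟩ := HB.T₃_surjective s
    refine forall_of_tmul (f := Θ ∘ₗ cotwistTwice Γ a ∘ₗ HB.T₃)
      (g := (TensorProduct.mk ℂ B A).flip a ∘ₗ mul' ℂ B ∘ₗ S.rTensor B ∘ₗ HB.T₃)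
      (fun b b' => ?_) s
    change Θ (cotwistTwice Γ a (HB.t₃ b' b)) = mul' ℂ B (S.rTensor B (HB.t₃ b' b)) ⊗ₜ a
    rw [hΓ.cotwistTwice_t₃, HB.antipode_rTensor_t₃ hS, TensorProduct.smul_tmul,
      ← hΓ.counit_cotwist]
    refine forall_of_tmul (f := Θ ∘ₗ (assoc ℂ B B A).toLinearMap ∘ₗ (HB.t₃ b').rTensor A)
      (g := TensorProduct.mk ℂ B A (S b') ∘ₗ (lid ℂ A).toLinearMap ∘ₗ G.counit.rTensor A)
      (fun x y => ?_) _
    have h3 : ∀ s : B ⊗[ℂ] B, Θ (assoc ℂ B B A (s ⊗ₜ y)) = mul' ℂ B (S.rTensor B s) ⊗ₜ y :=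
      forall_of_tmul (f := Θ ∘ₗ (assoc ℂ B B A).toLinearMap ∘ₗ
        (TensorProduct.mk ℂ (B ⊗[ℂ] B) A).flip y)
        (g := (TensorProduct.mk ℂ B A).flip y ∘ₗ mul' ℂ B ∘ₗ S.rTensor B)
        fun u v => by simp [Θ]
    simp only [LinearMap.comp_apply, LinearMap.rTensor_tmul, LinearEquiv.coe_coe, h3]
    rw [HB.antipode_rTensor_t₃ hS, TensorProduct.smul_tmul]
    simp [G]
  refine G.eq_of_mulRight_rTensor fun v => ?_
  rw [← h1, h2]
  simp

/-- `T(ι ⊗ S⁻¹)σTᵒᵖ = (S⁻¹ ⊗ ι)σ`, since `∑ a₍₋₁₎ S⁻¹(b a₍₋₂₎) ⊗ a₍₀₎ = S⁻¹(b) ⊗ a`. -/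
theorem cotwist_antipode {S S' : B →ₗ[ℂ] B} (hS : HB.canonicalPair.IsAntipode S)
    (hS' : ∀ x, S (S' x) = x) (hS'' : Function.Injective S) (a : A) (b : B) :
    cotwist Γ (S'.lTensor A (comm ℂ B A (cotwistOp Γ (a ⊗ₜ b)))) = S' b ⊗ₜ a := by
  set G := HB.canonicalPair
  let mop : B ⊗[ℂ] B →ₗ[ℂ] B := mul' ℂ B ∘ₗ S'.lTensor B ∘ₗ (comm ℂ B B).toLinearMap
  have hmop : ∀ w x, mop (G.t₂ w x) = G.counit x • S' w := fun w x => by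
    apply hS''
    rw [map_smul, hS', ← hS.right]
    refine forall_of_tmul (f := S ∘ₗ mop) (g := mul' ℂ B ∘ₗ S.lTensor B) (fun u v => ?_) _
    simp [mop, hS.map_mul, hS']
  let Θ : B ⊗[ℂ] (B ⊗[ℂ] A) →ₗ[ℂ] B ⊗[ℂ] A := mop.rTensor A ∘ₗ (assoc ℂ B B A).symm.toLinearMap
  have hΘ : ∀ q t, Θ (q ⊗ₜ t) = (mulRight ℂ (S' q)).rTensor A t := fun q =>
    forall_of_tmul (f := Θ ∘ₗ TensorProduct.mk ℂ B (B ⊗[ℂ] A) q) fun x y => by simp [Θ, mop]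
  have h1 : ∀ u v, Θ (cotwistOpTwice Γ a (u ⊗ₜ v)) = (mulLeft ℂ v).rTensor A
      (cotwist Γ (S'.lTensor A (comm ℂ B A (cotwistOp Γ (a ⊗ₜ u))))) := fun u v => by
    rw [cotwistOpTwice_tmul]
    refine forall_of_tmul (f := Θ ∘ₗ (cotwistOp Γ ∘ₗ (TensorProduct.mk ℂ A B).flip v).lTensor B)
      (g := (mulLeft ℂ v).rTensor A ∘ₗ cotwist Γ ∘ₗ S'.lTensor A ∘ₗ (comm ℂ B A).toLinearMap)
      (fun q x => ?_) _
    simp only [LinearMap.comp_apply, LinearMap.lTensor_tmul, hΘ, LinearEquiv.coe_coe,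
      TensorProduct.comm_tmul, cotwist_compat]
    rfl
  have h2 : ∀ s, Θ (cotwistOpTwice Γ a s) = mop s ⊗ₜ a := fun s => by
    obtain ⟨s, rfl⟩ := G.T₂.surjective s
    refine forall_of_tmul (f := Θ ∘ₗ cotwistOpTwice Γ a ∘ₗ G.T₂.toLinearMap)
      (g := (TensorProduct.mk ℂ B A).flip a ∘ₗ mop ∘ₗ G.T₂.toLinearMap)
      (fun b' b => ?_) s
    change Θ (cotwistOpTwice Γ a (G.t₂ b' b)) = mop (G.t₂ b' b) ⊗ₜ a
    rw [hΓ.cotwistOpTwice_t₂, hmop, TensorProduct.smul_tmul, ← hΓ.counit_cotwistOp]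
    refine forall_of_tmul (f := Θ ∘ₗ (assoc ℂ B B A).toLinearMap ∘ₗ (G.t₂ b').rTensor A)
      (g := TensorProduct.mk ℂ B A (S' b') ∘ₗ (lid ℂ A).toLinearMap ∘ₗ G.counit.rTensor A)
      (fun x y => ?_) _
    have h3 : ∀ s : B ⊗[ℂ] B, Θ (assoc ℂ B B A (s ⊗ₜ y)) = mop s ⊗ₜ y := fun s => by simp [Θ]
    simp only [LinearMap.comp_apply, LinearMap.rTensor_tmul, LinearEquiv.coe_coe, h3]
    rw [hmop, TensorProduct.smul_tmul]
    simp
  refine G.eq_of_mulLeft_rTensor fun v => ?_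
  rw [← h1, h2]
  simp [mop]

theorem cotwist_bijective : Function.Bijective (cotwist Γ) := by
  have hS := HB.isAntipode_antipode
  have hb := HB.antipode_bijective
  set S := HB.antipode
  let e : B ≃ₗ[ℂ] B := LinearEquiv.ofBijective S hb
  have he : ∀ x, S (e.symm x) = x := fun x => e.apply_symm_apply x
  constructor
  · have h1 : ∀ t, (cotwistOp Γ (S.lTensor A (comm ℂ B A (cotwist Γ t)))) =
        comm ℂ A B (e.toLinearMap.lTensor A t) :=
      forall_of_tmul (f := cotwistOp Γ ∘ₗ S.lTensor A ∘ₗ (comm ℂ B A).toLinearMap ∘ₗ cotwist Γ)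
        (g := (comm ℂ A B).toLinearMap ∘ₗ e.toLinearMap.lTensor A)
        fun a b => hΓ.cotwistOp_antipode hS a b
    intro t t' htt
    have h2 := h1 t
    rw [htt, h1] at h2
    exact ((e.lTensor A).injective ((comm ℂ A B).injective h2)).symm
  · intro t
    induction t using TensorProduct.induction_on with
    | zero => exact ⟨0, map_zero _⟩
    | add x y hx hy =>
      obtain ⟨x, rfl⟩ := hx
      obtain ⟨y, rfl⟩ := hy
      exact ⟨x + y, map_add _ _ _⟩
    | tmul b a =>
      have := hΓ.cotwist_antipode (S' := e.symm.toLinearMap) hS he hb.1 a (S b)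
      refine ⟨_, this.trans ?_⟩
      congr 1
      exact e.symm_apply_apply b

/-- The cotwist map as a linear equivalence. -/
noncomputable def cotwistEquiv : A ⊗[ℂ] B ≃ₗ[ℂ] B ⊗[ℂ] A :=
  LinearEquiv.ofBijective (cotwist Γ) hΓ.cotwist_bijective

end IsLeftCoaction

section Comul

variable {A : Type*} [NonUnitalNonAssocRing A] [Module ℂ A] [IsScalarTower ℂ A A]
  [SMulCommClass ℂ A A]
variable {B : Type*} [NonUnitalNonAssocRing B] [Module ℂ B] [IsScalarTower ℂ B B]
  [SMulCommClass ℂ B B]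

/-- `cotwistComul c (a ⊗ b) = ∑ c a₍₋₁₎ b₍₁₎ ⊗ a₍₀₎ ⊗ b₍₂₎`. -/
noncomputable def cotwistComul (Γ : A →ₗ[ℂ] LeftCompletion A B)
    (HB : RegularMultiplierHopfAlgebra B) (c : B) : A ⊗[ℂ] B →ₗ[ℂ] B ⊗[ℂ] (A ⊗[ℂ] B) :=
  legs₁₃ HB.canonicalPair.T₂.toLinearMap ∘ₗ
    (cotwistOp Γ ∘ₗ (TensorProduct.mk ℂ A B).flip c).rTensor B

variable {Γ : A →ₗ[ℂ] LeftCompletion A B} {HB : RegularMultiplierHopfAlgebra B}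

/-- Coassociativity of `Γ` in the form
`∑ c a₍₋₂₎ b₍₁₎ ⊗ a₍₋₁₎ b₍₂₎ ⊗ a₍₀₎ = ∑ c (a₍₋₁₎b)₍₁₎ ⊗ (a₍₋₁₎b)₍₂₎ ⊗ a₍₀₎`. -/
theorem IsLeftCoaction.cotwist_cotwistComul (hΓ : IsLeftCoaction HB Γ) (c : B) (a : A) (b : B) :
    (cotwist Γ).lTensor B (cotwistComul Γ HB c (a ⊗ₜ b)) =
      assoc ℂ B B A ((HB.canonicalPair.t₂ c).rTensor A (cotwist Γ (a ⊗ₜ b))) := by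
  set G := HB.canonicalPair
  -- `(q ⊗ x) ⊗ (u ⊗ v) ↦ qu ⊗ x ⊗ v`
  let J : (B ⊗[ℂ] A) ⊗[ℂ] (B ⊗[ℂ] B) →ₗ[ℂ] B ⊗[ℂ] (A ⊗[ℂ] B) := (mul' ℂ B).rTensor _ ∘ₗ
    (TensorProduct.tensorTensorTensorComm ℂ B A B B).toLinearMap
  refine G.eq_of_mulRight_rTensor fun b' => ?_
  have h1 : ∀ t : B ⊗[ℂ] A, (mulRight ℂ b').rTensor _ (legs₁₃ G.T₂.toLinearMap (t ⊗ₜ b)) =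
      J (t ⊗ₜ HB.t₃ b' b) := by
    refine forall_of_tmul (f := (mulRight ℂ b').rTensor _ ∘ₗ legs₁₃ G.T₂.toLinearMap ∘ₗ
      (TensorProduct.mk ℂ (B ⊗[ℂ] A) B).flip b)
      (g := J ∘ₗ (TensorProduct.mk ℂ (B ⊗[ℂ] A) (B ⊗[ℂ] B)).flip (HB.t₃ b' b)) fun q x => ?_
    simp only [LinearMap.comp_apply, LinearMap.flip_apply, TensorProduct.mk_apply, legs₁₃_tmul]
    change (mulRight ℂ b').rTensor _ ((TensorProduct.mk ℂ A B x).lTensor B (G.t₂ q b)) = _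
    rw [rTensor_lTensor, ← HB.t₃_mulLeft_rTensor]
    exact forall_of_tmul (f := (TensorProduct.mk ℂ A B x).lTensor B ∘ₗ (mulLeft ℂ q).rTensor B)
      (g := J ∘ₗ TensorProduct.mk ℂ (B ⊗[ℂ] A) (B ⊗[ℂ] B) (q ⊗ₜ x)) (fun u v => by simp [J]) _
  have h2 : ∀ s, (cotwist Γ).lTensor B (J (cotwistOp Γ (a ⊗ₜ c) ⊗ₜ s)) =
      (mulLeft ℂ c).rTensor _ (cotwistTwice Γ a s) := by
    refine forall_of_tmul (f := (cotwist Γ).lTensor B ∘ₗ J ∘ₗ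
      TensorProduct.mk ℂ (B ⊗[ℂ] A) (B ⊗[ℂ] B) (cotwistOp Γ (a ⊗ₜ c)))
      (g := (mulLeft ℂ c).rTensor _ ∘ₗ cotwistTwice Γ a) fun u v => ?_
    simp only [LinearMap.comp_apply, cotwistTwice_tmul, TensorProduct.mk_apply]
    rw [rTensor_lTensor, cotwist_compat]
    exact forall_of_tmul (f := (cotwist Γ).lTensor B ∘ₗ J ∘ₗ
      (TensorProduct.mk ℂ (B ⊗[ℂ] A) (B ⊗[ℂ] B)).flip (u ⊗ₜ v))
      (g := (cotwist Γ ∘ₗ (TensorProduct.mk ℂ A B).flip v).lTensor B ∘ₗ (mulRight ℂ u).rTensor A)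
      (fun x y => by simp [J]) _
  have h3 : (mulLeft ℂ c).rTensor B ∘ₗ HB.t₃ b' = (mulRight ℂ b').rTensor B ∘ₗ G.t₂ c :=
    LinearMap.ext fun x => HB.t₃_mulLeft_rTensor b' c x
  rw [rTensor_lTensor]
  change (cotwist Γ).lTensor B ((mulRight ℂ b').rTensor _
    (legs₁₃ G.T₂.toLinearMap (cotwistOp Γ (a ⊗ₜ c) ⊗ₜ b))) = _
  rw [h1, h2, hΓ.cotwistTwice_t₃, ← assoc_rTensor_rTensor, ← LinearMap.rTensor_comp_apply, h3,
    LinearMap.rTensor_comp_apply, assoc_rTensor_rTensor]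

end Comul

/-! ### Modules and the maps `a ⊗ m ↦ ∑ a₍₁₎ ⊗ a₍₂₎m` -/

section Module

variable {A : Type*} [NonUnitalNonAssocRing A] [Module ℂ A] [IsScalarTower ℂ A A]
  [SMulCommClass ℂ A A]
variable {M N : Type*} [AddCommGroup M] [AddCommGroup N] [Module ℂ M] [Module ℂ N]
variable (ψ : A ⊗[ℂ] N ≃ₗ[ℂ] M)

/-- The left action of `A` on a space `M` identified with the free module `A ⊗ N`. -/
noncomputable def freeAct : A →ₗ[ℂ] M →ₗ[ℂ] M :=
  ((LinearMap.rTensorHom N ∘ₗ LinearMap.mul ℂ A).compl₂ ψ.symm.toLinearMap).compr₂ ψ.toLinearMap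

theorem freeAct_apply (a : A) (m : M) :
    freeAct ψ a m = ψ ((mulLeft ℂ a).rTensor N (ψ.symm m)) := rfl

theorem freeAct_tmul (a x : A) (n : N) : freeAct ψ a (ψ (x ⊗ₜ n)) = ψ ((a * x) ⊗ₜ n) := by
  rw [freeAct_apply, LinearEquiv.symm_apply_apply, LinearMap.rTensor_tmul, LinearMap.mulLeft_apply]

/-- Linear maps out of `M ≅ X ⊗ Y` that agree on the images of pure tensors agree. -/
theorem forall_of_equiv {X Y V : Type*} [AddCommGroup X] [Module ℂ X] [AddCommGroup Y] [Module ℂ Y]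
    [AddCommGroup V] [Module ℂ V] (ψ : X ⊗[ℂ] Y ≃ₗ[ℂ] M) {f g : M →ₗ[ℂ] V}
    (h : ∀ x y, f (ψ (x ⊗ₜ y)) = g (ψ (x ⊗ₜ y))) (m : M) : f m = g m := by
  obtain ⟨t, rfl⟩ := ψ.surjective m
  exact forall_of_tmul (f := f ∘ₗ ψ.toLinearMap) (g := g ∘ₗ ψ.toLinearMap) h t

namespace CanonicalPair

variable (G : CanonicalPair A)

/-- The bijection `a ⊗ m ↦ ∑ a₍₁₎ ⊗ a₍₂₎m` of `A ⊗ M`, for a free left `A`-module `M`. -/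
noncomputable def freeT₁ : A ⊗[ℂ] M ≃ₗ[ℂ] A ⊗[ℂ] M :=
  TensorProduct.congr (LinearEquiv.refl ℂ A) ψ.symm ≪≫ₗ (assoc ℂ A A N).symm ≪≫ₗ
    TensorProduct.congr G.T₁ (LinearEquiv.refl ℂ N) ≪≫ₗ assoc ℂ A A N ≪≫ₗ
      TensorProduct.congr (LinearEquiv.refl ℂ A) ψ

theorem freeT₁_tmul (a x : A) (n : N) : G.freeT₁ ψ (a ⊗ₜ ψ (x ⊗ₜ n)) =
    (ψ.toLinearMap ∘ₗ (TensorProduct.mk ℂ A N).flip n).lTensor A (G.t₁ x a) := by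
  simp only [freeT₁, LinearEquiv.trans_apply, TensorProduct.congr_tmul, LinearEquiv.refl_apply,
    LinearEquiv.symm_apply_apply, TensorProduct.assoc_symm_tmul, ← t₁_apply]
  exact forall_of_tmul (f := (TensorProduct.congr (LinearEquiv.refl ℂ A) ψ).toLinearMap ∘ₗ
    (assoc ℂ A A N).toLinearMap ∘ₗ (TensorProduct.mk ℂ (A ⊗[ℂ] A) N).flip n)
    (g := (ψ.toLinearMap ∘ₗ (TensorProduct.mk ℂ A N).flip n).lTensor A) (fun x y => by simp) _

/-- `(w ⊗ 1)Δ(a)(1 ⊗ m)`, computed in two ways. -/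
theorem freeT₁_cover (w a : A) (m : M) : (mulLeft ℂ w).rTensor M (G.freeT₁ ψ (a ⊗ₜ m)) =
    ((freeAct ψ).flip m).lTensor A (G.t₂ w a) := by
  refine forall_of_equiv ψ (f := (mulLeft ℂ w).rTensor M ∘ₗ (G.freeT₁ ψ).toLinearMap ∘ₗ
    TensorProduct.mk ℂ A M a) (g := (LinearMap.lTensorHom A ∘ₗ (freeAct ψ).flip).flip (G.t₂ w a))
    (fun x n => ?_) m
  change (mulLeft ℂ w).rTensor M (G.freeT₁ ψ (a ⊗ₜ ψ (x ⊗ₜ n))) =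
    ((freeAct ψ).flip (ψ (x ⊗ₜ n))).lTensor A (G.t₂ w a)
  rw [freeT₁_tmul, rTensor_lTensor, t_compat, ← LinearMap.lTensor_comp_apply]
  congr 2
  ext y
  simp [freeAct_tmul]

theorem counit_freeT₁ (a : A) (m : M) :
    lid ℂ M (G.counit.rTensor M (G.freeT₁ ψ (a ⊗ₜ m))) = freeAct ψ a m := by
  refine forall_of_equiv ψ (f := (lid ℂ M).toLinearMap ∘ₗ G.counit.rTensor M ∘ₗ
    (G.freeT₁ ψ).toLinearMap ∘ₗ TensorProduct.mk ℂ A M a) (g := freeAct ψ a)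
    (fun x n => ?_) m
  simp only [LinearMap.comp_apply, LinearEquiv.coe_coe, TensorProduct.mk_apply]
  rw [freeT₁_tmul, freeAct_tmul, ← G.counit_left]
  exact forall_of_tmul (f := (lid ℂ M).toLinearMap ∘ₗ G.counit.rTensor M ∘ₗ
    (ψ.toLinearMap ∘ₗ (TensorProduct.mk ℂ A N).flip n).lTensor A)
    (g := ψ.toLinearMap ∘ₗ (TensorProduct.mk ℂ A N).flip n ∘ₗ (lid ℂ A).toLinearMap ∘ₗ
      G.counit.rTensor A) (fun x y => by simp) _

/-- `∑ S(a₍₁₎)a₍₂₎m = ε(a)m`. -/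
theorem antipode_freeT₁ {S : A →ₗ[ℂ] A} (hS : G.IsAntipode S) (a : A) (m : M) :
    lift (freeAct ψ) (S.rTensor M (G.freeT₁ ψ (a ⊗ₜ m))) = G.counit a • m := by
  refine forall_of_equiv ψ (f := lift (freeAct ψ) ∘ₗ S.rTensor M ∘ₗ
    (G.freeT₁ ψ).toLinearMap ∘ₗ TensorProduct.mk ℂ A M a) (g := G.counit a • LinearMap.id)
    (fun x n => ?_) m
  simp only [LinearMap.comp_apply, LinearEquiv.coe_coe, TensorProduct.mk_apply,
    LinearMap.smul_apply, LinearMap.id_apply]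
  rw [freeT₁_tmul, ← map_smul, TensorProduct.smul_tmul', ← hS.left]
  exact forall_of_tmul (f := lift (freeAct ψ) ∘ₗ S.rTensor M ∘ₗ
    (ψ.toLinearMap ∘ₗ (TensorProduct.mk ℂ A N).flip n).lTensor A)
    (g := ψ.toLinearMap ∘ₗ (TensorProduct.mk ℂ A N).flip n ∘ₗ mul' ℂ A ∘ₗ S.rTensor A)
    (fun x y => by simp [freeAct_tmul]) _

theorem freeT₁_freeAct (a a' : A) (m : M) : G.freeT₁ ψ (a ⊗ₜ freeAct ψ a' m) =
    ((freeAct ψ).flip m).lTensor A (G.t₁ a' a) := by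
  refine forall_of_equiv ψ (f := (G.freeT₁ ψ).toLinearMap ∘ₗ TensorProduct.mk ℂ A M a ∘ₗ
    freeAct ψ a') (g := (LinearMap.lTensorHom A ∘ₗ (freeAct ψ).flip).flip (G.t₁ a' a))
    (fun x n => ?_) m
  change G.freeT₁ ψ (a ⊗ₜ freeAct ψ a' (ψ (x ⊗ₜ n))) =
    ((freeAct ψ).flip (ψ (x ⊗ₜ n))).lTensor A (G.t₁ a' a)
  rw [freeAct_tmul, freeT₁_tmul, t₁_mul_right, ← LinearMap.lTensor_comp_apply]
  congr 2
  ext y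
  simp [freeAct_tmul]

theorem assoc_t₂_freeT₁ (w a : A) (m : M) :
    assoc ℂ A A M ((G.t₂ w).rTensor M (G.freeT₁ ψ (a ⊗ₜ m))) =
      ((G.freeT₁ ψ).toLinearMap ∘ₗ (TensorProduct.mk ℂ A M).flip m).lTensor A (G.t₂ w a) :=
  G.assoc_t₂_rTensor (F := (G.freeT₁ ψ).toLinearMap ∘ₗ (TensorProduct.mk ℂ A M).flip m)
    (fun c a => G.freeT₁_cover ψ c a m) w a

end CanonicalPair

end Module

/-! ### The map `a ⊗ b ⊗ m ↦ ∑ a₍₁₎ ⊗ Γ(a₍₂₎)(b ⊗ m)` -/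

section ComoduleCoalgebra

variable {A : Type*} [NonUnitalNonAssocRing A] [Module ℂ A] [IsScalarTower ℂ A A]
  [SMulCommClass ℂ A A]
variable {B : Type*} [NonUnitalNonAssocRing B] [Module ℂ B] [IsScalarTower ℂ B B]
  [SMulCommClass ℂ B B]
variable {M N : Type*} [AddCommGroup M] [AddCommGroup N] [Module ℂ M] [Module ℂ N]
variable {Γ : A →ₗ[ℂ] LeftCompletion A B} {HA : RegularMultiplierHopfAlgebra A}
  {HB : RegularMultiplierHopfAlgebra B}

/-- The map `a ↦ Γ(a)(b ⊗ m)`. -/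
noncomputable def coact (Γ : A →ₗ[ℂ] LeftCompletion A B)
    (ψ : A ⊗[ℂ] N ≃ₗ[ℂ] M) (b : B) (m : M) : A →ₗ[ℂ] B ⊗[ℂ] M :=
  ((freeAct ψ).flip m).lTensor B ∘ₗ cotwist Γ ∘ₗ (TensorProduct.mk ℂ A B).flip b

theorem coact_apply (ψ : A ⊗[ℂ] N ≃ₗ[ℂ] M) (a : A) (b : B) (m : M) :
    coact Γ ψ b m a = ((freeAct ψ).flip m).lTensor B (cotwist Γ (a ⊗ₜ b)) := rfl

/-- `T` on the first two legs of `A ⊗ B ⊗ M`. -/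
noncomputable def IsLeftCoaction.cotwist₁₂ (hΓ : IsLeftCoaction HB Γ) (M : Type*) [AddCommGroup M]
    [Module ℂ M] : A ⊗[ℂ] (B ⊗[ℂ] M) ≃ₗ[ℂ] B ⊗[ℂ] (A ⊗[ℂ] M) :=
  (assoc ℂ A B M).symm ≪≫ₗ TensorProduct.congr hΓ.cotwistEquiv (LinearEquiv.refl ℂ M) ≪≫ₗ
    assoc ℂ B A M

theorem IsLeftCoaction.cotwist₁₂_tmul (hΓ : IsLeftCoaction HB Γ) (a : A) (b : B) (m : M) :
    hΓ.cotwist₁₂ M (a ⊗ₜ (b ⊗ₜ m)) = assoc ℂ B A M (cotwist Γ (a ⊗ₜ b) ⊗ₜ m) := rfl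

namespace IsLeftComoduleCoalgebra

variable (hΓ : IsLeftComoduleCoalgebra HA HB Γ) (ψ : A ⊗[ℂ] N ≃ₗ[ℂ] M)

/-- The bijection `a ⊗ b ⊗ m ↦ ∑ a₍₁₎ ⊗ Γ(a₍₂₎)(b ⊗ m)` of `A ⊗ B ⊗ M`, for a free left `A`-module
`M`. As `A` is a comodule coalgebra, it is conjugate by `T` to `a ⊗ m ↦ ∑ a₍₁₎ ⊗ a₍₂₎m` on the
last two legs. -/
noncomputable def comulCoact : A ⊗[ℂ] (B ⊗[ℂ] M) ≃ₗ[ℂ] A ⊗[ℂ] (B ⊗[ℂ] M) :=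
  hΓ.cotwist₁₂ M ≪≫ₗ
    TensorProduct.congr (LinearEquiv.refl ℂ B) (HA.canonicalPair.freeT₁ ψ) ≪≫ₗ
      (hΓ.cotwist₁₂ M).symm

theorem cotwist₁₂_comulCoact (t : A ⊗[ℂ] (B ⊗[ℂ] M)) : hΓ.cotwist₁₂ M (hΓ.comulCoact ψ t) =
    (HA.canonicalPair.freeT₁ ψ).toLinearMap.lTensor B (hΓ.cotwist₁₂ M t) := by
  simp only [comulCoact, LinearEquiv.trans_apply, LinearEquiv.apply_symm_apply]
  rfl

include hΓ in
theorem cotwist₁₂_lTensor_lTensor {M' : Type*} [AddCommGroup M'] [Module ℂ M'] (f : M →ₗ[ℂ] M')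
    (t : A ⊗[ℂ] (B ⊗[ℂ] M)) : hΓ.cotwist₁₂ M' ((f.lTensor B).lTensor A t) =
      (f.lTensor A).lTensor B (hΓ.cotwist₁₂ M t) := by
  obtain ⟨t, rfl⟩ := (assoc ℂ A B M).surjective t
  refine forall_of_tmul (f := (hΓ.cotwist₁₂ M').toLinearMap ∘ₗ (f.lTensor B).lTensor A ∘ₗ
    (assoc ℂ A B M).toLinearMap) (g := (f.lTensor A).lTensor B ∘ₗ (hΓ.cotwist₁₂ M).toLinearMap ∘ₗ
      (assoc ℂ A B M).toLinearMap) (fun s m => ?_) t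
  refine forall_of_tmul (f := (hΓ.cotwist₁₂ M').toLinearMap ∘ₗ (f.lTensor B).lTensor A ∘ₗ
    (assoc ℂ A B M).toLinearMap ∘ₗ (TensorProduct.mk ℂ (A ⊗[ℂ] B) M).flip m)
    (g := (f.lTensor A).lTensor B ∘ₗ (hΓ.cotwist₁₂ M).toLinearMap ∘ₗ
      (assoc ℂ A B M).toLinearMap ∘ₗ (TensorProduct.mk ℂ (A ⊗[ℂ] B) M).flip m) (fun a b => ?_) s
  simp only [LinearMap.comp_apply, LinearMap.flip_apply, TensorProduct.mk_apply,
    LinearEquiv.coe_coe, TensorProduct.assoc_tmul, LinearMap.lTensor_tmul,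
    IsLeftCoaction.cotwist₁₂_tmul]
  rw [← assoc_lTensor, LinearMap.lTensor_tmul]

/-- `(c ⊗ 1)Δ(a)` applied to the coaction. -/
theorem comulCoact_cover (c a : A) (b : B) (m : M) :
    (mulLeft ℂ c).rTensor _ (hΓ.comulCoact ψ (a ⊗ₜ (b ⊗ₜ m))) =
      (coact Γ ψ b m).lTensor A (HA.canonicalPair.t₂ c a) := by
  set G := HA.canonicalPair
  refine forall_of_equiv ψ (f := (mulLeft ℂ c).rTensor _ ∘ₗ
    (hΓ.comulCoact ψ).toLinearMap ∘ₗ TensorProduct.mk ℂ A (B ⊗[ℂ] M) a ∘ₗ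
      TensorProduct.mk ℂ B M b)
    (g := (LinearMap.lTensorHom A ∘ₗ LinearMap.lTensorHom B ∘ₗ (freeAct ψ).flip).flip
      ((cotwist Γ ∘ₗ (TensorProduct.mk ℂ A B).flip b).lTensor A (G.t₂ c a)))
    (fun x n => ?_) m |>.trans ?_
  swap
  · change ((((freeAct ψ).flip m).lTensor B).lTensor A) _ = _
    rw [← LinearMap.lTensor_comp_apply]
    rfl
  obtain ⟨y, hy1, hy2⟩ := hΓ.comul_cotwist_right a b x
  set ψn := ψ.toLinearMap ∘ₗ (TensorProduct.mk ℂ A N).flip n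
  have h1 : hΓ.comulCoact ψ (a ⊗ₜ (b ⊗ₜ ψ (x ⊗ₜ n))) = (ψn.lTensor B).lTensor A y := by
    apply (hΓ.cotwist₁₂ M).injective
    rw [cotwist₁₂_comulCoact, IsLeftCoaction.cotwist₁₂_tmul, lTensor_assoc_tmul,
      hΓ.cotwist₁₂_lTensor_lTensor]
    have h2 : hΓ.cotwist₁₂ A y = _ := hy2
    rw [h2, ← LinearMap.lTensor_comp_apply]
    congr 2
    ext z
    exact G.freeT₁_tmul ψ z x n
  change (mulLeft ℂ c).rTensor _ (hΓ.comulCoact ψ (a ⊗ₜ (b ⊗ₜ ψ (x ⊗ₜ n)))) =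
    (((freeAct ψ).flip (ψ (x ⊗ₜ n))).lTensor B).lTensor A _
  rw [h1, rTensor_lTensor, hy1, lTensor_assoc_tmul, ← LinearMap.lTensor_comp_apply,
    ← LinearMap.lTensor_comp]
  congr 3
  ext z
  simp [ψn, freeAct_tmul]

theorem counit_comulCoact (a : A) (b : B) (m : M) :
    lid ℂ _ (HA.canonicalPair.counit.rTensor _ (hΓ.comulCoact ψ (a ⊗ₜ (b ⊗ₜ m)))) =
      coact Γ ψ b m a := by
  set G := HA.canonicalPair
  by_cases ha : a = 0
  · simp [ha]
  obtain ⟨c, hc⟩ := G.exists_counit_eq_one ha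
  have h1 : ∀ t : A ⊗[ℂ] (B ⊗[ℂ] M), lid ℂ _ (G.counit.rTensor _ ((mulLeft ℂ c).rTensor _ t)) =
      lid ℂ _ (G.counit.rTensor _ t) :=
    forall_of_tmul (f := (lid ℂ _).toLinearMap ∘ₗ G.counit.rTensor _ ∘ₗ (mulLeft ℂ c).rTensor _)
      (g := (lid ℂ _).toLinearMap ∘ₗ G.counit.rTensor _) fun x y => by simp [G.counit_mul, hc]
  have h2 : ∀ t : A ⊗[ℂ] A, lid ℂ _ (G.counit.rTensor _ ((coact Γ ψ b m).lTensor A t)) =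
      coact Γ ψ b m (lid ℂ A (G.counit.rTensor A t)) :=
    forall_of_tmul (f := (lid ℂ _).toLinearMap ∘ₗ G.counit.rTensor _ ∘ₗ (coact Γ ψ b m).lTensor A)
      (g := coact Γ ψ b m ∘ₗ (lid ℂ A).toLinearMap ∘ₗ G.counit.rTensor A) fun x y => by simp
  rw [← h1, hΓ.comulCoact_cover, h2, G.counit_rTensor_t₂, hc, one_smul]

include hΓ in
/-- `(ι ⊗ ε)(Γ(a)(b ⊗ 1)) = ε(a)b`. -/
theorem counit_lTensor_cotwist (a : A) (b : B) :
    rid ℂ B (HA.canonicalPair.counit.lTensor B (cotwist Γ (a ⊗ₜ b))) =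
      HA.canonicalPair.counit a • b := by
  set G := HA.canonicalPair
  by_cases ha : a = 0
  · simp [ha]
  obtain ⟨m, hm⟩ := G.exists_counit_eq_one ha
  let ψ : A ⊗[ℂ] ℂ ≃ₗ[ℂ] A := rid ℂ A
  let Λ : A ⊗[ℂ] (B ⊗[ℂ] A) →ₗ[ℂ] B ⊗[ℂ] A :=
    ((lid ℂ A).toLinearMap ∘ₗ G.counit.rTensor A).lTensor B ∘ₗ (hΓ.cotwist₁₂ A).toLinearMap
  have h1 : ∀ u, Λ (hΓ.comulCoact ψ u) = lid ℂ _ (G.counit.rTensor _ (hΓ.comulCoact ψ u)) :=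
      fun u => by
    refine forall_of_tmul (f := Λ ∘ₗ (hΓ.comulCoact ψ).toLinearMap)
      (g := (lid ℂ _).toLinearMap ∘ₗ G.counit.rTensor _ ∘ₗ (hΓ.comulCoact ψ).toLinearMap)
      (fun a t => ?_) u
    refine forall_of_tmul (f := Λ ∘ₗ (hΓ.comulCoact ψ).toLinearMap ∘ₗ TensorProduct.mk ℂ A _ a)
      (g := (lid ℂ _).toLinearMap ∘ₗ G.counit.rTensor _ ∘ₗ (hΓ.comulCoact ψ).toLinearMap ∘ₗ
        TensorProduct.mk ℂ A _ a) (fun b m => ?_) t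
    simp only [LinearMap.comp_apply, TensorProduct.mk_apply, LinearEquiv.coe_coe, Λ]
    rw [hΓ.counit_comulCoact, hΓ.cotwist₁₂_comulCoact, IsLeftCoaction.cotwist₁₂_tmul,
      lTensor_assoc_tmul, ← LinearMap.lTensor_comp_apply, coact_apply]
    congr 2
    ext z
    exact G.counit_freeT₁ ψ z m
  have h2 := h1 ((hΓ.comulCoact ψ).symm (a ⊗ₜ (b ⊗ₜ m)))
  rw [LinearEquiv.apply_symm_apply] at h2
  simp only [Λ, LinearMap.comp_apply, LinearEquiv.coe_coe, IsLeftCoaction.cotwist₁₂_tmul,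
    lTensor_assoc_tmul, LinearMap.rTensor_tmul, TensorProduct.lid_tmul] at h2
  have h3 := congrArg (fun t => rid ℂ B (G.counit.lTensor B t)) h2
  simp only [map_smul, LinearMap.lTensor_tmul, hm, TensorProduct.rid_tmul, one_smul] at h3
  rw [← h3]
  exact forall_of_tmul (f := (rid ℂ B).toLinearMap ∘ₗ G.counit.lTensor B)
    (g := (rid ℂ B).toLinearMap ∘ₗ G.counit.lTensor B ∘ₗ
      (((lid ℂ A).toLinearMap ∘ₗ G.counit.rTensor A) ∘ₗ
        (TensorProduct.mk ℂ A A).flip m).lTensor B) (fun x y => by simp [hm]) _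

end IsLeftComoduleCoalgebra

end ComoduleCoalgebra

/-! ### The smash product algebra -/

section RightModule

variable {A : Type*} [NonUnitalNonAssocRing A] [Module ℂ A] [IsScalarTower ℂ A A]
  [SMulCommClass ℂ A A]
variable {M N : Type*} [AddCommGroup M] [AddCommGroup N] [Module ℂ M] [Module ℂ N]
variable (ψ : N ⊗[ℂ] A ≃ₗ[ℂ] M)

/-- The right action of `A` on a space `M` identified with the free right module `N ⊗ A`. -/
noncomputable def freeActRight : A →ₗ[ℂ] M →ₗ[ℂ] M :=
  ((LinearMap.lTensorHom N ∘ₗ (LinearMap.mul ℂ A).flip).compl₂ ψ.symm.toLinearMap).compr₂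
    ψ.toLinearMap

theorem freeActRight_apply (a : A) (m : M) :
    freeActRight ψ a m = ψ ((mulRight ℂ a).lTensor N (ψ.symm m)) := rfl

theorem freeActRight_apply_equiv (a : A) (t : N ⊗[ℂ] A) :
    freeActRight ψ a (ψ t) = ψ ((mulRight ℂ a).lTensor N t) := by
  rw [freeActRight_apply, LinearEquiv.symm_apply_apply]

theorem freeActRight_tmul (a x : A) (n : N) :
    freeActRight ψ a (ψ (n ⊗ₜ x)) = ψ (n ⊗ₜ (x * a)) := by
  rw [freeActRight_apply_equiv, LinearMap.lTensor_tmul, LinearMap.mulRight_apply]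

theorem freeAct_apply_equiv (ψ : A ⊗[ℂ] N ≃ₗ[ℂ] M) (a : A) (t : A ⊗[ℂ] N) :
    freeAct ψ a (ψ t) = ψ ((mulLeft ℂ a).rTensor N t) := by
  rw [freeAct_apply, LinearEquiv.symm_apply_apply]

theorem CanonicalPair.freeAct_mul (G : CanonicalPair A) (ψ : A ⊗[ℂ] N ≃ₗ[ℂ] M) (a a' : A) (m : M) :
    freeAct ψ (a * a') m = freeAct ψ a (freeAct ψ a' m) := by
  simp only [freeAct_apply, LinearEquiv.symm_apply_apply, G.mulLeft_mul,
    LinearMap.rTensor_comp_apply]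

theorem CanonicalPair.freeActRight_mul (G : CanonicalPair A) (a a' : A) (m : M) :
    freeActRight ψ (a * a') m = freeActRight ψ a' (freeActRight ψ a m) := by
  simp only [freeActRight_apply, LinearEquiv.symm_apply_apply, G.mulRight_mul,
    LinearMap.lTensor_comp_apply]

theorem CanonicalPair.eq_zero_of_freeAct (G : CanonicalPair A) (ψ : A ⊗[ℂ] N ≃ₗ[ℂ] M) (m : M)
    (h : ∀ a, freeAct ψ a m = 0) : m = 0 := by
  obtain ⟨t, rfl⟩ := ψ.surjective m
  rw [G.eq_of_mulLeft_rTensor (u := t) (v := 0) fun d => ?_, map_zero]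
  apply ψ.injective
  rw [map_zero, map_zero, ← freeAct_apply_equiv, h]

theorem CanonicalPair.eq_zero_of_freeActRight (G : CanonicalPair A) (m : M)
    (h : ∀ a, freeActRight ψ a m = 0) : m = 0 := by
  obtain ⟨t, rfl⟩ := ψ.surjective m
  rw [G.eq_of_mulRight_lTensor (u := t) (v := 0) fun d => ?_, map_zero]
  apply ψ.injective
  rw [map_zero, map_zero, ← freeActRight_apply_equiv, h]

end RightModule

section SmashAlgebra

variable {A : Type*} [NonUnitalNonAssocRing A] [Module ℂ A] [IsScalarTower ℂ A A]
  [SMulCommClass ℂ A A]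
variable {B : Type*} [NonUnitalNonAssocRing B] [Module ℂ B] [IsScalarTower ℂ B B]
  [SMulCommClass ℂ B B]

/-- The identification of `A ⊗ B` with `AB`. -/
noncomputable abbrev smashEquiv (HA : RegularMultiplierHopfAlgebra A) (act : B →ₗ[ℂ] A →ₗ[ℂ] B) :
    A ⊗[ℂ] B ≃ₗ[ℂ] SmashProduct HA act := Smash.ofTensor HA.toMultiplierHopfAlgebra act

/-- Left multiplication by elements of `A` on `AB`. -/
noncomputable def lA (HA : RegularMultiplierHopfAlgebra A)
    (act : B →ₗ[ℂ] A →ₗ[ℂ] B) : A →ₗ[ℂ] SmashProduct HA act →ₗ[ℂ] SmashProduct HA act :=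
  freeAct (smashEquiv HA act)

/-- Right multiplication by elements of `B` on `AB`. -/
noncomputable def rB (HA : RegularMultiplierHopfAlgebra A)
    (act : B →ₗ[ℂ] A →ₗ[ℂ] B) : B →ₗ[ℂ] SmashProduct HA act →ₗ[ℂ] SmashProduct HA act :=
  freeActRight (smashEquiv HA act)

variable {HA : RegularMultiplierHopfAlgebra A} {act : B →ₗ[ℂ] A →ₗ[ℂ] B}

theorem lA_tmul (a α : A) (β : B) :
    lA HA act a (smashEquiv HA act (α ⊗ₜ β)) = smashEquiv HA act ((a * α) ⊗ₜ β) :=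
  freeAct_tmul _ _ _ _

theorem rB_tmul (α : A) (β b : B) :
    rB HA act b (smashEquiv HA act (α ⊗ₜ β)) = smashEquiv HA act (α ⊗ₜ (β * b)) :=
  freeActRight_tmul _ _ _ _

theorem lA_rB (a : A) (b : B) (x : SmashProduct HA act) :
    lA HA act a (rB HA act b x) = rB HA act b (lA HA act a x) :=
  forall_of_equiv (smashEquiv HA act) (f := lA HA act a ∘ₗ rB HA act b)
    (g := rB HA act b ∘ₗ lA HA act a) (fun α β => by simp [rB_tmul, lA_tmul]) x

namespace IsRightModuleAlgebra

variable (hact : IsRightModuleAlgebra HA.toMultiplierHopfAlgebra act)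

/-- The identification of `B ⊗ A` with `AB`, `b ⊗ a ↦ ba = R(b ⊗ a)`. -/
noncomputable def smashEquiv' : B ⊗[ℂ] A ≃ₗ[ℂ] SmashProduct HA act :=
  LinearEquiv.ofBijective (twist HA.toMultiplierHopfAlgebra act) hact.twist_bijective ≪≫ₗ
    smashEquiv HA act

theorem smashEquiv'_apply (t : B ⊗[ℂ] A) : hact.smashEquiv' t =
    smashEquiv HA act (twist HA.toMultiplierHopfAlgebra act t) := rfl

/-- Left multiplication by elements of `B` on `AB`. -/
noncomputable def lB : B →ₗ[ℂ] SmashProduct HA act →ₗ[ℂ] SmashProduct HA act :=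
  freeAct hact.smashEquiv'

/-- Right multiplication by elements of `A` on `AB`. -/
noncomputable def rA : A →ₗ[ℂ] SmashProduct HA act →ₗ[ℂ] SmashProduct HA act :=
  freeActRight hact.smashEquiv'

theorem lB_smashEquiv'_tmul (b β : B) (α : A) :
    hact.lB b (hact.smashEquiv' (β ⊗ₜ α)) = hact.smashEquiv' ((b * β) ⊗ₜ α) :=
  freeAct_tmul _ _ _ _

theorem rA_smashEquiv'_tmul (β : B) (α a : A) :
    hact.rA a (hact.smashEquiv' (β ⊗ₜ α)) = hact.smashEquiv' (β ⊗ₜ (α * a)) :=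
  freeActRight_tmul _ _ _ _

theorem lB_tmul (b β : B) (α : A) : hact.lB b (smashEquiv HA act (α ⊗ₜ β)) =
    rB HA act β (hact.smashEquiv' (b ⊗ₜ α)) := by
  have h : ∀ s, hact.lB b (smashEquiv HA act s) = smashEquiv HA act
      (contractRight (twist HA.toMultiplierHopfAlgebra act ∘ₗ TensorProduct.mk ℂ B A b)
        (LinearMap.mul ℂ B) s) := fun s => by
    obtain ⟨s, rfl⟩ := hact.twist_surjective s
    refine forall_of_tmul (f := hact.lB b ∘ₗ hact.smashEquiv'.toLinearMap)
      (g := (smashEquiv HA act).toLinearMap ∘ₗ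
        contractRight (twist HA.toMultiplierHopfAlgebra act ∘ₗ TensorProduct.mk ℂ B A b)
        (LinearMap.mul ℂ B) ∘ₗ twist HA.toMultiplierHopfAlgebra act) (fun b' a => ?_) s
    simp only [LinearMap.comp_apply, LinearEquiv.coe_coe, lB_smashEquiv'_tmul]
    rw [← hact.twist_mul_left]
    rfl
  rw [h, contractRight_tmul, rB, smashEquiv'_apply, freeActRight_apply_equiv]
  rfl

theorem rA_tmul (α a : A) (β : B) : hact.rA a (smashEquiv HA act (α ⊗ₜ β)) =
    lA HA act α (hact.smashEquiv' (β ⊗ₜ a)) := by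
  have h : ∀ s, hact.rA a (smashEquiv HA act s) = smashEquiv HA act
      (contractLeft (twist HA.toMultiplierHopfAlgebra act ∘ₗ (TensorProduct.mk ℂ B A).flip a)
        (LinearMap.mul ℂ A) s) := fun s => by
    obtain ⟨s, rfl⟩ := hact.twist_surjective s
    refine forall_of_tmul (f := hact.rA a ∘ₗ hact.smashEquiv'.toLinearMap)
      (g := (smashEquiv HA act).toLinearMap ∘ₗ
        contractLeft (twist HA.toMultiplierHopfAlgebra act ∘ₗ (TensorProduct.mk ℂ B A).flip a)
        (LinearMap.mul ℂ A) ∘ₗ twist HA.toMultiplierHopfAlgebra act) (fun b' a => ?_) s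
    simp only [LinearMap.comp_apply, LinearEquiv.coe_coe, rA_smashEquiv'_tmul]
    rw [← hact.twist_mul_right]
    rfl
  rw [h, contractLeft_tmul, lA, smashEquiv'_apply, freeAct_apply_equiv]
  rfl

theorem lB_rA (b : B) (a : A) (x : SmashProduct HA act) :
    hact.lB b (hact.rA a x) = hact.rA a (hact.lB b x) :=
  forall_of_equiv hact.smashEquiv' (f := hact.lB b ∘ₗ hact.rA a)
    (g := hact.rA a ∘ₗ hact.lB b)
    (fun β α => by simp [lB_smashEquiv'_tmul, rA_smashEquiv'_tmul]) x

theorem lB_rB (GB : CanonicalPair B) (b b' : B) (x : SmashProduct HA act) :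
    hact.lB b (rB HA act b' x) = rB HA act b' (hact.lB b x) :=
  forall_of_equiv (smashEquiv HA act) (f := hact.lB b ∘ₗ rB HA act b')
    (g := rB HA act b' ∘ₗ hact.lB b) (fun α β => by
      simp only [LinearMap.comp_apply, rB_tmul, lB_tmul]
      exact GB.freeActRight_mul _ _ _ _) x

theorem lA_rA (a a' : A) (x : SmashProduct HA act) :
    lA HA act a (hact.rA a' x) = hact.rA a' (lA HA act a x) :=
  forall_of_equiv (smashEquiv HA act) (f := lA HA act a ∘ₗ hact.rA a')
    (g := hact.rA a' ∘ₗ lA HA act a) (fun α β => by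
      simp only [LinearMap.comp_apply, lA_tmul, rA_tmul]
      exact (HA.canonicalPair.freeAct_mul _ _ _ _).symm) x

theorem tmul_mul (a : A) (b : B) (y : SmashProduct HA act) :
    smashEquiv HA act (a ⊗ₜ b) * y = lA HA act a (hact.lB b y) := by
  refine forall_of_equiv (smashEquiv HA act) (f := LinearMap.mulLeft ℂ (smashEquiv HA act (a ⊗ₜ b)))
    (g := lA HA act a ∘ₗ hact.lB b) (fun a' b' => ?_) y
  rw [LinearMap.comp_apply, hact.lB_tmul, lA_rB, smashEquiv'_apply, lA, rB,
    freeAct_apply_equiv, freeActRight_apply_equiv]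
  change smashEquiv HA act (Smash.mulMap _ act ((a ⊗ₜ b) ⊗ₜ (a' ⊗ₜ b'))) = _
  congr 1
  simp only [Smash.mulMap, middle, LinearMap.comp_apply, LinearEquiv.coe_coe,
    TensorProduct.assoc_tmul, LinearMap.lTensor_tmul, TensorProduct.assoc_symm_tmul,
    LinearMap.rTensor_tmul]
  exact forall_of_tmul (f := TensorProduct.map (mul' ℂ A) (mul' ℂ B) ∘ₗ
    (assoc ℂ A A (B ⊗[ℂ] B)).symm.toLinearMap ∘ₗ TensorProduct.mk ℂ A _ a ∘ₗ
    (assoc ℂ A B B).toLinearMap ∘ₗ (TensorProduct.mk ℂ (A ⊗[ℂ] B) B).flip b')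
    (g := (mulRight ℂ b').lTensor A ∘ₗ (mulLeft ℂ a).rTensor B) (fun x y => by simp) _

theorem mul_tmul (a : A) (b : B) (y : SmashProduct HA act) :
    y * smashEquiv HA act (a ⊗ₜ b) = rB HA act b (hact.rA a y) :=
  forall_of_equiv (smashEquiv HA act)
    (f := LinearMap.mulRight ℂ (smashEquiv HA act (a ⊗ₜ b)))
    (g := rB HA act b ∘ₗ hact.rA a) (fun a' b' => by
      rw [LinearMap.mulRight_apply, hact.tmul_mul, hact.lB_tmul, LinearMap.comp_apply,
        hact.rA_tmul, lA_rB]) y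

theorem smashEquiv'_tmul_mul (a : A) (b : B) (y : SmashProduct HA act) :
    hact.smashEquiv' (b ⊗ₜ a) * y = hact.lB b (lA HA act a y) :=
  forall_of_equiv (smashEquiv HA act) (f := LinearMap.mulLeft ℂ (hact.smashEquiv' (b ⊗ₜ a)))
    (g := hact.lB b ∘ₗ lA HA act a) (fun a' b' => by
      rw [LinearMap.mulLeft_apply, hact.mul_tmul, rA_smashEquiv'_tmul, LinearMap.comp_apply,
        lA_tmul, lB_tmul]) y

include hact in
theorem smash_mul_assoc (GB : CanonicalPair B) (x y z : SmashProduct HA act) :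
    x * y * z = x * (y * z) := by
  refine forall_of_equiv (smashEquiv HA act) (f := mulRight ℂ z ∘ₗ mulRight ℂ y)
    (g := mulRight ℂ (y * z)) (fun a b => ?_) x
  refine forall_of_equiv (smashEquiv HA act) (f := mulLeft ℂ (smashEquiv HA act (a ⊗ₜ b) * y))
    (g := mulLeft ℂ (smashEquiv HA act (a ⊗ₜ b)) ∘ₗ mulLeft ℂ y) (fun a' b' => ?_) z
  simp only [LinearMap.mulLeft_apply, LinearMap.comp_apply, hact.tmul_mul, hact.mul_tmul,
    hact.lB_rB GB, lB_rA, lA_rB, lA_rA]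

include hact in
theorem smash_eq_zero_of_mul (GB : CanonicalPair B) (x : SmashProduct HA act)
    (h : ∀ y, x * y = 0) : x = 0 :=
  HA.canonicalPair.eq_zero_of_freeActRight hact.smashEquiv' x fun a =>
    GB.eq_zero_of_freeActRight (smashEquiv HA act) _ fun b => by
      rw [← h (smashEquiv HA act (a ⊗ₜ b)), hact.mul_tmul]
      rfl

include hact in
theorem smash_eq_zero_of_mul' (GB : CanonicalPair B) (x : SmashProduct HA act)
    (h : ∀ y, y * x = 0) : x = 0 :=
  GB.eq_zero_of_freeAct hact.smashEquiv' x fun b =>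
    HA.canonicalPair.eq_zero_of_freeAct (smashEquiv HA act) _ fun a => by
      rw [← h (smashEquiv HA act (a ⊗ₜ b)), hact.tmul_mul]
      rfl

theorem leftB_eq (b : B) : Smash.leftB HA.toMultiplierHopfAlgebra act b = hact.lB b := by
  refine LinearMap.ext fun y => forall_of_equiv (smashEquiv HA act) (fun α β => ?_) y
  rw [lB_tmul, rB, smashEquiv'_apply, freeActRight_apply_equiv]
  change smashEquiv HA act ((mul' ℂ B).lTensor A (assoc ℂ A B B
    (twist HA.toMultiplierHopfAlgebra act (b ⊗ₜ α) ⊗ₜ β))) = _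
  rw [lTensor_assoc_tmul]
  rfl

end IsRightModuleAlgebra

end SmashAlgebra

/-! ### The compatibility map `P = TR` -/

section Compatible

variable {A : Type*} [NonUnitalNonAssocRing A] [Module ℂ A] [IsScalarTower ℂ A A]
  [SMulCommClass ℂ A A]
variable {B : Type*} [NonUnitalNonAssocRing B] [Module ℂ B] [IsScalarTower ℂ B B]
  [SMulCommClass ℂ B B]
variable {V : Type*} [AddCommGroup V] [Module ℂ V]
variable {HA : RegularMultiplierHopfAlgebra A} {HB : RegularMultiplierHopfAlgebra B}
  {act : B →ₗ[ℂ] A →ₗ[ℂ] B} {Γ : A →ₗ[ℂ] LeftCompletion A B}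

theorem pMap_tmul (b : B) (a : A) :
    pMap HA act Γ (b ⊗ₜ a) = cotwistOp Γ (comm ℂ B A (actComul HA act b a)) := by
  have h : ∀ t : A ⊗[ℂ] B, comm ℂ B A (comm ℂ A B t) = t := fun t => by
    rw [← LinearEquiv.trans_apply, TensorProduct.comm_trans_comm, LinearEquiv.refl_apply]
  change _ = cotwistOp Γ (comm ℂ B A (comm ℂ A B (twistOp HA act (b ⊗ₜ a))))
  rw [h]
  rfl

namespace IsRightModuleAlgebra

variable (hact : IsRightModuleAlgebra HA.toMultiplierHopfAlgebra act)
include hact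

/-- `P(cb ⊗ a) = ∑ ((c ◁ a₍₁₎) ⊗ 1)P(b ⊗ a₍₂₎)`. -/
theorem pMap_mul_left (GB : CanonicalPair B) (c b : B) (a : A) : pMap HA act Γ ((c * b) ⊗ₜ a) =
    contractLeft (pMap HA act Γ ∘ₗ TensorProduct.mk ℂ B A b) (LinearMap.mul ℂ B)
      (actComul HA act c a) := by
  rw [pMap_tmul, hact.actComul_mul]
  refine forall_of_tmul (f := cotwistOp Γ ∘ₗ (comm ℂ B A).toLinearMap ∘ₗ
    contractLeft (actComul HA act b) (LinearMap.mul ℂ B)) (fun c a => ?_) _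
  simp only [LinearMap.comp_apply, contractLeft_tmul, LinearEquiv.coe_coe, TensorProduct.mk_apply,
    pMap_tmul]
  refine forall_of_tmul (f := cotwistOp Γ ∘ₗ (comm ℂ B A).toLinearMap ∘ₗ
      (LinearMap.mul ℂ B c).rTensor A) (g := (LinearMap.mul ℂ B c).rTensor A ∘ₗ cotwistOp Γ ∘ₗ
        (comm ℂ B A).toLinearMap) (fun x y => ?_) _
  simp only [LinearMap.comp_apply, LinearMap.rTensor_tmul, LinearEquiv.coe_coe,
    TensorProduct.comm_tmul]
  exact cotwistOp_mul Γ GB y c x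

/-- `∑ P(b ⊗ a₍₁₎) ⊗ f(a₍₂₎)` for a map `F : a ↦ ∑ a₍₁₎ ⊗ f(a₍₂₎)`. -/
theorem pMap_rTensor {F : A →ₗ[ℂ] A ⊗[ℂ] V} {f : A →ₗ[ℂ] V}
    (h : ∀ c a, (mulLeft ℂ c).rTensor V (F a) = f.lTensor A (HA.canonicalPair.t₂ c a))
    (b : B) (a : A) : (pMap HA act Γ ∘ₗ TensorProduct.mk ℂ B A b).rTensor V (F a) =
      (cotwistOp Γ ∘ₗ (comm ℂ B A).toLinearMap).rTensor V
        ((assoc ℂ B A V).symm (F.lTensor B (actComul HA act b a))) := by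
  have h1 : pMap HA act Γ ∘ₗ TensorProduct.mk ℂ B A b =
      (cotwistOp Γ ∘ₗ (comm ℂ B A).toLinearMap) ∘ₗ actComul HA act b :=
    LinearMap.ext fun a => pMap_tmul b a
  rw [← hact.assoc_actComul_rTensor h, LinearEquiv.symm_apply_apply, h1,
    LinearMap.rTensor_comp_apply]

end IsRightModuleAlgebra

namespace IsCompatible

variable (hcomp : IsCompatible HA HB act Γ)
include hcomp

theorem cotwist_twist_apply (t : B ⊗[ℂ] A) :
    cotwist Γ (twist HA.toMultiplierHopfAlgebra act t) = pMap HA act Γ t :=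
  LinearMap.congr_fun hcomp.cotwist_twist t

theorem pMap_mul_right (b : B) (a a' : A) : pMap HA act Γ (b ⊗ₜ (a * a')) =
    contractRight (pMap HA act Γ ∘ₗ (TensorProduct.mk ℂ B A).flip a') (LinearMap.mul ℂ A).flip
      (pMap HA act Γ (b ⊗ₜ a)) := by
  have h := hcomp.pMap_mul ((b ⊗ₜ a) ⊗ₜ a')
  simp only [TensorProduct.assoc_tmul, LinearMap.lTensor_tmul, LinearMap.mul'_apply,
    LinearMap.rTensor_tmul] at h
  rw [h]
  refine forall_of_tmul (f := (mul' ℂ A).lTensor B ∘ₗ (assoc ℂ B A A).toLinearMap ∘ₗ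
    (TensorProduct.rightComm ℂ B A A).toLinearMap ∘ₗ (pMap HA act Γ).rTensor A ∘ₗ
    (TensorProduct.rightComm ℂ B A A).toLinearMap ∘ₗ (TensorProduct.mk ℂ (B ⊗[ℂ] A) A).flip a')
    (fun x y => ?_) _
  rw [contractRight_tmul]
  simp only [LinearMap.comp_apply, LinearMap.flip_apply, TensorProduct.mk_apply,
    LinearEquiv.coe_coe, TensorProduct.rightComm_tmul, LinearMap.rTensor_tmul]
  exact forall_of_tmul (f := (mul' ℂ A).lTensor B ∘ₗ (assoc ℂ B A A).toLinearMap ∘ₗ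
    (TensorProduct.rightComm ℂ B A A).toLinearMap ∘ₗ (TensorProduct.mk ℂ (B ⊗[ℂ] A) A).flip y)
    (g := ((LinearMap.mul ℂ A).flip.flip y).lTensor B) (fun u v => by simp) _

/-- `∑ c(b₍₁₎ ⊗ a)^P ⊗ b₍₂₎`, as `c ⊗ a` runs through an element of `B ⊗ A`. -/
theorem exists_comul_pMap (b : B) (t : B ⊗[ℂ] A) : ∃ z : B ⊗[ℂ] (B ⊗[ℂ] A),
    (∀ d, ((mulRight ℂ d).rTensor A).lTensor B z = contractLeft
      (legs₁₃ (pMap HA act Γ) ∘ₗ TensorProduct.mk ℂ _ A (HB.canonicalPair.t₁ d b))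
      (LinearMap.mul ℂ B) t) ∧
    (pMap HA act Γ).lTensor B z = assoc ℂ B B A (contractLeft
      (pMap HA act Γ ∘ₗ TensorProduct.mk ℂ B A b)
      (TensorProduct.curry HB.canonicalPair.T₂.toLinearMap) t) := by
  induction t using TensorProduct.induction_on with
  | zero => exact ⟨0, fun d => by rw [map_zero, map_zero], by simp⟩
  | add x y hx hy =>
    obtain ⟨z, hz, hz'⟩ := hx
    obtain ⟨w, hw, hw'⟩ := hy
    exact ⟨z + w, fun d => by rw [map_add, map_add, hz, hw], by simp only [map_add, hz', hw']⟩
  | tmul c a =>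
    obtain ⟨z, hz, hz'⟩ := hcomp.comul_pMap a b c
    refine ⟨assoc ℂ B B A z, fun d => ?_, ?_⟩
    · rw [contractLeft_tmul, ← assoc_lTensor_rTensor, hz, assoc_rTensor_rTensor]
      rfl
    · rw [hz', contractLeft_tmul]
      rfl

variable (hact : IsRightModuleAlgebra HA.toMultiplierHopfAlgebra act)
include hact

/-- `(Δ ⊗ ι)P = P₂₃P₁₃(Δ ⊗ ι)`, multiplied by `c` from the left. -/
theorem pMap_legs₁₃ (c b : B) (a : A) : (pMap HA act Γ).lTensor B
    (legs₁₃ (pMap HA act Γ) (HB.canonicalPair.t₂ c b ⊗ₜ a)) =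
      assoc ℂ B B A (contractLeft (pMap HA act Γ ∘ₗ TensorProduct.mk ℂ B A b)
        (TensorProduct.curry HB.canonicalPair.T₂.toLinearMap) (actComul HA act c a)) := by
  set G := HB.canonicalPair
  obtain ⟨z, hz, hz'⟩ := hcomp.exists_comul_pMap b (actComul HA act c a)
  rw [← hz']
  congr 1
  have h1 : ∀ d (s : B ⊗[ℂ] B), ((mulRight ℂ d).rTensor A).lTensor B
      (legs₁₃ (pMap HA act Γ) (s ⊗ₜ a)) =
      legs₁₃ (pMap HA act Γ) ((mulRight ℂ d).lTensor B s ⊗ₜ a) := fun d =>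
    forall_of_tmul (f := ((mulRight ℂ d).rTensor A).lTensor B ∘ₗ legs₁₃ (pMap HA act Γ) ∘ₗ
      (TensorProduct.mk ℂ (B ⊗[ℂ] B) A).flip a)
      (g := legs₁₃ (pMap HA act Γ) ∘ₗ (TensorProduct.mk ℂ (B ⊗[ℂ] B) A).flip a ∘ₗ
        (mulRight ℂ d).lTensor B) fun u v => by
      simp only [LinearMap.comp_apply, LinearMap.flip_apply, TensorProduct.mk_apply,
        LinearMap.lTensor_tmul, legs₁₃_tmul]
      rw [← LinearMap.lTensor_comp_apply]
      rfl
  have h2 : ∀ s : B ⊗[ℂ] B, legs₁₃ (pMap HA act Γ) ((mulLeft ℂ c).rTensor B s ⊗ₜ a) =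
      contractLeft (legs₁₃ (pMap HA act Γ) ∘ₗ TensorProduct.mk ℂ _ A s)
        (LinearMap.mul ℂ B) (actComul HA act c a) := fun s => by
    refine (forall_of_tmul (f := legs₁₃ (pMap HA act Γ) ∘ₗ
      (TensorProduct.mk ℂ (B ⊗[ℂ] B) A).flip a ∘ₗ (mulLeft ℂ c).rTensor B)
      (g := (mul' ℂ B).rTensor _ ∘ₗ (assoc ℂ B B _).symm.toLinearMap ∘ₗ
        (legs₁₃ (pMap HA act Γ)).lTensor B ∘ₗ (TensorProduct.leftComm ℂ _ B A).toLinearMap ∘ₗ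
        (TensorProduct.mk ℂ (B ⊗[ℂ] B) (B ⊗[ℂ] A)).flip (actComul HA act c a))
        (fun u v => ?_) s).trans ?_
    · simp only [LinearMap.comp_apply, LinearMap.flip_apply, TensorProduct.mk_apply,
        LinearMap.rTensor_tmul, legs₁₃_tmul, LinearMap.mulLeft_apply]
      rw [hact.pMap_mul_left G]
      refine forall_of_tmul (f := (TensorProduct.mk ℂ B A v).lTensor B ∘ₗ
        contractLeft (pMap HA act Γ ∘ₗ TensorProduct.mk ℂ B A u) (LinearMap.mul ℂ B))
        (g := (mul' ℂ B).rTensor _ ∘ₗ (assoc ℂ B B _).symm.toLinearMap ∘ₗ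
        (legs₁₃ (pMap HA act Γ)).lTensor B ∘ₗ (TensorProduct.leftComm ℂ _ B A).toLinearMap ∘ₗ
        TensorProduct.mk ℂ (B ⊗[ℂ] B) (B ⊗[ℂ] A) (u ⊗ₜ v)) (fun x y => ?_) _
      simp only [LinearMap.comp_apply, contractLeft_tmul, TensorProduct.mk_apply,
        LinearEquiv.coe_coe, TensorProduct.leftComm_tmul, LinearMap.lTensor_tmul, legs₁₃_tmul]
      exact forall_of_tmul (f := (TensorProduct.mk ℂ B A v).lTensor B ∘ₗ
        (LinearMap.mul ℂ B x).rTensor A) (g := (mul' ℂ B).rTensor _ ∘ₗ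
        (assoc ℂ B B _).symm.toLinearMap ∘ₗ TensorProduct.mk ℂ B _ x ∘ₗ
        (TensorProduct.mk ℂ B A v).lTensor B) (fun p q => by simp) _
    · refine forall_of_tmul (f := (mul' ℂ B).rTensor _ ∘ₗ (assoc ℂ B B _).symm.toLinearMap ∘ₗ
        (legs₁₃ (pMap HA act Γ)).lTensor B ∘ₗ (TensorProduct.leftComm ℂ _ B A).toLinearMap ∘ₗ
        TensorProduct.mk ℂ (B ⊗[ℂ] B) (B ⊗[ℂ] A) s) (fun x y => ?_) _
      simp only [LinearMap.comp_apply, contractLeft_tmul, TensorProduct.mk_apply,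
        LinearEquiv.coe_coe, TensorProduct.leftComm_tmul, LinearMap.lTensor_tmul]
      exact forall_of_tmul (f := (mul' ℂ B).rTensor _ ∘ₗ
        (assoc ℂ B B _).symm.toLinearMap ∘ₗ TensorProduct.mk ℂ B (B ⊗[ℂ] (B ⊗[ℂ] A)) x)
        (g := (LinearMap.mul ℂ B x).rTensor _) (fun p q => by simp) _
  refine eq_of_forall_lTensor (fun d : B => (mulRight ℂ d).rTensor A)
    (fun x hx => eq_zero_of_forall_rTensor (fun y : B => mulRight ℂ y)
      (fun x hx => G.eq_zero_of_mul x fun b => by simpa using hx b) x hx) fun d => ?_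
  rw [hz, h1, ← G.t_compat, h2]

/-- The exchange relation `R₂₃P₁₃T₂,₁₂ = T₂,₁₃P₁₂R₂₃` on `B ⊗ B ⊗ A`, with `T₂` that of `B`. It
expresses that the coproduct of the smash product respects the relation `ba = R(b ⊗ a)`. -/
theorem twist_legs₁₃_pMap (hΓ : IsLeftCoaction HB Γ) (c b : B) (a : A) :
    (twist HA.toMultiplierHopfAlgebra act).lTensor B
      (legs₁₃ (pMap HA act Γ) (HB.canonicalPair.t₂ c b ⊗ₜ a)) =
      legs₁₃ HB.canonicalPair.T₂.toLinearMap
        ((pMap HA act Γ ∘ₗ TensorProduct.mk ℂ B A c).rTensor B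
          (twist HA.toMultiplierHopfAlgebra act (b ⊗ₜ a))) := by
  apply (hΓ.cotwistEquiv.lTensor B).injective
  change (cotwist Γ).lTensor B _ = (cotwist Γ).lTensor B _
  have h1 : cotwist Γ ∘ₗ twist HA.toMultiplierHopfAlgebra act = pMap HA act Γ :=
    hcomp.cotwist_twist
  rw [← LinearMap.lTensor_comp_apply, h1, hcomp.pMap_legs₁₃ hact]
  have h2 := hact.pMap_rTensor (Γ := Γ) (F := twist HA.toMultiplierHopfAlgebra act ∘ₗ
    TensorProduct.mk ℂ B A b) (fun c a => hact.twist_cover b a c) c a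
  rw [LinearMap.comp_apply (twist HA.toMultiplierHopfAlgebra act), TensorProduct.mk_apply] at h2
  rw [h2]
  refine forall_of_tmul (f := (assoc ℂ B B A).toLinearMap ∘ₗ contractLeft
    (pMap HA act Γ ∘ₗ TensorProduct.mk ℂ B A b)
      (TensorProduct.curry HB.canonicalPair.T₂.toLinearMap))
    (g := (cotwist Γ).lTensor B ∘ₗ legs₁₃ HB.canonicalPair.T₂.toLinearMap ∘ₗ
      (cotwistOp Γ ∘ₗ (comm ℂ B A).toLinearMap).rTensor B ∘ₗ (assoc ℂ B A B).symm.toLinearMap ∘ₗ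
      (twist HA.toMultiplierHopfAlgebra act ∘ₗ TensorProduct.mk ℂ B A b).lTensor B)
    (fun c a => ?_) _
  simp only [LinearMap.comp_apply, contractLeft_tmul, TensorProduct.mk_apply,
    LinearEquiv.coe_coe, LinearMap.lTensor_tmul]
  rw [← hcomp.cotwist_twist_apply]
  generalize twist HA.toMultiplierHopfAlgebra act (b ⊗ₜ a) = t
  refine forall_of_tmul (f := (assoc ℂ B B A).toLinearMap ∘ₗ
    (HB.canonicalPair.t₂ c).rTensor A ∘ₗ cotwist Γ)
    (g := (cotwist Γ).lTensor B ∘ₗ legs₁₃ HB.canonicalPair.T₂.toLinearMap ∘ₗ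
      (cotwistOp Γ ∘ₗ (comm ℂ B A).toLinearMap).rTensor B ∘ₗ (assoc ℂ B A B).symm.toLinearMap ∘ₗ
      TensorProduct.mk ℂ B _ c) (fun x y => ?_) t
  exact (hΓ.cotwist_cotwistComul c x y).symm

end IsCompatible

end Compatible

/-! ### Right multiplication by the smash coproduct -/

section SmashComul

variable {A : Type*} [NonUnitalNonAssocRing A] [Module ℂ A] [IsScalarTower ℂ A A]
  [SMulCommClass ℂ A A]
variable {B : Type*} [NonUnitalNonAssocRing B] [Module ℂ B] [IsScalarTower ℂ B B]
  [SMulCommClass ℂ B B]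

section Defs

variable (HA : RegularMultiplierHopfAlgebra A) (HB : RegularMultiplierHopfAlgebra B)
  (act : B →ₗ[ℂ] A →ₗ[ℂ] B) (Γ : A →ₗ[ℂ] LeftCompletion A B)

/-- The identification of `A ⊗ B ⊗ X` with `AB ⊗ X`. -/
noncomputable def smashLeft (X : Type*) [AddCommGroup X] [Module ℂ X] :
    A ⊗[ℂ] (B ⊗[ℂ] X) ≃ₗ[ℂ] SmashProduct HA act ⊗[ℂ] X :=
  (assoc ℂ A B X).symm ≪≫ₗ TensorProduct.congr (smashEquiv HA act) (LinearEquiv.refl ℂ X)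

/-- The map `w ⊗ a ↦ (w ⊗ 1)Δ(a) = ∑ (w a₍₁₎ ⊗ 1)Γ(a₍₂₎)` on `AB ⊗ A`. -/
noncomputable def comulA : SmashProduct HA act ⊗[ℂ] A →ₗ[ℂ] SmashProduct HA act ⊗[ℂ] A :=
  (smashLeft HA act A).toLinearMap ∘ₗ (pMap HA act Γ).lTensor A ∘ₗ
    legs₁₃ HA.canonicalPair.T₂.toLinearMap ∘ₗ (smashEquiv HA act).symm.toLinearMap.rTensor A

/-- The map `w ⊗ b ↦ (w ⊗ 1)Δ(b) = ∑ w b₍₁₎ ⊗ b₍₂₎` on `AB ⊗ B`. -/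
noncomputable def comulB : SmashProduct HA act ⊗[ℂ] B →ₗ[ℂ] SmashProduct HA act ⊗[ℂ] B :=
  (smashLeft HA act B).toLinearMap ∘ₗ HB.canonicalPair.T₂.toLinearMap.lTensor A ∘ₗ
    (smashLeft HA act B).symm.toLinearMap

/-- The map `w ⊗ a ⊗ b ↦ (w ⊗ 1)Δ(ab)` on `AB ⊗ A ⊗ B`. -/
noncomputable def comulAB : SmashProduct HA act ⊗[ℂ] (A ⊗[ℂ] B) →ₗ[ℂ]
    SmashProduct HA act ⊗[ℂ] (A ⊗[ℂ] B) :=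
  legs₁₃ (comulB HA HB act) ∘ₗ (comulA HA act Γ).rTensor B ∘ₗ (assoc ℂ _ A B).symm.toLinearMap

/-- The map `a ⊗ b ↦ ∑ (β ⊗ 1)(a₍₁₎ ⊗ 1)Γ(a₍₂₎)Δ(b)` without the leg `a₍₁₎`, which is moved to the
left of `β`. -/
noncomputable def pMapComul (β : B) : A ⊗[ℂ] B →ₗ[ℂ] B ⊗[ℂ] (A ⊗[ℂ] B) :=
  legs₁₃ HB.canonicalPair.T₂.toLinearMap ∘ₗ (pMap HA act Γ ∘ₗ TensorProduct.mk ℂ B A β).rTensor B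

end Defs

variable {HA : RegularMultiplierHopfAlgebra A} {HB : RegularMultiplierHopfAlgebra B}
  {act : B →ₗ[ℂ] A →ₗ[ℂ] B} {Γ : A →ₗ[ℂ] LeftCompletion A B}
  {X Y : Type*} [AddCommGroup X] [Module ℂ X] [AddCommGroup Y] [Module ℂ Y]

theorem smashLeft_tmul (a : A) (t : B ⊗[ℂ] X) : smashLeft HA act X (a ⊗ₜ t) =
    ((smashEquiv HA act).toLinearMap ∘ₗ TensorProduct.mk ℂ A B a).rTensor X t :=
  forall_of_tmul (f := (smashLeft HA act X).toLinearMap ∘ₗ TensorProduct.mk ℂ A (B ⊗[ℂ] X) a)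
    (g := ((smashEquiv HA act).toLinearMap ∘ₗ TensorProduct.mk ℂ A B a).rTensor X)
    (fun b x => by simp [smashLeft]) t

theorem smashLeft_lTensor (f : X →ₗ[ℂ] Y) (t : A ⊗[ℂ] (B ⊗[ℂ] X)) :
    smashLeft HA act Y ((f.lTensor B).lTensor A t) =
      f.lTensor _ (smashLeft HA act X t) :=
  forall_of_tmul (f := (smashLeft HA act Y).toLinearMap ∘ₗ (f.lTensor B).lTensor A)
    (g := f.lTensor _ ∘ₗ (smashLeft HA act X).toLinearMap) (fun a t => by
      simp only [LinearMap.comp_apply, LinearMap.lTensor_tmul, LinearEquiv.coe_coe, smashLeft_tmul]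
      rw [rTensor_lTensor]) t

theorem comulA_tmul (α a : A) (β : B) : comulA HA act Γ (smashEquiv HA act (α ⊗ₜ β) ⊗ₜ a) =
    smashLeft HA act A ((pMap HA act Γ ∘ₗ TensorProduct.mk ℂ B A β).lTensor A
      (HA.canonicalPair.t₂ α a)) := by
  simp only [comulA, LinearMap.comp_apply, LinearMap.rTensor_tmul, LinearEquiv.coe_coe,
    LinearEquiv.symm_apply_apply, legs₁₃_tmul, LinearMap.lTensor_comp]
  rfl

theorem comulB_tmul (α : A) (β b : B) : comulB HA HB act (smashEquiv HA act (α ⊗ₜ β) ⊗ₜ b) =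
    smashLeft HA act B (α ⊗ₜ HB.canonicalPair.t₂ β b) := by
  have h : smashEquiv HA act (α ⊗ₜ β) ⊗ₜ[ℂ] b = smashLeft HA act B (α ⊗ₜ (β ⊗ₜ b)) := by
    simp [smashLeft]
  rw [h]
  simp only [comulB, LinearMap.comp_apply, LinearEquiv.coe_coe, LinearEquiv.symm_apply_apply]
  rfl

theorem comulAB_tmul (w : SmashProduct HA act) (a : A) (b : B) :
    comulAB HA HB act Γ (w ⊗ₜ (a ⊗ₜ b)) =
      legs₁₃ (comulB HA HB act) (comulA HA act Γ (w ⊗ₜ a) ⊗ₜ b) := rfl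

theorem legs₁₃_comulB (α : A) (t : B ⊗[ℂ] A) (b : B) :
    legs₁₃ (comulB HA HB act) (smashLeft HA act A (α ⊗ₜ t) ⊗ₜ b) =
      smashLeft HA act _ (α ⊗ₜ legs₁₃ HB.canonicalPair.T₂.toLinearMap (t ⊗ₜ b)) :=
  forall_of_tmul (f := legs₁₃ (comulB HA HB act) ∘ₗ (TensorProduct.mk ℂ _ B).flip b ∘ₗ
      (smashLeft HA act A).toLinearMap ∘ₗ TensorProduct.mk ℂ A _ α)
    (g := (smashLeft HA act _).toLinearMap ∘ₗ TensorProduct.mk ℂ A _ α ∘ₗ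
      legs₁₃ HB.canonicalPair.T₂.toLinearMap ∘ₗ (TensorProduct.mk ℂ _ B).flip b) (fun β a => by
      have h : smashLeft HA act A (α ⊗ₜ (β ⊗ₜ a)) = smashEquiv HA act (α ⊗ₜ β) ⊗ₜ[ℂ] a := by
        simp [smashLeft]
      simp only [LinearMap.comp_apply, LinearEquiv.coe_coe, TensorProduct.mk_apply,
        LinearMap.flip_apply, h, legs₁₃_tmul, comulB_tmul]
      rw [← smashLeft_lTensor, LinearMap.lTensor_tmul]
      rfl) t

theorem comulAB_smashEquiv (α : A) (β : B) (s : A ⊗[ℂ] B) :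
    comulAB HA HB act Γ (smashEquiv HA act (α ⊗ₜ β) ⊗ₜ s) =
      smashLeft HA act _ ((pMapComul HA HB act Γ β).lTensor A
        (assoc ℂ A A B ((HA.canonicalPair.t₂ α).rTensor B s))) := by
  refine forall_of_tmul (f := comulAB HA HB act Γ ∘ₗ
    TensorProduct.mk ℂ _ _ (smashEquiv HA act (α ⊗ₜ β)))
    (g := (smashLeft HA act _).toLinearMap ∘ₗ (pMapComul HA HB act Γ β).lTensor A ∘ₗ
      (assoc ℂ A A B).toLinearMap ∘ₗ (HA.canonicalPair.t₂ α).rTensor B) (fun a b => ?_) s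
  simp only [LinearMap.comp_apply, TensorProduct.mk_apply, comulAB_tmul, comulA_tmul,
    LinearMap.rTensor_tmul, LinearEquiv.coe_coe]
  refine forall_of_tmul (f := legs₁₃ (comulB HA HB act) ∘ₗ (TensorProduct.mk ℂ _ B).flip b ∘ₗ
    (smashLeft HA act A).toLinearMap ∘ₗ (pMap HA act Γ ∘ₗ TensorProduct.mk ℂ B A β).lTensor A)
    (g := (smashLeft HA act _).toLinearMap ∘ₗ (pMapComul HA HB act Γ β).lTensor A ∘ₗ
      (assoc ℂ A A B).toLinearMap ∘ₗ (TensorProduct.mk ℂ _ B).flip b) (fun p q => ?_) _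
  simp only [LinearMap.comp_apply, LinearMap.lTensor_tmul, LinearMap.flip_apply,
    TensorProduct.mk_apply, LinearEquiv.coe_coe, TensorProduct.assoc_tmul, legs₁₃_comulB]
  rfl

/-- `(w ⊗ 1)Δ(aa') = ((w ⊗ 1)Δ(a))Δ(a')`. -/
theorem IsCompatible.comulA_mul (hcomp : IsCompatible HA HB act Γ) (w : SmashProduct HA act)
    (a a' : A) : comulA HA act Γ (w ⊗ₜ (a * a')) =
      contractRight (comulA HA act Γ ∘ₗ (TensorProduct.mk ℂ _ A).flip a')
        (LinearMap.mul ℂ A).flip (comulA HA act Γ (w ⊗ₜ a)) := by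
  refine forall_of_equiv (smashEquiv HA act) (f := comulA HA act Γ ∘ₗ
    (TensorProduct.mk ℂ _ A).flip (a * a')) (g := contractRight (comulA HA act Γ ∘ₗ
      (TensorProduct.mk ℂ _ A).flip a') (LinearMap.mul ℂ A).flip ∘ₗ comulA HA act Γ ∘ₗ
        (TensorProduct.mk ℂ _ A).flip a) (fun α β => ?_) w
  simp only [LinearMap.comp_apply, LinearMap.flip_apply, TensorProduct.mk_apply, comulA_tmul]
  rw [HA.canonicalPair.t₂_mul]
  refine forall_of_tmul (f := (smashLeft HA act A).toLinearMap ∘ₗ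
    (pMap HA act Γ ∘ₗ TensorProduct.mk ℂ B A β).lTensor A ∘ₗ
      rightMul HA.canonicalPair.T₂.toLinearMap a')
    (g := contractRight (comulA HA act Γ ∘ₗ (TensorProduct.mk ℂ _ A).flip a')
      (LinearMap.mul ℂ A).flip ∘ₗ (smashLeft HA act A).toLinearMap ∘ₗ
        (pMap HA act Γ ∘ₗ TensorProduct.mk ℂ B A β).lTensor A) (fun p q => ?_) _
  simp only [LinearMap.comp_apply, LinearMap.lTensor_tmul, LinearEquiv.coe_coe,
    CanonicalPair.rightMul_tmul, TensorProduct.mk_apply]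
  -- both sides are `∑ p a'₍₁₎ ⊗ P(β ⊗ q a'₍₂₎)`
  have h1 : (pMap HA act Γ ∘ₗ TensorProduct.mk ℂ B A β) ∘ₗ mulLeft ℂ q =
      lift (LinearMap.mk₂ ℂ (fun (x : B ⊗[ℂ] A) s => contractRight
        (pMap HA act Γ ∘ₗ (TensorProduct.mk ℂ B A).flip s) (LinearMap.mul ℂ A).flip x)
        (fun x y s => by simp) (fun r x s => by simp)
        (fun x s s' => by
          simp [contractRight, LinearMap.comp_add, LinearMap.rTensor_add])
        (fun r x s => by
          simp [contractRight, LinearMap.comp_smul, LinearMap.rTensor_smul])) ∘ₗ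
        TensorProduct.mk ℂ _ A (pMap HA act Γ (β ⊗ₜ q)) := by
    ext s
    simp only [LinearMap.comp_apply, TensorProduct.mk_apply, LinearMap.mulLeft_apply, lift.tmul]
    exact hcomp.pMap_mul_right _ _ _
  rw [← LinearMap.lTensor_comp_apply, h1]
  generalize pMap HA act Γ (β ⊗ₜ q) = x
  induction x using TensorProduct.induction_on with
  | zero => simp
  | add x y hx hy =>
    simp only [map_add, LinearMap.comp_add, LinearMap.lTensor_add, LinearMap.add_apply,
      TensorProduct.tmul_add, hx, hy]
  | tmul β' q' =>
    have h2 : smashLeft HA act A (p ⊗ₜ (β' ⊗ₜ q')) = smashEquiv HA act (p ⊗ₜ β') ⊗ₜ[ℂ] q' := by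
      simp [smashLeft]
    rw [h2, contractRight_tmul]
    simp only [LinearMap.comp_apply, LinearMap.flip_apply, TensorProduct.mk_apply, comulA_tmul,
      LinearMap.flip_flip]
    rw [← smashLeft_lTensor, ← LinearMap.lTensor_comp_apply]
    congr 3
    ext s
    simp only [LinearMap.comp_apply, TensorProduct.mk_apply, lift.tmul]
    exact contractRight_tmul (pMap HA act Γ ∘ₗ (TensorProduct.mk ℂ B A).flip s)
      (LinearMap.mul ℂ A).flip β' q'

theorem comulB_mul (w : SmashProduct HA act) (b b' : B) : comulB HA HB act (w ⊗ₜ (b * b')) =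
    contractRight (comulB HA HB act ∘ₗ (TensorProduct.mk ℂ _ B).flip b')
      (LinearMap.mul ℂ B).flip (comulB HA HB act (w ⊗ₜ b)) := by
  refine forall_of_equiv (smashEquiv HA act) (f := comulB HA HB act ∘ₗ
    (TensorProduct.mk ℂ _ B).flip (b * b')) (g := contractRight (comulB HA HB act ∘ₗ
      (TensorProduct.mk ℂ _ B).flip b') (LinearMap.mul ℂ B).flip ∘ₗ comulB HA HB act ∘ₗ
        (TensorProduct.mk ℂ _ B).flip b) (fun α β => ?_) w
  simp only [LinearMap.comp_apply, LinearMap.flip_apply, TensorProduct.mk_apply, comulB_tmul]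
  rw [HB.canonicalPair.t₂_mul]
  refine forall_of_tmul (f := (smashLeft HA act B).toLinearMap ∘ₗ TensorProduct.mk ℂ A _ α ∘ₗ
      rightMul HB.canonicalPair.T₂.toLinearMap b')
    (g := contractRight (comulB HA HB act ∘ₗ (TensorProduct.mk ℂ _ B).flip b')
      (LinearMap.mul ℂ B).flip ∘ₗ (smashLeft HA act B).toLinearMap ∘ₗ
        TensorProduct.mk ℂ A _ α) (fun p q => ?_) _
  have h2 : smashLeft HA act B (α ⊗ₜ (p ⊗ₜ q)) = smashEquiv HA act (α ⊗ₜ p) ⊗ₜ[ℂ] q := by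
    simp [smashLeft]
  simp only [LinearMap.comp_apply, LinearEquiv.coe_coe, CanonicalPair.rightMul_tmul,
    TensorProduct.mk_apply, h2, contractRight_tmul, LinearMap.flip_apply, comulB_tmul]
  rw [← smashLeft_lTensor, LinearMap.lTensor_tmul]
  rfl

/-- The coproduct respects the relation `ba = R(b ⊗ a)`. -/
theorem IsCompatible.twist_legs₁₃_comulA (hcomp : IsCompatible HA HB act Γ)
    (hact : IsRightModuleAlgebra HA.toMultiplierHopfAlgebra act) (hΓ : IsLeftCoaction HB Γ)
    (w : SmashProduct HA act) (b : B) (a : A) :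
    (twist HA.toMultiplierHopfAlgebra act).lTensor _
      (legs₁₃ (comulA HA act Γ) (comulB HA HB act (w ⊗ₜ b) ⊗ₜ a)) =
      comulAB HA HB act Γ (w ⊗ₜ twist HA.toMultiplierHopfAlgebra act (b ⊗ₜ a)) := by
  refine forall_of_equiv (smashEquiv HA act) (f := (twist HA.toMultiplierHopfAlgebra act).lTensor _
    ∘ₗ legs₁₃ (comulA HA act Γ) ∘ₗ (TensorProduct.mk ℂ _ A).flip a ∘ₗ comulB HA HB act ∘ₗ
      (TensorProduct.mk ℂ _ B).flip b)
    (g := comulAB HA HB act Γ ∘ₗ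
      (TensorProduct.mk ℂ _ _).flip (twist HA.toMultiplierHopfAlgebra act (b ⊗ₜ a)))
    (fun α β => ?_) w
  simp only [LinearMap.comp_apply, LinearMap.flip_apply, TensorProduct.mk_apply, comulB_tmul,
    comulAB_smashEquiv, hact.assoc_t₂_twist]
  have h1 : ∀ s : B ⊗[ℂ] B, legs₁₃ (comulA HA act Γ) (smashLeft HA act B (α ⊗ₜ s) ⊗ₜ a) =
      smashLeft HA act _ ((legs₁₃ (pMap HA act Γ) ∘ₗ TensorProduct.mk ℂ _ A s).lTensor A
        (HA.canonicalPair.t₂ α a)) := fun s => by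
    induction s using TensorProduct.induction_on with
    | zero => simp
    | add x y hx hy =>
      simp only [TensorProduct.tmul_add, TensorProduct.add_tmul, map_add, hx, hy,
        LinearMap.comp_add, LinearMap.lTensor_add, LinearMap.add_apply]
    | tmul p q =>
      have h2 : smashLeft HA act B (α ⊗ₜ (p ⊗ₜ q)) = smashEquiv HA act (α ⊗ₜ p) ⊗ₜ[ℂ] q := by
        simp [smashLeft]
      rw [h2, legs₁₃_tmul, comulA_tmul, ← smashLeft_lTensor, ← LinearMap.lTensor_comp_apply]
      congr 3
      ext x
      simp [legs₁₃_tmul]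
  rw [h1, ← smashLeft_lTensor, ← LinearMap.lTensor_comp_apply, ← LinearMap.lTensor_comp_apply]
  congr 3
  ext x
  exact hcomp.twist_legs₁₃_pMap hact hΓ β b x

end SmashComul

/-! ### The canonical maps of the smash product -/

section SmashCanonical

variable {A : Type*} [NonUnitalNonAssocRing A] [Module ℂ A] [IsScalarTower ℂ A A]
  [SMulCommClass ℂ A A]
variable {B : Type*} [NonUnitalNonAssocRing B] [Module ℂ B] [IsScalarTower ℂ B B]
  [SMulCommClass ℂ B B]
variable {HA : RegularMultiplierHopfAlgebra A} {HB : RegularMultiplierHopfAlgebra B}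
  {act : B →ₗ[ℂ] A →ₗ[ℂ] B} {Γ : A →ₗ[ℂ] LeftCompletion A B}
  (hact : IsRightModuleAlgebra HA.toMultiplierHopfAlgebra act)
  (hΓ : IsLeftComoduleCoalgebra HA HB Γ) (hcomp : IsCompatible HA HB act Γ)

theorem rTensor_bijective {X Y : Type*} [AddCommGroup X] [Module ℂ X] [AddCommGroup Y] [Module ℂ Y]
    (V : Type*) [AddCommGroup V] [Module ℂ V] {f : X →ₗ[ℂ] Y} (hf : Function.Bijective f) :
    Function.Bijective (f.rTensor V) :=
  ((LinearEquiv.ofBijective f hf).rTensor V).bijective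

theorem lTensor_bijective {X Y : Type*} [AddCommGroup X] [Module ℂ X] [AddCommGroup Y] [Module ℂ Y]
    (V : Type*) [AddCommGroup V] [Module ℂ V] {f : X →ₗ[ℂ] Y} (hf : Function.Bijective f) :
    Function.Bijective (f.lTensor V) :=
  ((LinearEquiv.ofBijective f hf).lTensor V).bijective

theorem legs₁₃_bijective {X Y Z U V : Type*} [AddCommGroup X] [AddCommGroup Y] [AddCommGroup Z]
    [AddCommGroup U] [AddCommGroup V] [Module ℂ X] [Module ℂ Y] [Module ℂ Z] [Module ℂ U]
    [Module ℂ V] {f : X ⊗[ℂ] Y →ₗ[ℂ] U ⊗[ℂ] V} (hf : Function.Bijective f) :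
    Function.Bijective (legs₁₃ (Z := Z) f) :=
  (assoc ℂ U Z V).bijective.comp ((TensorProduct.rightComm ℂ U V Z).bijective.comp
    ((rTensor_bijective Z hf).comp (TensorProduct.rightComm ℂ X Z Y).bijective))

include hact hΓ hcomp in
theorem comulAB_bijective : Function.Bijective (comulAB HA HB act Γ) := by
  have hP : Function.Bijective (pMap HA act Γ) := by
    have h : pMap HA act Γ = cotwist Γ ∘ₗ twist HA.toMultiplierHopfAlgebra act :=
      hcomp.cotwist_twist.symm
    rw [h]
    exact hΓ.cotwist_bijective.comp hact.twist_bijective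
  have hQ : Function.Bijective (comulA HA act Γ) :=
    (smashLeft HA act A).bijective.comp ((lTensor_bijective A hP).comp
      ((legs₁₃_bijective HA.canonicalPair.T₂.bijective).comp
        (rTensor_bijective A (smashEquiv HA act).symm.bijective)))
  have hU : Function.Bijective (comulB HA HB act) :=
    (smashLeft HA act B).bijective.comp ((lTensor_bijective A HB.canonicalPair.T₂.bijective).comp
      (smashLeft HA act B).symm.bijective)
  exact (legs₁₃_bijective hU).comp ((rTensor_bijective B hQ).comp (assoc ℂ _ A B).symm.bijective)

/-- The map `w ⊗ x ↦ (w ⊗ 1)Δ(x)` on `AB ⊗ AB`. -/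
noncomputable def smashT₂ : SmashProduct HA act ⊗[ℂ] SmashProduct HA act ≃ₗ[ℂ]
    SmashProduct HA act ⊗[ℂ] SmashProduct HA act :=
  (smashEquiv HA act).symm.lTensor _ ≪≫ₗ
    LinearEquiv.ofBijective (comulAB HA HB act Γ) (comulAB_bijective hact hΓ hcomp) ≪≫ₗ
      (smashEquiv HA act).lTensor _

theorem smashT₂_tmul (w : SmashProduct HA act) (s : A ⊗[ℂ] B) :
    smashT₂ hact hΓ hcomp (w ⊗ₜ smashEquiv HA act s) =
      (smashEquiv HA act).toLinearMap.lTensor _ (comulAB HA HB act Γ (w ⊗ₜ s)) := by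
  have h : (smashEquiv HA act).symm.lTensor (SmashProduct HA act) (w ⊗ₜ smashEquiv HA act s) =
      w ⊗ₜ s := by
    rw [LinearEquiv.lTensor_tmul, LinearEquiv.symm_apply_apply]
  rw [smashT₂, LinearEquiv.trans_apply, LinearEquiv.trans_apply, h]
  rfl

/-- The map `x ⊗ y ↦ Δ(x)(1 ⊗ y)` on `AB ⊗ AB`. -/
noncomputable def smashT₁ : SmashProduct HA act ⊗[ℂ] SmashProduct HA act ≃ₗ[ℂ]
    SmashProduct HA act ⊗[ℂ] SmashProduct HA act :=
  (smashLeft HA act _).symm ≪≫ₗ (HB.canonicalPair.freeT₁ hact.smashEquiv').lTensor A ≪≫ₗ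
    hΓ.comulCoact (smashEquiv HA act) ≪≫ₗ smashLeft HA act _

theorem smashT₁_tmul (a : A) (b : B) (y : SmashProduct HA act) :
    smashT₁ hact hΓ (smashEquiv HA act (a ⊗ₜ b) ⊗ₜ y) =
      smashLeft HA act _ (hΓ.comulCoact (smashEquiv HA act)
        (a ⊗ₜ HB.canonicalPair.freeT₁ hact.smashEquiv' (b ⊗ₜ y))) := by
  have h : smashEquiv HA act (a ⊗ₜ b) ⊗ₜ[ℂ] y = smashLeft HA act _ (a ⊗ₜ (b ⊗ₜ y)) := by
    simp [smashLeft]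
  rw [h]
  simp only [smashT₁, LinearEquiv.trans_apply, LinearEquiv.symm_apply_apply]
  rfl

/-! ### Multiplicativity -/

include hact in
theorem smash_tmul_mul_tmul (a a' : A) (b b' : B) :
    smashEquiv HA act (a ⊗ₜ b) * smashEquiv HA act (a' ⊗ₜ b') =
      smashEquiv HA act ((mulLeft ℂ a).rTensor B ((mulRight ℂ b').lTensor A
        (twist HA.toMultiplierHopfAlgebra act (b ⊗ₜ a')))) := by
  rw [hact.tmul_mul, hact.lB_tmul, hact.smashEquiv'_apply, rB, lA, freeActRight_apply_equiv,
    freeAct_apply_equiv]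

include hcomp in
/-- `(w ⊗ 1)Δ(as) = ((w ⊗ 1)Δ(a))Δ(s)` for `a` in `A` and `s` in `A ⊗ B`. -/
theorem comulAB_mulLeft (w : SmashProduct HA act) (a : A) (s : A ⊗[ℂ] B) :
    comulAB HA HB act Γ (w ⊗ₜ (mulLeft ℂ a).rTensor B s) =
      contractRight (comulAB HA HB act Γ ∘ₗ (TensorProduct.mk ℂ _ _).flip s)
        (LinearMap.rTensorHom B ∘ₗ LinearMap.mul ℂ A).flip (comulA HA act Γ (w ⊗ₜ a)) := by
  induction s using TensorProduct.induction_on with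
  | zero => simp [contractRight]
  | add x y hx hy =>
    rw [map_add, TensorProduct.tmul_add, map_add, hx, hy]
    simp [contractRight, LinearMap.comp_add, LinearMap.rTensor_add]
  | tmul α β =>
    rw [LinearMap.rTensor_tmul, LinearMap.mulLeft_apply, comulAB_tmul, hcomp.comulA_mul]
    refine forall_of_tmul (f := legs₁₃ (comulB HA HB act) ∘ₗ (TensorProduct.mk ℂ _ B).flip β ∘ₗ
      contractRight (comulA HA act Γ ∘ₗ (TensorProduct.mk ℂ _ A).flip α)
        (LinearMap.mul ℂ A).flip) (fun w' a₁ => ?_) _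
    simp only [LinearMap.comp_apply, contractRight_tmul, LinearMap.flip_apply,
      TensorProduct.mk_apply, LinearMap.flip_flip, comulAB_tmul]
    refine forall_of_tmul (f := legs₁₃ (comulB HA HB act) ∘ₗ (TensorProduct.mk ℂ _ B).flip β ∘ₗ
      (LinearMap.mul ℂ A a₁).lTensor _)
      (g := ((LinearMap.mul ℂ A a₁).rTensor B).lTensor _ ∘ₗ legs₁₃ (comulB HA HB act) ∘ₗ
        (TensorProduct.mk ℂ _ B).flip β) (fun x y => ?_) _
    simp only [LinearMap.comp_apply, LinearMap.flip_apply, TensorProduct.mk_apply,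
      LinearMap.lTensor_tmul, legs₁₃_tmul]
    rw [← LinearMap.lTensor_comp_apply]
    congr 2

/-- `(w ⊗ 1)Δ(sb) = ((w ⊗ 1)Δ(s))Δ(b)` for `s` in `A ⊗ B` and `b` in `B`. -/
theorem comulAB_mulRight (w : SmashProduct HA act) (b : B) (s : A ⊗[ℂ] B) :
    comulAB HA HB act Γ (w ⊗ₜ (mulRight ℂ b).lTensor A s) =
      contractRight (comulB HA HB act ∘ₗ (TensorProduct.mk ℂ _ B).flip b)
        (LinearMap.lTensorHom A ∘ₗ (LinearMap.mul ℂ B).flip) (comulAB HA HB act Γ (w ⊗ₜ s)) := by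
  refine forall_of_tmul (f := comulAB HA HB act Γ ∘ₗ TensorProduct.mk ℂ _ _ w ∘ₗ
    (mulRight ℂ b).lTensor A)
    (g := contractRight (comulB HA HB act ∘ₗ (TensorProduct.mk ℂ _ B).flip b)
        (LinearMap.lTensorHom A ∘ₗ (LinearMap.mul ℂ B).flip) ∘ₗ comulAB HA HB act Γ ∘ₗ
          TensorProduct.mk ℂ _ _ w) (fun α β => ?_) s
  simp only [LinearMap.comp_apply, LinearMap.lTensor_tmul, TensorProduct.mk_apply, comulAB_tmul,
    LinearMap.mulRight_apply]
  refine forall_of_tmul (f := legs₁₃ (comulB HA HB act) ∘ₗ (TensorProduct.mk ℂ _ B).flip (β * b))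
    (g := contractRight (comulB HA HB act ∘ₗ (TensorProduct.mk ℂ _ B).flip b)
        (LinearMap.lTensorHom A ∘ₗ (LinearMap.mul ℂ B).flip) ∘ₗ legs₁₃ (comulB HA HB act) ∘ₗ
          (TensorProduct.mk ℂ _ B).flip β) (fun v p => ?_) _
  simp only [LinearMap.comp_apply, LinearMap.flip_apply, TensorProduct.mk_apply, legs₁₃_tmul,
    comulB_mul]
  refine forall_of_tmul (f := (TensorProduct.mk ℂ A B p).lTensor _ ∘ₗ
    contractRight (comulB HA HB act ∘ₗ (TensorProduct.mk ℂ _ B).flip b) (LinearMap.mul ℂ B).flip)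
    (g := contractRight (comulB HA HB act ∘ₗ (TensorProduct.mk ℂ _ B).flip b)
        (LinearMap.lTensorHom A ∘ₗ (LinearMap.mul ℂ B).flip) ∘ₗ
          (TensorProduct.mk ℂ A B p).lTensor _) (fun x y => ?_) _
  simp only [LinearMap.comp_apply, LinearMap.lTensor_tmul, contractRight_tmul,
    TensorProduct.mk_apply]
  rw [← LinearMap.lTensor_comp_apply]
  congr 2

/-- The coproduct of the smash product is multiplicative, `(w ⊗ 1)Δ(xx') = ((w ⊗ 1)Δ(x))Δ(x')`. As
`(ab)(a'b') = a R(b ⊗ a') b'`, this follows from the multiplicativity on `A` and on `B` and from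
the fact that the coproduct respects `ba' = R(b ⊗ a')`. -/
theorem smashT₂_mul (w x x' : SmashProduct HA act) :
    smashT₂ hact hΓ hcomp (w ⊗ₜ (x * x')) =
      rightMul (smashT₂ hact hΓ hcomp).toLinearMap x' (smashT₂ hact hΓ hcomp (w ⊗ₜ x)) := by
  set T := smashT₂ hact hΓ hcomp with hT
  obtain ⟨s', rfl⟩ := (smashEquiv HA act).surjective x'
  induction s' using TensorProduct.induction_on with
  | zero => simp [rightMul, contractRight]
  | add s s' hs hs' =>
    rw [map_add, mul_add, TensorProduct.tmul_add, map_add, hs, hs']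
    simp [rightMul, contractRight, LinearMap.comp_add, LinearMap.rTensor_add]
  | tmul a' b' =>
  refine forall_of_equiv (smashEquiv HA act) (f := T.toLinearMap ∘ₗ TensorProduct.mk ℂ _ _ w ∘ₗ
    mulRight ℂ (smashEquiv HA act (a' ⊗ₜ b')))
    (g := rightMul T.toLinearMap (smashEquiv HA act (a' ⊗ₜ b')) ∘ₗ T.toLinearMap ∘ₗ
      TensorProduct.mk ℂ _ _ w) (fun a b => ?_) x
  simp only [LinearMap.comp_apply, TensorProduct.mk_apply, LinearMap.mulRight_apply,
    LinearEquiv.coe_coe]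
  rw [smash_tmul_mul_tmul hact, hT, smashT₂_tmul, smashT₂_tmul, comulAB_mulLeft hcomp,
    comulAB_tmul, ← hT]
  let R := twist HA.toMultiplierHopfAlgebra act
  refine forall_of_tmul (f := (smashEquiv HA act).toLinearMap.lTensor _ ∘ₗ
    contractRight (comulAB HA HB act Γ ∘ₗ (TensorProduct.mk ℂ _ _).flip
      ((mulRight ℂ b').lTensor A (R (b ⊗ₜ a'))))
        (LinearMap.rTensorHom B ∘ₗ LinearMap.mul ℂ A).flip)
    (g := rightMul T.toLinearMap (smashEquiv HA act (a' ⊗ₜ b')) ∘ₗ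
      (smashEquiv HA act).toLinearMap.lTensor _ ∘ₗ legs₁₃ (comulB HA HB act) ∘ₗ
        (TensorProduct.mk ℂ _ B).flip b) (fun w' a₁ => ?_) _
  simp only [LinearMap.comp_apply, contractRight_tmul, LinearMap.flip_apply,
    TensorProduct.mk_apply, LinearMap.flip_flip, legs₁₃_tmul]
  rw [comulAB_mulRight, ← hcomp.twist_legs₁₃_comulA hact hΓ.toIsLeftCoaction]
  refine forall_of_tmul (f := (smashEquiv HA act).toLinearMap.lTensor _ ∘ₗ
    ((LinearMap.mul ℂ A a₁).rTensor B).lTensor _ ∘ₗ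
      contractRight (comulB HA HB act ∘ₗ (TensorProduct.mk ℂ _ B).flip b')
        (LinearMap.lTensorHom A ∘ₗ (LinearMap.mul ℂ B).flip) ∘ₗ R.lTensor _ ∘ₗ
          legs₁₃ (comulA HA act Γ) ∘ₗ (TensorProduct.mk ℂ _ A).flip a')
    (g := rightMul T.toLinearMap (smashEquiv HA act (a' ⊗ₜ b')) ∘ₗ
      (smashEquiv HA act).toLinearMap.lTensor _ ∘ₗ (TensorProduct.mk ℂ A B a₁).lTensor _)
    (fun w'' b₁ => ?_) _
  simp only [LinearMap.comp_apply, LinearMap.flip_apply, TensorProduct.mk_apply, legs₁₃_tmul,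
    LinearMap.lTensor_tmul, LinearEquiv.coe_coe, MultiplierHopf.rightMul_tmul]
  rw [hT, smashT₂_tmul, comulAB_tmul]
  refine forall_of_tmul (f := (smashEquiv HA act).toLinearMap.lTensor _ ∘ₗ
    ((LinearMap.mul ℂ A a₁).rTensor B).lTensor _ ∘ₗ
      contractRight (comulB HA HB act ∘ₗ (TensorProduct.mk ℂ _ B).flip b')
        (LinearMap.lTensorHom A ∘ₗ (LinearMap.mul ℂ B).flip) ∘ₗ R.lTensor _ ∘ₗ
          (TensorProduct.mk ℂ B A b₁).lTensor _)
    (g := (mulLeft ℂ (smashEquiv HA act (a₁ ⊗ₜ b₁))).lTensor _ ∘ₗ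
      (smashEquiv HA act).toLinearMap.lTensor _ ∘ₗ legs₁₃ (comulB HA HB act) ∘ₗ
        (TensorProduct.mk ℂ _ B).flip b')
    (fun v p => ?_) _
  simp only [LinearMap.comp_apply, LinearMap.flip_apply, TensorProduct.mk_apply, legs₁₃_tmul,
    LinearMap.lTensor_tmul, contractRight_tmul]
  simp only [← LinearMap.lTensor_comp_apply]
  congr 2
  ext q
  simp only [LinearMap.comp_apply, TensorProduct.mk_apply, LinearEquiv.coe_coe,
    LinearMap.mulLeft_apply, smash_tmul_mul_tmul hact]
  rfl

end SmashCanonical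

/-! ### Coassociativity of the smash coproduct -/

section Extend

variable {X Y Z U A B E : Type*} [AddCommGroup X] [AddCommGroup Y] [AddCommGroup Z]
  [AddCommGroup U] [AddCommGroup A] [AddCommGroup B] [AddCommGroup E] [Module ℂ X] [Module ℂ Y]
  [Module ℂ Z] [Module ℂ U] [Module ℂ A] [Module ℂ B] [Module ℂ E]

/-- `K ⊗ ι : A ⊗ B ⊗ E → X ⊗ A ⊗ B ⊗ E` for a map `K : A ⊗ B → X ⊗ A ⊗ B`. -/
noncomputable def extendRight (E : Type*) [AddCommGroup E] [Module ℂ E]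
    (K : A ⊗[ℂ] B →ₗ[ℂ] X ⊗[ℂ] (Y ⊗[ℂ] Z)) :
    A ⊗[ℂ] (B ⊗[ℂ] E) →ₗ[ℂ] X ⊗[ℂ] (Y ⊗[ℂ] (Z ⊗[ℂ] E)) :=
  (assoc ℂ Y Z E).toLinearMap.lTensor X ∘ₗ (assoc ℂ X (Y ⊗[ℂ] Z) E).toLinearMap ∘ₗ K.rTensor E ∘ₗ
    (assoc ℂ A B E).symm.toLinearMap

theorem extendRight_tmul (K : A ⊗[ℂ] B →ₗ[ℂ] X ⊗[ℂ] (Y ⊗[ℂ] Z)) (a : A) (b : B) (y : E) :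
    extendRight E K (a ⊗ₜ (b ⊗ₜ y)) =
      ((assoc ℂ Y Z E).toLinearMap ∘ₗ (TensorProduct.mk ℂ (Y ⊗[ℂ] Z) E).flip y).lTensor X
        (K (a ⊗ₜ b)) := by
  simp only [extendRight, LinearMap.comp_apply, LinearEquiv.coe_coe, TensorProduct.assoc_symm_tmul,
    LinearMap.rTensor_tmul]
  exact forall_of_tmul (f := (assoc ℂ Y Z E).toLinearMap.lTensor X ∘ₗ
    (assoc ℂ X (Y ⊗[ℂ] Z) E).toLinearMap ∘ₗ (TensorProduct.mk ℂ (X ⊗[ℂ] (Y ⊗[ℂ] Z)) E).flip y)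
    (fun x t => by simp) _

/-- Linear maps out of `X ⊗ Y ⊗ Z` that agree on the pure tensors agree. -/
theorem forall_of_tmul_tmul {f g : X ⊗[ℂ] (Y ⊗[ℂ] Z) →ₗ[ℂ] U}
    (h : ∀ x y z, f (x ⊗ₜ (y ⊗ₜ z)) = g (x ⊗ₜ (y ⊗ₜ z))) (t : X ⊗[ℂ] (Y ⊗[ℂ] Z)) : f t = g t :=
  forall_of_tmul (fun x s => forall_of_tmul (f := f ∘ₗ TensorProduct.mk ℂ X (Y ⊗[ℂ] Z) x)
    (g := g ∘ₗ TensorProduct.mk ℂ X (Y ⊗[ℂ] Z) x) (fun y z => h x y z) s) t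

theorem extendRight_comp_rTensor {W : Type*} [AddCommGroup W] [Module ℂ W]
    (L : W ⊗[ℂ] B →ₗ[ℂ] X ⊗[ℂ] (Y ⊗[ℂ] Z)) (k : A →ₗ[ℂ] W) (t : A ⊗[ℂ] (B ⊗[ℂ] E)) :
    extendRight E (L ∘ₗ k.rTensor B) t = extendRight E L (k.rTensor _ t) :=
  forall_of_tmul_tmul (f := extendRight E (L ∘ₗ k.rTensor B)) (g := extendRight E L ∘ₗ k.rTensor _)
    (fun a b y => by
      rw [LinearMap.comp_apply, LinearMap.rTensor_tmul, extendRight_tmul, extendRight_tmul,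
        LinearMap.comp_apply, LinearMap.rTensor_tmul]) t

end Extend

section Coassoc

variable {A : Type*} [NonUnitalNonAssocRing A] [Module ℂ A] [IsScalarTower ℂ A A]
  [SMulCommClass ℂ A A]
variable {B : Type*} [NonUnitalNonAssocRing B] [Module ℂ B] [IsScalarTower ℂ B B]
  [SMulCommClass ℂ B B]
variable {M N : Type*} [AddCommGroup M] [AddCommGroup N] [Module ℂ M] [Module ℂ N]
variable {HA : RegularMultiplierHopfAlgebra A} {HB : RegularMultiplierHopfAlgebra B}
  {act : B →ₗ[ℂ] A →ₗ[ℂ] B} {Γ : A →ₗ[ℂ] LeftCompletion A B}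
  (hact : IsRightModuleAlgebra HA.toMultiplierHopfAlgebra act)
  (hΓ : IsLeftComoduleCoalgebra HA HB Γ) (hcomp : IsCompatible HA HB act Γ)

include hΓ in
theorem lTensor_cotwist₁₂_extendRight (c : B) (t : A ⊗[ℂ] (B ⊗[ℂ] M)) :
    (hΓ.cotwist₁₂ M).toLinearMap.lTensor B (extendRight M (cotwistComul Γ HB c) t) =
      assoc ℂ B B _ ((HB.canonicalPair.t₂ c).rTensor _ (hΓ.cotwist₁₂ M t)) := by
  refine forall_of_tmul_tmul (f := (hΓ.cotwist₁₂ M).toLinearMap.lTensor B ∘ₗ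
      extendRight M (cotwistComul Γ HB c))
    (g := (assoc ℂ B B _).toLinearMap ∘ₗ (HB.canonicalPair.t₂ c).rTensor _ ∘ₗ
      (hΓ.cotwist₁₂ M).toLinearMap) (fun a b y => ?_) t
  simp only [LinearMap.comp_apply, LinearEquiv.coe_coe, extendRight_tmul,
    IsLeftCoaction.cotwist₁₂_tmul]
  have h1 : (hΓ.cotwist₁₂ M).toLinearMap ∘ₗ (assoc ℂ A B M).toLinearMap ∘ₗ
      (TensorProduct.mk ℂ (A ⊗[ℂ] B) M).flip y =
      ((assoc ℂ B A M).toLinearMap ∘ₗ (TensorProduct.mk ℂ (B ⊗[ℂ] A) M).flip y) ∘ₗ cotwist Γ := by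
    ext p q
    simp [IsLeftCoaction.cotwist₁₂_tmul]
  rw [← LinearMap.lTensor_comp_apply, h1, LinearMap.lTensor_comp_apply, hΓ.cotwist_cotwistComul]
  refine forall_of_tmul (f := ((assoc ℂ B A M).toLinearMap ∘ₗ
      (TensorProduct.mk ℂ (B ⊗[ℂ] A) M).flip y).lTensor B ∘ₗ (assoc ℂ B B A).toLinearMap ∘ₗ
        (HB.canonicalPair.t₂ c).rTensor A)
    (g := (assoc ℂ B B _).toLinearMap ∘ₗ (HB.canonicalPair.t₂ c).rTensor _ ∘ₗ
      (assoc ℂ B A M).toLinearMap ∘ₗ (TensorProduct.mk ℂ (B ⊗[ℂ] A) M).flip y) (fun p q => ?_) _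
  simp only [LinearMap.comp_apply, LinearMap.rTensor_tmul, LinearEquiv.coe_coe,
    LinearMap.flip_apply, TensorProduct.mk_apply, TensorProduct.assoc_tmul]
  exact forall_of_tmul (f := ((assoc ℂ B A M).toLinearMap ∘ₗ
      (TensorProduct.mk ℂ (B ⊗[ℂ] A) M).flip y).lTensor B ∘ₗ (assoc ℂ B B A).toLinearMap ∘ₗ
        (TensorProduct.mk ℂ (B ⊗[ℂ] B) A).flip q)
    (g := (assoc ℂ B B _).toLinearMap ∘ₗ (TensorProduct.mk ℂ (B ⊗[ℂ] B) (A ⊗[ℂ] M)).flip (q ⊗ₜ y))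
    (fun u v => by simp) _

/-- The map `a ⊗ b ⊗ m ↦ ∑ a₍₁₎ ⊗ Γ(a₍₂₎)(b ⊗ m)` commutes with
`a ⊗ b ↦ ∑ c a₍₋₁₎ b₍₁₎ ⊗ a₍₀₎ ⊗ b₍₂₎`. Conjugation by `T` turns the two maps into
`a ⊗ m ↦ ∑ a₍₁₎ ⊗ a₍₂₎m` and `b ↦ ∑ c b₍₁₎ ⊗ b₍₂₎`, which act on different legs. -/
theorem IsLeftComoduleCoalgebra.extendRight_cotwistComul (ψ : A ⊗[ℂ] N ≃ₗ[ℂ] M) (c : B)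
    (t : A ⊗[ℂ] (B ⊗[ℂ] M)) : extendRight M (cotwistComul Γ HB c) (hΓ.comulCoact ψ t) =
      (hΓ.comulCoact ψ).toLinearMap.lTensor B (extendRight M (cotwistComul Γ HB c) t) := by
  apply ((hΓ.cotwist₁₂ M).lTensor B).injective
  change (hΓ.cotwist₁₂ M).toLinearMap.lTensor B _ = (hΓ.cotwist₁₂ M).toLinearMap.lTensor B _
  have h1 : (hΓ.cotwist₁₂ M).toLinearMap ∘ₗ (hΓ.comulCoact ψ).toLinearMap =
      (HA.canonicalPair.freeT₁ ψ).toLinearMap.lTensor B ∘ₗ (hΓ.cotwist₁₂ M).toLinearMap :=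
    LinearMap.ext fun t => hΓ.cotwist₁₂_comulCoact ψ t
  rw [lTensor_cotwist₁₂_extendRight hΓ, hΓ.cotwist₁₂_comulCoact, ← LinearMap.lTensor_comp_apply, h1,
    LinearMap.lTensor_comp_apply, lTensor_cotwist₁₂_extendRight hΓ, rTensor_lTensor, assoc_lTensor]

include hact in
/-- The map `a ⊗ b ⊗ m ↦ ∑ a₍₁₎ ⊗ Γ(a₍₂₎)(b ⊗ m)` commutes with `pMapComul β`. Both maps become
simpler after applying `T` to the legs in `A ⊗ B`, which reduces this to
`IsLeftComoduleCoalgebra.extendRight_cotwistComul`. -/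
theorem IsLeftComoduleCoalgebra.extendRight_pMapComul (ψ : A ⊗[ℂ] N ≃ₗ[ℂ] M) (β : B)
    (t : A ⊗[ℂ] (B ⊗[ℂ] M)) : extendRight M (pMapComul HA HB act Γ β) (hΓ.comulCoact ψ t) =
      (hΓ.comulCoact ψ).toLinearMap.lTensor B (extendRight M (pMapComul HA HB act Γ β) t) := by
  refine forall_of_tmul_tmul (f := extendRight M (pMapComul HA HB act Γ β) ∘ₗ
    (hΓ.comulCoact ψ).toLinearMap) (g := (hΓ.comulCoact ψ).toLinearMap.lTensor B ∘ₗ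
      extendRight M (pMapComul HA HB act Γ β)) (fun a b m => ?_) t
  set L := extendRight M (legs₁₃ (Z := A) HB.canonicalPair.T₂.toLinearMap) with hL
  let F := (hΓ.comulCoact ψ).toLinearMap ∘ₗ (TensorProduct.mk ℂ A (B ⊗[ℂ] M)).flip (b ⊗ₜ m)
  have h1 := hact.pMap_rTensor (Γ := Γ) (F := F) (f := coact Γ ψ b m)
    (fun c a => hΓ.comulCoact_cover ψ c a b m) β a
  have h2 : ∀ k : A →ₗ[ℂ] B ⊗[ℂ] A, ∀ t, extendRight M
      (legs₁₃ HB.canonicalPair.T₂.toLinearMap ∘ₗ k.rTensor B) t = L (k.rTensor _ t) := fun k t =>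
    extendRight_comp_rTensor _ _ _
  simp only [LinearMap.comp_apply, LinearEquiv.coe_coe]
  rw [pMapComul, h2, h2, LinearMap.rTensor_tmul, LinearMap.comp_apply, TensorProduct.mk_apply,
    pMap_tmul]
  refine (congrArg L h1).trans ?_
  refine forall_of_tmul (f := L ∘ₗ (cotwistOp Γ ∘ₗ (comm ℂ B A).toLinearMap).rTensor _ ∘ₗ
      (assoc ℂ B A (B ⊗[ℂ] M)).symm.toLinearMap ∘ₗ F.lTensor B)
    (g := (hΓ.comulCoact ψ).toLinearMap.lTensor B ∘ₗ L ∘ₗ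
      (TensorProduct.mk ℂ (B ⊗[ℂ] A) (B ⊗[ℂ] M)).flip (b ⊗ₜ m) ∘ₗ cotwistOp Γ ∘ₗ
        (comm ℂ B A).toLinearMap) (fun c a' => ?_) _
  simp only [LinearMap.comp_apply, LinearMap.lTensor_tmul, LinearEquiv.coe_coe,
    TensorProduct.comm_tmul, LinearMap.flip_apply, TensorProduct.mk_apply]
  have h3 := hΓ.extendRight_cotwistComul ψ c (a' ⊗ₜ (b ⊗ₜ m))
  rw [cotwistComul, h2, h2, LinearMap.rTensor_tmul] at h3
  refine Eq.trans (congrArg L ?_) h3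
  change _ = (cotwistOp Γ ∘ₗ (TensorProduct.mk ℂ A B).flip c).rTensor _ (F a')
  exact forall_of_tmul (f := (cotwistOp Γ ∘ₗ (comm ℂ B A).toLinearMap).rTensor _ ∘ₗ
      (assoc ℂ B A (B ⊗[ℂ] M)).symm.toLinearMap ∘ₗ TensorProduct.mk ℂ B _ c)
    (g := (cotwistOp Γ ∘ₗ (TensorProduct.mk ℂ A B).flip c).rTensor _) (fun x y => by simp) _

include hact in
/-- The part of the coassociativity of the smash product that concerns `A`: right multiplication
by the coproduct commutes with `a ⊗ b ⊗ m ↦ ∑ a₍₁₎ ⊗ Γ(a₍₂₎)(b ⊗ m)`. -/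
theorem IsLeftComoduleCoalgebra.extendRight_comulAB (ψ : A ⊗[ℂ] N ≃ₗ[ℂ] M)
    (w : SmashProduct HA act) (t : A ⊗[ℂ] (B ⊗[ℂ] M)) :
    extendRight M (comulAB HA HB act Γ ∘ₗ TensorProduct.mk ℂ _ _ w) (hΓ.comulCoact ψ t) =
      (hΓ.comulCoact ψ).toLinearMap.lTensor _
        (extendRight M (comulAB HA HB act Γ ∘ₗ TensorProduct.mk ℂ _ _ w) t) := by
  let X : SmashProduct HA act → A ⊗[ℂ] (B ⊗[ℂ] M) →ₗ[ℂ] _ := fun w =>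
    extendRight M (comulAB HA HB act Γ ∘ₗ TensorProduct.mk ℂ _ _ w)
  have hX : ∀ t, ∃ Y : SmashProduct HA act →ₗ[ℂ]
      SmashProduct HA act ⊗[ℂ] (A ⊗[ℂ] (B ⊗[ℂ] M)), ∀ w, Y w = X w t := fun t => by
    refine ⟨⟨⟨fun w => X w t, fun x y => ?_⟩, fun r x => ?_⟩, fun w => rfl⟩
    · simp only [X, extendRight, map_add, LinearMap.comp_add, LinearMap.rTensor_add,
        LinearMap.add_comp, LinearMap.add_apply]
    · simp only [X, extendRight, map_smul, LinearMap.comp_smul, LinearMap.rTensor_smul,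
        LinearMap.smul_comp, LinearMap.smul_apply, RingHom.id_apply]
  obtain ⟨Y, hY⟩ := hX (hΓ.comulCoact ψ t)
  obtain ⟨Y', hY'⟩ := hX t
  change X w _ = (hΓ.comulCoact ψ).toLinearMap.lTensor _ (X w t)
  rw [← hY, ← hY']
  refine forall_of_equiv (smashEquiv HA act)
    (g := (hΓ.comulCoact ψ).toLinearMap.lTensor _ ∘ₗ Y') (fun α β => ?_) w
  rw [LinearMap.comp_apply, hY, hY']
  have h1 : ∀ v, X (smashEquiv HA act (α ⊗ₜ β)) v = smashLeft HA act _
      ((extendRight M (pMapComul HA HB act Γ β)).lTensor A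
        (assoc ℂ A A _ ((HA.canonicalPair.t₂ α).rTensor _ v))) := by
    refine forall_of_tmul_tmul (f := X (smashEquiv HA act (α ⊗ₜ β)))
      (g := (smashLeft HA act _).toLinearMap ∘ₗ
        (extendRight M (pMapComul HA HB act Γ β)).lTensor A ∘ₗ (assoc ℂ A A _).toLinearMap ∘ₗ
          (HA.canonicalPair.t₂ α).rTensor _) fun a b m => ?_
    simp only [X, extendRight_tmul, LinearMap.comp_apply, TensorProduct.mk_apply,
      comulAB_smashEquiv, LinearMap.rTensor_tmul, LinearEquiv.coe_coe]
    rw [← smashLeft_lTensor, ← LinearMap.lTensor_comp_apply]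
    congr 1
    refine forall_of_tmul (g := (extendRight M (pMapComul HA HB act Γ β)).lTensor A ∘ₗ
      (assoc ℂ A A _).toLinearMap ∘ₗ (TensorProduct.mk ℂ (A ⊗[ℂ] A) (B ⊗[ℂ] M)).flip (b ⊗ₜ m))
      (f := (LinearMap.lTensor B ((assoc ℂ A B M).toLinearMap ∘ₗ
        (TensorProduct.mk ℂ (A ⊗[ℂ] B) M).flip m) ∘ₗ pMapComul HA HB act Γ β).lTensor A ∘ₗ
        (assoc ℂ A A B).toLinearMap ∘ₗ (TensorProduct.mk ℂ (A ⊗[ℂ] A) B).flip b)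
      (fun p q => ?_) _
    simp [extendRight_tmul]
  rw [h1, h1]
  refine forall_of_tmul_tmul (f := (smashLeft HA act _).toLinearMap ∘ₗ
      (extendRight M (pMapComul HA HB act Γ β)).lTensor A ∘ₗ (assoc ℂ A A _).toLinearMap ∘ₗ
        (HA.canonicalPair.t₂ α).rTensor _ ∘ₗ (hΓ.comulCoact ψ).toLinearMap)
    (g := (hΓ.comulCoact ψ).toLinearMap.lTensor _ ∘ₗ (smashLeft HA act _).toLinearMap ∘ₗ
      (extendRight M (pMapComul HA HB act Γ β)).lTensor A ∘ₗ (assoc ℂ A A _).toLinearMap ∘ₗ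
        (HA.canonicalPair.t₂ α).rTensor _) (fun a b m => ?_) t
  simp only [LinearMap.comp_apply, LinearEquiv.coe_coe, LinearMap.rTensor_tmul]
  have h2 := HA.canonicalPair.assoc_t₂_rTensor (F := (hΓ.comulCoact ψ).toLinearMap ∘ₗ
    (TensorProduct.mk ℂ A (B ⊗[ℂ] M)).flip (b ⊗ₜ m)) (f := coact Γ ψ b m)
    (fun c a => hΓ.comulCoact_cover ψ c a b m) α a
  have h3 : extendRight M (pMapComul HA HB act Γ β) ∘ₗ (hΓ.comulCoact ψ).toLinearMap =
      (hΓ.comulCoact ψ).toLinearMap.lTensor B ∘ₗ extendRight M (pMapComul HA HB act Γ β) :=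
    LinearMap.ext fun t => hΓ.extendRight_pMapComul hact ψ β t
  rw [LinearMap.comp_apply, LinearMap.flip_apply, TensorProduct.mk_apply, LinearEquiv.coe_coe] at h2
  rw [h2, ← LinearMap.lTensor_comp_apply, ← LinearMap.comp_assoc, h3, LinearMap.comp_assoc,
    LinearMap.lTensor_comp_apply, smashLeft_lTensor, lTensor_assoc_tmul]

/-- The part of the coassociativity of the smash product that concerns `B`. -/
theorem assoc_comulB_freeT₁ (ψ : B ⊗[ℂ] N ≃ₗ[ℂ] M) (w : SmashProduct HA act) (b : B) (m : M) :
    assoc ℂ _ B M ((comulB HA HB act ∘ₗ TensorProduct.mk ℂ _ B w).rTensor M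
      (HB.canonicalPair.freeT₁ ψ (b ⊗ₜ m))) =
      ((HB.canonicalPair.freeT₁ ψ).toLinearMap ∘ₗ (TensorProduct.mk ℂ B M).flip m).lTensor _
        (comulB HA HB act (w ⊗ₜ b)) := by
  set G := HB.canonicalPair
  have hl : ∀ s : B ⊗[ℂ] M, ∃ Y : SmashProduct HA act →ₗ[ℂ] SmashProduct HA act ⊗[ℂ] (B ⊗[ℂ] M),
      ∀ w, Y w = assoc ℂ _ B M ((comulB HA HB act ∘ₗ TensorProduct.mk ℂ _ B w).rTensor M s) :=
    fun s => ⟨(assoc ℂ _ B M).toLinearMap ∘ₗ LinearMap.flip (LinearMap.rTensorHom M ∘ₗ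
      TensorProduct.curry (comulB HA HB act)) s, fun w => rfl⟩
  obtain ⟨Y, hY⟩ := hl (G.freeT₁ ψ (b ⊗ₜ m))
  rw [← hY]
  refine forall_of_equiv (smashEquiv HA act) (g := ((G.freeT₁ ψ).toLinearMap ∘ₗ
    (TensorProduct.mk ℂ B M).flip m).lTensor _ ∘ₗ comulB HA HB act ∘ₗ
      (TensorProduct.mk ℂ _ B).flip b) (fun α β => ?_) w
  simp only [hY, LinearMap.comp_apply, LinearMap.flip_apply, TensorProduct.mk_apply, comulB_tmul]
  rw [← smashLeft_lTensor, LinearMap.lTensor_tmul, ← G.assoc_t₂_freeT₁]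
  generalize G.freeT₁ ψ (b ⊗ₜ m) = s
  refine forall_of_tmul (f := (assoc ℂ _ B M).toLinearMap ∘ₗ
    (comulB HA HB act ∘ₗ TensorProduct.mk ℂ _ B (smashEquiv HA act (α ⊗ₜ β))).rTensor M)
    (g := (smashLeft HA act _).toLinearMap ∘ₗ TensorProduct.mk ℂ A _ α ∘ₗ
      (assoc ℂ B B M).toLinearMap ∘ₗ (G.t₂ β).rTensor M) (fun b m => ?_) s
  simp only [LinearMap.comp_apply, LinearMap.rTensor_tmul, LinearEquiv.coe_coe,
    TensorProduct.mk_apply, comulB_tmul]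
  exact forall_of_tmul (f := (assoc ℂ _ B M).toLinearMap ∘ₗ
    (TensorProduct.mk ℂ (SmashProduct HA act ⊗[ℂ] B) M).flip m ∘ₗ
      (smashLeft HA act B).toLinearMap ∘ₗ TensorProduct.mk ℂ A _ α)
    (g := (smashLeft HA act _).toLinearMap ∘ₗ TensorProduct.mk ℂ A _ α ∘ₗ
      (assoc ℂ B B M).toLinearMap ∘ₗ (TensorProduct.mk ℂ (B ⊗[ℂ] B) M).flip m)
    (fun x y => by simp [smashLeft]) _

/-- Coassociativity of the smash coproduct,
`((w ⊗ 1)Δ ⊗ ι)(Δ(x)(1 ⊗ y)) = (ι ⊗ Δ)((w ⊗ 1)Δ(x))(1 ⊗ 1 ⊗ y)`. -/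
theorem assoc_smashT₂_smashT₁ (w x y : SmashProduct HA act) :
    assoc ℂ _ _ _ (((smashT₂ hact hΓ hcomp).toLinearMap ∘ₗ TensorProduct.mk ℂ _ _ w).rTensor _
      (smashT₁ hact hΓ (x ⊗ₜ y))) =
      ((smashT₁ hact hΓ).toLinearMap ∘ₗ (TensorProduct.mk ℂ _ _).flip y).lTensor _
        (smashT₂ hact hΓ hcomp (w ⊗ₜ x)) := by
  set φ := smashEquiv HA act with hφ
  set W := hΓ.comulCoact φ with hW
  set V := HB.canonicalPair.freeT₁ hact.smashEquiv' with hV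
  refine forall_of_equiv φ (f := (assoc ℂ _ _ _).toLinearMap ∘ₗ
    ((smashT₂ hact hΓ hcomp).toLinearMap ∘ₗ TensorProduct.mk ℂ _ _ w).rTensor _ ∘ₗ
      (smashT₁ hact hΓ).toLinearMap ∘ₗ (TensorProduct.mk ℂ _ _).flip y)
    (g := ((smashT₁ hact hΓ).toLinearMap ∘ₗ (TensorProduct.mk ℂ _ _).flip y).lTensor _ ∘ₗ
      (smashT₂ hact hΓ hcomp).toLinearMap ∘ₗ TensorProduct.mk ℂ _ _ w) (fun a b => ?_) x
  simp only [LinearMap.comp_apply, LinearMap.flip_apply, TensorProduct.mk_apply,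
    LinearEquiv.coe_coe]
  rw [smashT₁_tmul, smashT₂_tmul]
  set D := comulAB HA HB act Γ ∘ₗ TensorProduct.mk ℂ _ _ w with hD
  have h1 : ∀ t, assoc ℂ _ _ _ (((smashT₂ hact hΓ hcomp).toLinearMap ∘ₗ
      TensorProduct.mk ℂ _ _ w).rTensor _ (smashLeft HA act (SmashProduct HA act) t)) =
      (smashLeft HA act (SmashProduct HA act)).toLinearMap.lTensor _
        (extendRight (SmashProduct HA act) D t) := by
    refine forall_of_tmul_tmul (f := (assoc ℂ _ _ _).toLinearMap ∘ₗ
      ((smashT₂ hact hΓ hcomp).toLinearMap ∘ₗ TensorProduct.mk ℂ _ _ w).rTensor _ ∘ₗ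
        (smashLeft HA act (SmashProduct HA act)).toLinearMap)
      (g := (smashLeft HA act (SmashProduct HA act)).toLinearMap.lTensor _ ∘ₗ
        extendRight (SmashProduct HA act) D) fun a b y => ?_
    have h2 : smashLeft HA act (SmashProduct HA act) (a ⊗ₜ (b ⊗ₜ y)) = φ (a ⊗ₜ b) ⊗ₜ[ℂ] y := by
      simp [smashLeft, hφ]
    simp only [LinearMap.comp_apply, LinearEquiv.coe_coe, h2, LinearMap.rTensor_tmul,
      TensorProduct.mk_apply, hφ, smashT₂_tmul, extendRight_tmul]
    refine forall_of_tmul (f := (assoc ℂ (SmashProduct HA act) (SmashProduct HA act)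
        (SmashProduct HA act)).toLinearMap ∘ₗ
        (TensorProduct.mk ℂ (SmashProduct HA act ⊗[ℂ] SmashProduct HA act)
          (SmashProduct HA act)).flip y ∘ₗ
          (smashEquiv HA act).toLinearMap.lTensor _)
      (g := (smashLeft HA act (SmashProduct HA act)).toLinearMap.lTensor (SmashProduct HA act) ∘ₗ
        ((assoc ℂ A B (SmashProduct HA act)).toLinearMap ∘ₗ
        (TensorProduct.mk ℂ (A ⊗[ℂ] B) (SmashProduct HA act)).flip y).lTensor _)
      (fun u v => ?_) (comulAB HA HB act Γ (w ⊗ₜ (a ⊗ₜ b)))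
    simp [smashLeft]
  rw [h1, hΓ.extendRight_comulAB hact]
  let U : SmashProduct HA act ⊗[ℂ] (B ⊗[ℂ] SmashProduct HA act) →ₗ[ℂ]
      SmashProduct HA act ⊗[ℂ] (B ⊗[ℂ] SmashProduct HA act) :=
    (assoc ℂ _ _ _).toLinearMap ∘ₗ (comulB HA HB act).rTensor _ ∘ₗ (assoc ℂ _ _ _).symm.toLinearMap
  have hU : ∀ w s, U (w ⊗ₜ s) = assoc ℂ _ _ _
      ((comulB HA HB act ∘ₗ TensorProduct.mk ℂ _ B w).rTensor _ s) := fun w =>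
    forall_of_tmul (f := U ∘ₗ TensorProduct.mk ℂ _ _ w) (g := (assoc ℂ _ _ _).toLinearMap ∘ₗ
      (comulB HA HB act ∘ₗ TensorProduct.mk ℂ _ B w).rTensor _) fun b y => by simp [U]
  have h3 : ∀ s, extendRight (SmashProduct HA act) D (a ⊗ₜ s) =
      legs₁₃ U (comulA HA act Γ (w ⊗ₜ a) ⊗ₜ s) := by
    refine forall_of_tmul (f := extendRight (SmashProduct HA act) D ∘ₗ TensorProduct.mk ℂ A _ a)
      (g := legs₁₃ U ∘ₗ TensorProduct.mk ℂ _ _ (comulA HA act Γ (w ⊗ₜ a))) fun b y => ?_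
    simp only [LinearMap.comp_apply, TensorProduct.mk_apply, extendRight_tmul, hD, comulAB_tmul]
    refine forall_of_tmul (f := ((assoc ℂ A B _).toLinearMap ∘ₗ
        (TensorProduct.mk ℂ (A ⊗[ℂ] B) (SmashProduct HA act)).flip y).lTensor _ ∘ₗ
          legs₁₃ (comulB HA HB act) ∘ₗ (TensorProduct.mk ℂ _ B).flip b)
      (g := legs₁₃ U ∘ₗ (TensorProduct.mk ℂ _ _).flip (b ⊗ₜ y)) (fun w' a' => ?_) _
    simp only [LinearMap.comp_apply, LinearMap.flip_apply, TensorProduct.mk_apply, legs₁₃_tmul, hU,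
      LinearMap.rTensor_tmul]
    refine forall_of_tmul (f := ((assoc ℂ A B _).toLinearMap ∘ₗ
        (TensorProduct.mk ℂ (A ⊗[ℂ] B) (SmashProduct HA act)).flip y).lTensor _ ∘ₗ
          (TensorProduct.mk ℂ A B a').lTensor _)
      (g := (TensorProduct.mk ℂ A _ a').lTensor _ ∘ₗ (assoc ℂ _ _ _).toLinearMap ∘ₗ
        (TensorProduct.mk ℂ (SmashProduct HA act ⊗[ℂ] B) _).flip y) (fun u v => ?_)
        (comulB HA HB act (w' ⊗ₜ b))
    simp
  rw [h3, comulAB_tmul]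
  refine forall_of_tmul (f := (smashLeft HA act (SmashProduct HA act)).toLinearMap.lTensor _ ∘ₗ
      W.toLinearMap.lTensor _ ∘ₗ legs₁₃ U ∘ₗ (TensorProduct.mk ℂ _ _).flip (V (b ⊗ₜ y)))
    (g := ((smashT₁ hact hΓ).toLinearMap ∘ₗ (TensorProduct.mk ℂ _ _).flip y).lTensor _ ∘ₗ
      φ.toLinearMap.lTensor _ ∘ₗ legs₁₃ (comulB HA HB act) ∘ₗ (TensorProduct.mk ℂ _ B).flip b)
    (fun w' a' => ?_) _
  simp only [LinearMap.comp_apply, LinearMap.flip_apply, TensorProduct.mk_apply, legs₁₃_tmul, hU]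
  rw [hV, assoc_comulB_freeT₁]
  simp only [← LinearMap.lTensor_comp_apply]
  congr 2

end Coassoc

/-! ### Compatibility of the two canonical maps -/

section Compat

variable {A : Type*} [NonUnitalNonAssocRing A] [Module ℂ A] [IsScalarTower ℂ A A]
  [SMulCommClass ℂ A A]
variable {B : Type*} [NonUnitalNonAssocRing B] [Module ℂ B] [IsScalarTower ℂ B B]
  [SMulCommClass ℂ B B]
variable {M N : Type*} [AddCommGroup M] [AddCommGroup N] [Module ℂ M] [Module ℂ N]
variable {HA : RegularMultiplierHopfAlgebra A} {HB : RegularMultiplierHopfAlgebra B}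
  {act : B →ₗ[ℂ] A →ₗ[ℂ] B} {Γ : A →ₗ[ℂ] LeftCompletion A B}
  (hact : IsRightModuleAlgebra HA.toMultiplierHopfAlgebra act)
  (hΓ : IsLeftComoduleCoalgebra HA HB Γ) (hcomp : IsCompatible HA HB act Γ)

/-- The map `β ⊗ p ⊗ b ⊗ m ↦ (β ◁ p)b ⊗ m`. -/
noncomputable def actMul (act : B →ₗ[ℂ] A →ₗ[ℂ] B) (M : Type*) [AddCommGroup M] [Module ℂ M] :
    B ⊗[ℂ] (A ⊗[ℂ] (B ⊗[ℂ] M)) →ₗ[ℂ] B ⊗[ℂ] M :=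
  (mul' ℂ B).rTensor M ∘ₗ (assoc ℂ B B M).symm.toLinearMap ∘ₗ (lift act).rTensor (B ⊗[ℂ] M) ∘ₗ
    (assoc ℂ B A (B ⊗[ℂ] M)).symm.toLinearMap

theorem actMul_tmul (β : B) (p : A) (s : B ⊗[ℂ] M) :
    actMul act M (β ⊗ₜ (p ⊗ₜ s)) = (mulLeft ℂ (act β p)).rTensor M s :=
  forall_of_tmul (f := actMul act M ∘ₗ TensorProduct.mk ℂ B _ β ∘ₗ TensorProduct.mk ℂ A _ p)
    (g := (mulLeft ℂ (act β p)).rTensor M) (fun b m => by simp [actMul]) s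

include hact in
/-- `∑ (β ◁ a₍₁₎ ⊗ 1)Γ(a₍₂₎)(b ⊗ m) = P(β ⊗ a)(b ⊗ m)`. -/
theorem actMul_comulCoact (ψ : A ⊗[ℂ] N ≃ₗ[ℂ] M) (β : B) (a : A) (b : B) (m : M) :
    actMul act M (β ⊗ₜ hΓ.comulCoact ψ (a ⊗ₜ (b ⊗ₜ m))) =
      TensorProduct.map (mulRight ℂ b) ((freeAct ψ).flip m) (pMap HA act Γ (β ⊗ₜ a)) := by
  refine LinearMap.congr_fun (hact.hom_ext (f := actMul act M ∘ₗ (TensorProduct.mk ℂ B _).flip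
      (hΓ.comulCoact ψ (a ⊗ₜ (b ⊗ₜ m))))
    (g := TensorProduct.map (mulRight ℂ b) ((freeAct ψ).flip m) ∘ₗ pMap HA act Γ ∘ₗ
      (TensorProduct.mk ℂ B A).flip a) fun β e => ?_) β
  simp only [LinearMap.comp_apply, LinearMap.flip_apply, TensorProduct.mk_apply]
  have h1 : ∀ v : A ⊗[ℂ] (B ⊗[ℂ] M), actMul act M (act β e ⊗ₜ v) =
      actMul act M (β ⊗ₜ (mulLeft ℂ e).rTensor _ v) :=
    forall_of_tmul (f := actMul act M ∘ₗ TensorProduct.mk ℂ B _ (act β e))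
      (g := actMul act M ∘ₗ TensorProduct.mk ℂ B _ β ∘ₗ (mulLeft ℂ e).rTensor _) fun p s => by
      simp only [LinearMap.comp_apply, TensorProduct.mk_apply, LinearMap.rTensor_tmul, actMul_tmul,
        LinearMap.mulLeft_apply]
      rw [hact.act_mul]
  rw [h1, hΓ.comulCoact_cover, pMap_tmul, hact.actComul_act]
  refine forall_of_tmul (f := actMul act M ∘ₗ TensorProduct.mk ℂ B _ β ∘ₗ
      (coact Γ ψ b m).lTensor A)
    (g := TensorProduct.map (mulRight ℂ b) ((freeAct ψ).flip m) ∘ₗ cotwistOp Γ ∘ₗ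
      (comm ℂ B A).toLinearMap ∘ₗ (act β).rTensor A) (fun u u' => ?_) _
  simp only [LinearMap.comp_apply, TensorProduct.mk_apply, LinearMap.lTensor_tmul, actMul_tmul,
    coact_apply, LinearMap.rTensor_tmul, LinearEquiv.coe_coe, TensorProduct.comm_tmul]
  rw [rTensor_lTensor, cotwist_compat, ← LinearMap.comp_apply, LinearMap.lTensor_comp_rTensor]

include hact in
theorem mulLeft_smashLeft (α : A) (β : B) (v : A ⊗[ℂ] (B ⊗[ℂ] M)) :
    (mulLeft ℂ (smashEquiv HA act (α ⊗ₜ β))).rTensor M (smashLeft HA act M v) =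
      smashLeft HA act M ((actMul act M ∘ₗ TensorProduct.mk ℂ B _ β).lTensor A
        (assoc ℂ A A _ ((HA.canonicalPair.t₂ α).rTensor _ v))) := by
  refine forall_of_tmul_tmul (f := (mulLeft ℂ (smashEquiv HA act (α ⊗ₜ β))).rTensor M ∘ₗ
      (smashLeft HA act M).toLinearMap)
    (g := (smashLeft HA act M).toLinearMap ∘ₗ
      (actMul act M ∘ₗ TensorProduct.mk ℂ B _ β).lTensor A ∘ₗ
      (assoc ℂ A A _).toLinearMap ∘ₗ (HA.canonicalPair.t₂ α).rTensor _) (fun p q m => ?_) v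
  have h : smashLeft HA act M (p ⊗ₜ (q ⊗ₜ m)) = smashEquiv HA act (p ⊗ₜ q) ⊗ₜ[ℂ] m := by
    simp [smashLeft]
  simp only [LinearMap.comp_apply, LinearEquiv.coe_coe, h, LinearMap.rTensor_tmul,
    LinearMap.mulLeft_apply]
  rw [smash_tmul_mul_tmul hact, rTensor_lTensor, hact.twist_cover, ← LinearMap.lTensor_comp_apply]
  refine forall_of_tmul (f := (TensorProduct.mk ℂ (SmashProduct HA act) M).flip m ∘ₗ
      (smashEquiv HA act).toLinearMap ∘ₗ (mulRight ℂ q ∘ₗ act β).lTensor A)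
    (g := (smashLeft HA act M).toLinearMap ∘ₗ
      (actMul act M ∘ₗ TensorProduct.mk ℂ B _ β).lTensor A ∘ₗ (assoc ℂ A A _).toLinearMap ∘ₗ
        (TensorProduct.mk ℂ (A ⊗[ℂ] A) (B ⊗[ℂ] M)).flip (q ⊗ₜ m)) (fun u u' => ?_) _
  simp [actMul_tmul, smashLeft]

include hact in
/-- `(w ⊗ 1)(∑ (a₍₁₎ ⊗ 1)Γ(a₍₂₎)(b ⊗ y))`, computed in two ways. -/
theorem mulLeft_comulCoact (w y : SmashProduct HA act) (a : A) (b : B) :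
    (mulLeft ℂ w).rTensor _ (smashLeft HA act _
      (hΓ.comulCoact (smashEquiv HA act) (a ⊗ₜ (b ⊗ₜ y)))) =
      TensorProduct.map (rB HA act b) ((lA HA act).flip y) (comulA HA act Γ (w ⊗ₜ a)) := by
  refine forall_of_equiv (smashEquiv HA act)
    (f := (LinearMap.rTensorHom _ ∘ₗ LinearMap.mul ℂ (SmashProduct HA act)).flip
      (smashLeft HA act _ (hΓ.comulCoact (smashEquiv HA act) (a ⊗ₜ (b ⊗ₜ y)))))
    (g := TensorProduct.map (rB HA act b) ((lA HA act).flip y) ∘ₗ comulA HA act Γ ∘ₗ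
      (TensorProduct.mk ℂ _ A).flip a) (fun α β => ?_) w
  change (mulLeft ℂ (smashEquiv HA act (α ⊗ₜ β))).rTensor _ _ = _
  rw [mulLeft_smashLeft hact]
  simp only [LinearMap.comp_apply, LinearMap.flip_apply, TensorProduct.mk_apply, comulA_tmul]
  have h2 := HA.canonicalPair.assoc_t₂_rTensor (F := (hΓ.comulCoact (smashEquiv HA act)).toLinearMap
    ∘ₗ (TensorProduct.mk ℂ A _).flip (b ⊗ₜ y)) (f := coact Γ (smashEquiv HA act) b y)
    (fun c a => hΓ.comulCoact_cover _ c a b y) α a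
  rw [LinearMap.comp_apply, LinearMap.flip_apply, TensorProduct.mk_apply, LinearEquiv.coe_coe] at h2
  rw [h2]
  refine forall_of_tmul (f := (smashLeft HA act _).toLinearMap ∘ₗ
      (actMul act _ ∘ₗ TensorProduct.mk ℂ B _ β).lTensor A ∘ₗ
        ((hΓ.comulCoact (smashEquiv HA act)).toLinearMap ∘ₗ
          (TensorProduct.mk ℂ A _).flip (b ⊗ₜ y)).lTensor A)
    (g := TensorProduct.map (rB HA act b) ((lA HA act).flip y) ∘ₗ
      (smashLeft HA act A).toLinearMap ∘ₗ
      (pMap HA act Γ ∘ₗ TensorProduct.mk ℂ B A β).lTensor A) (fun u a' => ?_) _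
  simp only [LinearMap.comp_apply, LinearMap.lTensor_tmul, LinearEquiv.coe_coe,
    LinearMap.flip_apply, TensorProduct.mk_apply, actMul_comulCoact hact hΓ]
  refine forall_of_tmul (f := (smashLeft HA act _).toLinearMap ∘ₗ TensorProduct.mk ℂ A _ u ∘ₗ
      TensorProduct.map (mulRight ℂ b) ((lA HA act).flip y))
    (g := TensorProduct.map (rB HA act b) ((lA HA act).flip y) ∘ₗ
      (smashLeft HA act A).toLinearMap ∘ₗ
      TensorProduct.mk ℂ A _ u) (fun x z => ?_) _
  simp [smashLeft, rB_tmul]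

/-- `(w ⊗ 1)(∑ b₍₁₎ ⊗ b₍₂₎y)`, computed in two ways. -/
theorem rB_freeT₁ (w y : SmashProduct HA act) (b : B) :
    ((rB HA act).flip w).rTensor _ (HB.canonicalPair.freeT₁ hact.smashEquiv' (b ⊗ₜ y)) =
      (hact.lB.flip y).lTensor _ (comulB HA HB act (w ⊗ₜ b)) := by
  refine forall_of_equiv (smashEquiv HA act)
    (f := (LinearMap.rTensorHom _ ∘ₗ (rB HA act).flip).flip
      (HB.canonicalPair.freeT₁ hact.smashEquiv' (b ⊗ₜ y)))
    (g := (hact.lB.flip y).lTensor _ ∘ₗ comulB HA HB act ∘ₗ (TensorProduct.mk ℂ _ B).flip b)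
    (fun α β => ?_) w
  simp only [LinearMap.comp_apply, LinearMap.flip_apply, TensorProduct.mk_apply, comulB_tmul]
  rw [← smashLeft_lTensor, LinearMap.lTensor_tmul]
  have h := HB.canonicalPair.freeT₁_cover hact.smashEquiv' β b y
  refine Eq.trans ?_ (congrArg (fun t => smashLeft HA act _ (α ⊗ₜ t)) h)
  refine forall_of_tmul (f := ((rB HA act).flip (smashEquiv HA act (α ⊗ₜ β))).rTensor _)
    (g := (smashLeft HA act _).toLinearMap ∘ₗ TensorProduct.mk ℂ A _ α ∘ₗ (mulLeft ℂ β).rTensor _)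
    (fun x z => ?_) _
  simp [smashLeft, rB_tmul]

/-- `((w ⊗ 1)Δ(x))(1 ⊗ y) = (w ⊗ 1)(Δ(x)(1 ⊗ y))` for the smash product: the maps `smashT₁` and
`smashT₂` come from one coproduct. -/
theorem smash_compat (w x y : SmashProduct HA act) :
    (mulLeft ℂ w).rTensor _ (smashT₁ hact hΓ (x ⊗ₜ y)) =
      (mulRight ℂ y).lTensor _ (smashT₂ hact hΓ hcomp (w ⊗ₜ x)) := by
  refine forall_of_equiv (smashEquiv HA act) (f := (mulLeft ℂ w).rTensor _ ∘ₗ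
      (smashT₁ hact hΓ).toLinearMap ∘ₗ (TensorProduct.mk ℂ _ _).flip y)
    (g := (mulRight ℂ y).lTensor _ ∘ₗ (smashT₂ hact hΓ hcomp).toLinearMap ∘ₗ
      TensorProduct.mk ℂ _ _ w) (fun a b => ?_) x
  simp only [LinearMap.comp_apply, LinearMap.flip_apply, TensorProduct.mk_apply,
    LinearEquiv.coe_coe]
  rw [smashT₁_tmul, smashT₂_tmul, comulAB_tmul]
  let Z : (SmashProduct HA act ⊗[ℂ] A) ⊗[ℂ] (B ⊗[ℂ] SmashProduct HA act) →ₗ[ℂ]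
      SmashProduct HA act ⊗[ℂ] SmashProduct HA act :=
    TensorProduct.map (lift (rB HA act).flip) (lift (lA HA act)) ∘ₗ
      (TensorProduct.tensorTensorTensorComm ℂ _ A B _).toLinearMap
  have hZ : ∀ w' a' s, Z ((w' ⊗ₜ a') ⊗ₜ s) =
      (lA HA act a').lTensor _ (((rB HA act).flip w').rTensor _ s) := fun w' a' =>
    forall_of_tmul (f := Z ∘ₗ TensorProduct.mk ℂ _ _ (w' ⊗ₜ a'))
      (g := (lA HA act a').lTensor _ ∘ₗ ((rB HA act).flip w').rTensor _) fun b y => by simp [Z]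
  have h1 : ∀ s, (mulLeft ℂ w).rTensor _ (smashLeft HA act _
      (hΓ.comulCoact (smashEquiv HA act) (a ⊗ₜ s))) = Z (comulA HA act Γ (w ⊗ₜ a) ⊗ₜ s) := by
    refine forall_of_tmul (f := (mulLeft ℂ w).rTensor _ ∘ₗ (smashLeft HA act _).toLinearMap ∘ₗ
        (hΓ.comulCoact (smashEquiv HA act)).toLinearMap ∘ₗ TensorProduct.mk ℂ A _ a)
      (g := Z ∘ₗ TensorProduct.mk ℂ _ _ (comulA HA act Γ (w ⊗ₜ a))) fun b y => ?_
    simp only [LinearMap.comp_apply, TensorProduct.mk_apply, LinearEquiv.coe_coe]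
    rw [mulLeft_comulCoact hact hΓ]
    exact forall_of_tmul (f := TensorProduct.map (rB HA act b) ((lA HA act).flip y))
      (g := Z ∘ₗ (TensorProduct.mk ℂ _ _).flip (b ⊗ₜ y)) (fun w' a' => by simp [Z]) _
  rw [h1]
  refine forall_of_tmul (f := Z ∘ₗ (TensorProduct.mk ℂ _ _).flip
      (HB.canonicalPair.freeT₁ hact.smashEquiv' (b ⊗ₜ y)))
    (g := (mulRight ℂ y).lTensor _ ∘ₗ (smashEquiv HA act).toLinearMap.lTensor _ ∘ₗ
      legs₁₃ (comulB HA HB act) ∘ₗ (TensorProduct.mk ℂ _ B).flip b) (fun w' a' => ?_) _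
  simp only [LinearMap.comp_apply, LinearMap.flip_apply, TensorProduct.mk_apply, hZ, legs₁₃_tmul]
  rw [rB_freeT₁]
  simp only [← LinearMap.lTensor_comp_apply]
  congr 2
  ext b'
  exact (hact.tmul_mul a' b' y).symm

end Compat

/-! ### The multiplier Hopf algebra structure of the smash product -/

section SmashHopf

variable {A : Type*} [NonUnitalNonAssocRing A] [Module ℂ A] [IsScalarTower ℂ A A]
  [SMulCommClass ℂ A A]
variable {B : Type*} [NonUnitalNonAssocRing B] [Module ℂ B] [IsScalarTower ℂ B B]
  [SMulCommClass ℂ B B]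
variable {HA : RegularMultiplierHopfAlgebra A} {HB : RegularMultiplierHopfAlgebra B}
  {act : B →ₗ[ℂ] A →ₗ[ℂ] B} {Γ : A →ₗ[ℂ] LeftCompletion A B}
  (hact : IsRightModuleAlgebra HA.toMultiplierHopfAlgebra act)
  (hΓ : IsLeftComoduleCoalgebra HA HB Γ) (hcomp : IsCompatible HA HB act Γ)

/-- The canonical maps of the smash product. -/
noncomputable def smashPair : CanonicalPair (SmashProduct HA act) where
  mul_assoc := hact.smash_mul_assoc HB.canonicalPair
  eq_zero_of_mul := hact.smash_eq_zero_of_mul HB.canonicalPair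
  eq_zero_of_mul' := hact.smash_eq_zero_of_mul' HB.canonicalPair
  T₁ := smashT₁ hact hΓ
  T₂ := smashT₂ hact hΓ hcomp
  compat := smash_compat hact hΓ hcomp
  T₂_mul := smashT₂_mul hact hΓ hcomp
  coassoc w x y := by
    apply (assoc ℂ _ _ _).injective
    rw [LinearEquiv.apply_symm_apply, lTensor_assoc_tmul, ← assoc_smashT₂_smashT₁ hact hΓ hcomp]
    exact forall_of_tmul (f := (assoc ℂ _ _ _).toLinearMap ∘ₗ
      (smashT₂ hact hΓ hcomp).toLinearMap.rTensor _ ∘ₗ (assoc ℂ _ _ _).symm.toLinearMap ∘ₗ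
        TensorProduct.mk ℂ _ _ w)
      (g := (assoc ℂ _ _ _).toLinearMap ∘ₗ
        ((smashT₂ hact hΓ hcomp).toLinearMap ∘ₗ TensorProduct.mk ℂ _ _ w).rTensor _)
      (fun u v => by simp) _

theorem smashPair_t₁ (x y : SmashProduct HA act) :
    (smashPair hact hΓ hcomp).t₁ y x = smashT₁ hact hΓ (x ⊗ₜ y) := rfl

theorem smashCounit_tmul (a : A) (b : B) : smashCounit HA HB act (smashEquiv HA act (a ⊗ₜ b)) =
    HA.canonicalPair.counit a * HB.canonicalPair.counit b := by
  rw [← HA.counit_eq, ← HB.counit_eq]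
  simp [smashCounit]

theorem smashCounit_eq : smashCounit HA HB act = (smashPair hact hΓ hcomp).counit := by
  refine (smashPair hact hΓ hcomp).eq_counit fun x y => ?_
  set εA := HA.canonicalPair.counit with hεA
  set εB := HB.canonicalPair.counit with hεB
  refine forall_of_equiv (smashEquiv HA act) (f := (lid ℂ _).toLinearMap ∘ₗ
    (smashCounit HA HB act).rTensor _ ∘ₗ (smashPair hact hΓ hcomp).t₁ y) (g := mulRight ℂ y)
    (fun a b => ?_) x
  simp only [LinearMap.comp_apply, LinearEquiv.coe_coe, LinearMap.mulRight_apply, smashPair_t₁,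
    smashT₁_tmul, hact.tmul_mul]
  have h1 : ∀ t, lid ℂ _ ((smashCounit HA HB act).rTensor _ (smashLeft HA act _ t)) =
      lid ℂ (SmashProduct HA act) (εB.rTensor _ (lid ℂ _ (εA.rTensor _ t))) :=
    forall_of_tmul_tmul (f := (lid ℂ _).toLinearMap ∘ₗ (smashCounit HA HB act).rTensor _ ∘ₗ
        (smashLeft HA act _).toLinearMap)
      (g := (lid ℂ _).toLinearMap ∘ₗ εB.rTensor _ ∘ₗ (lid ℂ _).toLinearMap ∘ₗ εA.rTensor _)
      fun a b m => by
        have h : smashLeft HA act (SmashProduct HA act) (a ⊗ₜ (b ⊗ₜ m)) =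
            smashEquiv HA act (a ⊗ₜ b) ⊗ₜ[ℂ] m := by simp [smashLeft]
        simp only [LinearMap.comp_apply, LinearEquiv.coe_coe, h, LinearMap.rTensor_tmul,
          smashCounit_tmul, TensorProduct.lid_tmul, map_smul, smul_smul]
        rfl
  have h2 : ∀ s, lid ℂ (SmashProduct HA act) (εB.rTensor _ (lid ℂ _ (εA.rTensor _
      (hΓ.comulCoact (smashEquiv HA act) (a ⊗ₜ s))))) = lA HA act a (lid ℂ _ (εB.rTensor _ s)) := by
    refine forall_of_tmul (f := (lid ℂ _).toLinearMap ∘ₗ εB.rTensor _ ∘ₗ (lid ℂ _).toLinearMap ∘ₗ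
        εA.rTensor _ ∘ₗ (hΓ.comulCoact (smashEquiv HA act)).toLinearMap ∘ₗ TensorProduct.mk ℂ A _ a)
      (g := lA HA act a ∘ₗ (lid ℂ _).toLinearMap ∘ₗ εB.rTensor _) fun b m => ?_
    simp only [LinearMap.comp_apply, LinearEquiv.coe_coe, TensorProduct.mk_apply,
      LinearMap.rTensor_tmul, TensorProduct.lid_tmul, map_smul]
    rw [hεA, hΓ.counit_comulCoact, coact_apply, ← LinearMap.smul_apply, ← map_smul,
      ← hΓ.counit_cotwist]
    exact forall_of_tmul (f := (lid ℂ _).toLinearMap ∘ₗ εB.rTensor _ ∘ₗ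
        ((freeAct (smashEquiv HA act)).flip m).lTensor B)
      (g := (lA HA act).flip m ∘ₗ (lid ℂ _).toLinearMap ∘ₗ εB.rTensor _)
      (fun q p => by simp [lA]) _
  rw [h1, h2, hεB, CanonicalPair.counit_freeT₁]
  rfl

theorem smashAntipode_smashEquiv (t : A ⊗[ℂ] B) :
    smashAntipode HA HB act Γ (smashEquiv HA act t) =
      hact.smashEquiv' (TensorProduct.map HB.antipode HA.antipode (cotwist Γ t)) := rfl

/-- Since `S(pq)` is computed from `T(p ⊗ q)`, and `T` turns `comulCoact` into the map
`a ⊗ m ↦ ∑ a₍₁₎ ⊗ a₍₂₎m`, the identity `∑ S(x₍₁₎)x₍₂₎y = ε(x)y` for `x = ab` is that of `A`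
followed by that of `B`. -/
theorem isAntipode_smashAntipode :
    (smashPair hact hΓ hcomp).IsAntipode (smashAntipode HA HB act Γ) := by
  refine CanonicalPair.isAntipode_of_left _ fun x y => ?_
  rw [← smashCounit_eq]
  refine forall_of_equiv (smashEquiv HA act) (f := mul' ℂ _ ∘ₗ
    (smashAntipode HA HB act Γ).rTensor _ ∘ₗ (smashPair hact hΓ hcomp).t₁ y)
    (g := LinearMap.toSpanSingleton ℂ _ y ∘ₗ smashCounit HA HB act) (fun a b => ?_) x
  simp only [LinearMap.comp_apply, smashPair_t₁, smashT₁_tmul, smashCounit_tmul,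
    LinearMap.toSpanSingleton_apply]
  set E := SmashProduct HA act
  set SA := HA.antipode
  set SB := HB.antipode
  -- `Ω (q ⊗ p ⊗ m) = S(q) S(p) m`
  let Ω : B ⊗[ℂ] (A ⊗[ℂ] E) →ₗ[ℂ] E :=
    lift (hact.lB ∘ₗ SB) ∘ₗ (lift (lA HA act) ∘ₗ SA.rTensor E).lTensor B
  have h1 : ∀ t, mul' ℂ E ((smashAntipode HA HB act Γ).rTensor E (smashLeft HA act E t)) =
      Ω (hΓ.cotwist₁₂ E t) := by
    refine forall_of_tmul_tmul (f := mul' ℂ E ∘ₗ (smashAntipode HA HB act Γ).rTensor E ∘ₗ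
      (smashLeft HA act E).toLinearMap) (g := Ω ∘ₗ (hΓ.cotwist₁₂ E).toLinearMap) fun p q m => ?_
    have h : smashLeft HA act E (p ⊗ₜ (q ⊗ₜ m)) = smashEquiv HA act (p ⊗ₜ q) ⊗ₜ[ℂ] m := by
      simp [smashLeft]
    simp only [LinearMap.comp_apply, LinearEquiv.coe_coe, h, LinearMap.rTensor_tmul,
      smashAntipode_smashEquiv hact, LinearMap.mul'_apply, IsLeftCoaction.cotwist₁₂_tmul]
    refine forall_of_tmul (f := mulRight ℂ m ∘ₗ hact.smashEquiv'.toLinearMap ∘ₗ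
        TensorProduct.map SB SA)
      (g := Ω ∘ₗ (assoc ℂ B A E).toLinearMap ∘ₗ (TensorProduct.mk ℂ (B ⊗[ℂ] A) E).flip m)
      (fun q p => ?_) _
    simp [Ω, hact.smashEquiv'_tmul_mul]
  have h2 : ∀ s, Ω ((HA.canonicalPair.freeT₁ (smashEquiv HA act)).toLinearMap.lTensor B
      (hΓ.cotwist₁₂ E (a ⊗ₜ s))) =
      HA.canonicalPair.counit a • lift hact.lB (SB.rTensor E s) := by
    refine forall_of_tmul (f := Ω ∘ₗ
        (HA.canonicalPair.freeT₁ (smashEquiv HA act)).toLinearMap.lTensor B ∘ₗ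
          (hΓ.cotwist₁₂ E).toLinearMap ∘ₗ TensorProduct.mk ℂ A _ a)
      (g := HA.canonicalPair.counit a • (lift hact.lB ∘ₗ SB.rTensor E)) fun b m => ?_
    simp only [LinearMap.comp_apply, LinearEquiv.coe_coe, TensorProduct.mk_apply,
      LinearMap.smul_apply, LinearMap.rTensor_tmul, lift.tmul, IsLeftCoaction.cotwist₁₂_tmul]
    rw [← LinearMap.smul_apply, ← map_smul, ← map_smul, ← hΓ.counit_lTensor_cotwist]
    refine forall_of_tmul (f := Ω ∘ₗ
        (HA.canonicalPair.freeT₁ (smashEquiv HA act)).toLinearMap.lTensor B ∘ₗ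
          (assoc ℂ B A E).toLinearMap ∘ₗ (TensorProduct.mk ℂ (B ⊗[ℂ] A) E).flip m)
      (g := hact.lB.flip m ∘ₗ SB ∘ₗ (rid ℂ B).toLinearMap ∘ₗ HA.canonicalPair.counit.lTensor B)
      (fun q p => ?_) _
    simp only [LinearMap.comp_apply, LinearEquiv.coe_coe, LinearMap.flip_apply,
      TensorProduct.mk_apply, TensorProduct.assoc_tmul, LinearMap.lTensor_tmul, Ω, lift.tmul,
      TensorProduct.rid_tmul, map_smul]
    rw [lA, CanonicalPair.antipode_freeT₁ _ _ HA.isAntipode_antipode, map_smul]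
  rw [h1, hΓ.cotwist₁₂_comulCoact, h2, IsRightModuleAlgebra.lB,
    CanonicalPair.antipode_freeT₁ _ _ HB.isAntipode_antipode, smul_smul]

include hact hΓ in
theorem smashAntipode_bijective : Function.Bijective (smashAntipode HA HB act Γ) := by
  have h1 : Function.Bijective (TensorProduct.map HB.antipode HA.antipode) :=
    (TensorProduct.congr (LinearEquiv.ofBijective _ HB.antipode_bijective)
      (LinearEquiv.ofBijective _ HA.antipode_bijective)).bijective
  exact hact.smashEquiv'.bijective.comp (h1.comp
    (hΓ.cotwist_bijective.comp (smashEquiv HA act).symm.bijective))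

/-- The smash product has an opposite pair of canonical maps because its antipode is bijective. -/
theorem exists_isOpposite_smashPair : ∃ G', (smashPair hact hΓ hcomp).IsOpposite G' :=
  (smashPair hact hΓ hcomp).exists_isOpposite
    (LinearEquiv.ofBijective _ (smashAntipode_bijective hact hΓ))
    (isAntipode_smashAntipode hact hΓ hcomp)

theorem lA_rTensor_smashLeft {X : Type*} [AddCommGroup X] [Module ℂ X] (a : A)
    (t : A ⊗[ℂ] (B ⊗[ℂ] X)) : (lA HA act a).rTensor X (smashLeft HA act X t) =
      smashLeft HA act X ((mulLeft ℂ a).rTensor _ t) :=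
  forall_of_tmul_tmul (f := (lA HA act a).rTensor X ∘ₗ (smashLeft HA act X).toLinearMap)
    (g := (smashLeft HA act X).toLinearMap ∘ₗ (mulLeft ℂ a).rTensor _)
    (fun p q m => by simp [smashLeft, lA_tmul]) t

/-- `(a' ⊗ 1)Δ(ab)(1 ⊗ b'v)` is determined by `(a' ⊗ 1)Δ(a) ⊗ Δ(b)(1 ⊗ b')`. -/
theorem lA_smashT₁_lB (a a' : A) (b b' : B) (v : SmashProduct HA act) :
    (lA HA act a').rTensor _ (smashT₁ hact hΓ (smashEquiv HA act (a ⊗ₜ b) ⊗ₜ hact.lB b' v)) =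
      (mulRight ℂ v).lTensor _ (TensorProduct.map (smashEquiv HA act).toLinearMap
        (smashEquiv HA act).toLinearMap (middle (cotwist Γ)
          (HA.canonicalPair.t₂ a' a ⊗ₜ HB.canonicalPair.t₁ b' b))) := by
  rw [smashT₁_tmul, lA_rTensor_smashLeft, IsRightModuleAlgebra.lB, CanonicalPair.freeT₁_freeAct]
  set Ψ := (mulRight ℂ v).lTensor (SmashProduct HA act) ∘ₗ
    TensorProduct.map (smashEquiv HA act).toLinearMap (smashEquiv HA act).toLinearMap ∘ₗ
      middle (cotwist Γ) with hΨ
  refine forall_of_tmul (f := (smashLeft HA act _).toLinearMap ∘ₗ (mulLeft ℂ a').rTensor _ ∘ₗ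
      (hΓ.comulCoact (smashEquiv HA act)).toLinearMap ∘ₗ TensorProduct.mk ℂ A _ a ∘ₗ
        ((freeAct hact.smashEquiv').flip v).lTensor B)
    (g := Ψ ∘ₗ TensorProduct.mk ℂ _ _ (HA.canonicalPair.t₂ a' a)) (fun b₁ b₂ => ?_) _
  simp only [LinearMap.comp_apply, LinearEquiv.coe_coe, TensorProduct.mk_apply,
    LinearMap.lTensor_tmul, LinearMap.flip_apply]
  rw [hΓ.comulCoact_cover]
  refine forall_of_tmul (f := (smashLeft HA act _).toLinearMap ∘ₗ
      (coact Γ (smashEquiv HA act) b₁ (hact.lB b₂ v)).lTensor A)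
    (g := Ψ ∘ₗ (TensorProduct.mk ℂ (A ⊗[ℂ] A) (B ⊗[ℂ] B)).flip (b₁ ⊗ₜ b₂)) (fun a₁ a₂ => ?_) _
  simp only [LinearMap.comp_apply, LinearEquiv.coe_coe, TensorProduct.mk_apply, Ψ, middle,
    LinearMap.lTensor_tmul, LinearMap.flip_apply, coact_apply, TensorProduct.assoc_tmul,
    TensorProduct.assoc_symm_tmul, LinearMap.rTensor_tmul]
  refine forall_of_tmul (f := (smashLeft HA act _).toLinearMap ∘ₗ TensorProduct.mk ℂ A _ a₁ ∘ₗ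
      ((lA HA act).flip (hact.lB b₂ v)).lTensor B)
    (g := (mulRight ℂ v).lTensor (SmashProduct HA act) ∘ₗ
      TensorProduct.map (smashEquiv HA act).toLinearMap (smashEquiv HA act).toLinearMap ∘ₗ
        (assoc ℂ A B (A ⊗[ℂ] B)).symm.toLinearMap ∘ₗ TensorProduct.mk ℂ A _ a₁ ∘ₗ
          (assoc ℂ B A B).toLinearMap ∘ₗ (TensorProduct.mk ℂ (B ⊗[ℂ] A) B).flip b₂)
    (fun q p => ?_) _
  simp [smashLeft, hact.tmul_mul]

include hact in
theorem lA_mul (a : A) (x y : SmashProduct HA act) :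
    lA HA act a (x * y) = lA HA act a x * y :=
  forall_of_equiv (smashEquiv HA act) (f := lA HA act a ∘ₗ mulRight ℂ y)
    (g := mulRight ℂ y ∘ₗ lA HA act a) (fun α β => by
      simp only [LinearMap.comp_apply, LinearMap.mulRight_apply, lA_tmul, hact.tmul_mul]
      exact (HA.canonicalPair.freeAct_mul _ _ _ _).symm) x

/-- The smash coproduct as a linear map. -/
noncomputable def smashComul : SmashProduct HA act →ₗ[ℂ]
    Multiplier (SmashProduct HA act ⊗[ℂ] SmashProduct HA act) :=
  LinearMapClass.linearMap (smashPair hact hΓ hcomp).comul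

theorem isSmashCoproduct_smashComul :
    IsSmashCoproduct HA HB act Γ (smashComul hact hΓ hcomp) := by
  intro a a' b b' z
  set G := smashPair hact hΓ hcomp
  change (lA HA act a').rTensor _ (leftMul G.T₁.toLinearMap (smashEquiv HA act (a ⊗ₜ b))
    ((Smash.leftB _ act b').lTensor _ z)) = _
  rw [hact.leftB_eq]
  set X := TensorProduct.map (smashEquiv HA act).toLinearMap
        (smashEquiv HA act).toLinearMap (middle (cotwist Γ)
          (HA.canonicalPair.t₂ a' a ⊗ₜ HB.canonicalPair.t₁ b' b)) with hX
  change _ = X * z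
  refine forall_of_tmul (f := (lA HA act a').rTensor _ ∘ₗ
    leftMul G.T₁.toLinearMap (smashEquiv HA act (a ⊗ₜ b)) ∘ₗ (hact.lB b').lTensor _)
    (g := mulLeft ℂ X) (fun u v => ?_) z
  rw [LinearMap.mulLeft_apply, CanonicalPair.mul_tmul, hX, ← lA_smashT₁_lB hact hΓ]
  simp only [LinearMap.comp_apply, LinearMap.lTensor_tmul, G.leftMul_tmul]
  rw [← LinearMap.rTensor_comp_apply, ← LinearMap.rTensor_comp_apply]
  congr 2
  ext x
  exact lA_mul hact a' x u

include hact in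
/-- Every element of `AB` is a sum of products `bx` with `b` in `B` and `x` in `AB`. -/
theorem lift_lB_surjective (GB : CanonicalPair B) : Function.Surjective (lift hact.lB) := by
  intro x
  obtain ⟨t, rfl⟩ := hact.smashEquiv'.surjective x
  induction t using TensorProduct.induction_on with
  | zero => exact ⟨0, by simp⟩
  | add x y hx hy =>
    obtain ⟨s, hs⟩ := hx
    obtain ⟨t, ht⟩ := hy
    exact ⟨s + t, by rw [map_add, hs, ht, map_add]⟩
  | tmul b a =>
    obtain ⟨s, rfl⟩ := GB.mul'_surjective b
    refine ⟨((hact.smashEquiv'.toLinearMap ∘ₗ (TensorProduct.mk ℂ B A).flip a)).lTensor B s, ?_⟩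
    exact forall_of_tmul (f := lift hact.lB ∘ₗ
      (hact.smashEquiv'.toLinearMap ∘ₗ (TensorProduct.mk ℂ B A).flip a).lTensor B)
      (g := hact.smashEquiv'.toLinearMap ∘ₗ (TensorProduct.mk ℂ B A).flip a ∘ₗ mul' ℂ B)
      (fun b b' => by simp [hact.lB_smashEquiv'_tmul]) s

include hact hΓ hcomp in
theorem IsSmashCoproduct.unique {Δ Δ' : SmashProduct HA act →ₗ[ℂ]
    Multiplier (SmashProduct HA act ⊗[ℂ] SmashProduct HA act)}
    (h : IsSmashCoproduct HA HB act Γ Δ) (h' : IsSmashCoproduct HA HB act Γ Δ') : Δ = Δ' := by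
  have key : ∀ a b, Δ (smashEquiv HA act (a ⊗ₜ b)) = Δ' (smashEquiv HA act (a ⊗ₜ b)) := ?_
  · refine LinearMap.ext fun x => ?_
    obtain ⟨t, rfl⟩ := (smashEquiv HA act).surjective x
    induction t using TensorProduct.induction_on with
    | zero => simp
    | add x y hx hy => simp only [map_add, hx, hy]
    | tmul a b => exact key a b
  intro a b
  refine (smashPair hact hΓ hcomp).ext_lmul fun t => ?_
  refine forall_of_tmul (fun u v => ?_) t
  obtain ⟨s, rfl⟩ := lift_lB_surjective hact HB.canonicalPair v
  refine forall_of_tmul (f := lmul (Δ (smashEquiv HA act (a ⊗ₜ b))) ∘ₗ TensorProduct.mk ℂ _ _ u ∘ₗ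
    lift hact.lB) (g := lmul (Δ' (smashEquiv HA act (a ⊗ₜ b))) ∘ₗ TensorProduct.mk ℂ _ _ u ∘ₗ
    lift hact.lB) (fun b' v => ?_) s
  refine eq_of_forall_rTensor (fun a' : A => lA HA act a')
    (HA.canonicalPair.eq_zero_of_freeAct (smashEquiv HA act)) fun a' => ?_
  have h1 := h a a' b b' (u ⊗ₜ v)
  rw [← h' a a' b b' (u ⊗ₜ v), hact.leftB_eq] at h1
  exact h1

end SmashHopf

end MultiplierHopf

theorem theorem4p1 {A : Type*} [NonUnitalRing A] [Module ℂ A] [IsScalarTower ℂ A A]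
    [SMulCommClass ℂ A A] {B : Type*} [NonUnitalRing B] [Module ℂ B] [IsScalarTower ℂ B B]
    [SMulCommClass ℂ B B]
    (HA : MultiplierHopf.RegularMultiplierHopfAlgebra A)
    (HB : MultiplierHopf.RegularMultiplierHopfAlgebra B)
    (act : B →ₗ[ℂ] A →ₗ[ℂ] B)
    (hact : MultiplierHopf.IsRightModuleAlgebra HA.toMultiplierHopfAlgebra act)
    (Γ : A →ₗ[ℂ] MultiplierHopf.LeftCompletion A B)
    (hΓ : MultiplierHopf.IsLeftComoduleCoalgebra HA HB Γ)
    (hcomp : MultiplierHopf.IsCompatible HA HB act Γ) :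
    (∃! Δ, MultiplierHopf.IsSmashCoproduct HA HB act Γ Δ) ∧
    ∀ Δ, MultiplierHopf.IsSmashCoproduct HA HB act Γ Δ →
      ∃ H : MultiplierHopf.RegularMultiplierHopfAlgebra (MultiplierHopf.SmashProduct HA act),
        (∀ x, H.comul x = Δ x) ∧
        H.IsCounit (MultiplierHopf.smashCounit HA HB act) ∧
        H.IsAntipode (MultiplierHopf.smashCounit HA HB act)
          (MultiplierHopf.smashAntipode HA HB act Γ) := by
  refine ⟨⟨MultiplierHopf.smashComul hact hΓ hcomp,
    MultiplierHopf.isSmashCoproduct_smashComul hact hΓ hcomp,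
    fun Δ h => h.unique hact hΓ hcomp
      (MultiplierHopf.isSmashCoproduct_smashComul hact hΓ hcomp)⟩, fun Δ h => ?_⟩
  obtain ⟨G', hG⟩ := MultiplierHopf.exists_isOpposite_smashPair hact hΓ hcomp
  rw [h.unique hact hΓ hcomp (MultiplierHopf.isSmashCoproduct_smashComul hact hΓ hcomp),
    MultiplierHopf.smashCounit_eq hact hΓ hcomp]
  exact ⟨MultiplierHopf.CanonicalPair.toRegular _ hG, fun _ => rfl,
    (MultiplierHopf.smashPair hact hΓ hcomp).toMultiplierHopfAlgebra.isCounit_counit,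
    (MultiplierHopf.smashPair hact hΓ hcomp).toMultiplierHopfAlgebra.isAntipode_of
      (MultiplierHopf.isAntipode_smashAntipode hact hΓ hcomp)⟩
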